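/- Let $(X,x_0)$ be a based (abstract) simplicial complex; spatial realizations $|\cdot|$ carry the weak topology. Let $\Omega X$ be the simplicial complex whose vertices are all edge loops $l=(x_0=v_0,v_1,\dots,v_m=x_0)$ of $X$ based at $x_0$, of all lengths $m\ge 0$ (adjacent vertices are equal or span an edge); a finite non-empty set of loops $\{l^0,\dots,l^n\}$ is a simplex if, for some $m$, at least one of them has length $m$, all have length $m$ or $m-1$, and, after those of length $m-1$ are extended by one repeat of $x_0$, the set $\{l^0(i),\dots,l^n(i),l^0(i+1),\dots,l^n(i+1)\}$ is a simplex of $X$ for every $0\le i\le m-1$. Let $\Omega X(k)$ be the full subcomplex of $\Omega X$ on the loops of length at most $k$. A chain of length $k$ is a sequence of simplices $\{x_0\}=\sigma_0,\sigma_1,\dots,\sigma_{k-1},\sigma_k=\{x_0\}$ of $X$ such that $\sigma_i\cup\sigma_{i+1}$ is a simplex for $0\le i\le k-1$. Stone's space $N(k)$ is the set of all points $(x_1,\dots,x_{k-1})\in|X|^{k-1}$ for which there is such a chain with $x_i\in|\sigma_i|$ for all $i$; it is a cell complex with the weak topology with respect to the closed cells $|\sigma_1|\times\dots\times|\sigma_{k-1}|$.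 For $l$ of length at most $k$ let $(l)_k$ be its extension to length $k$ by repeats of $x_0$, and let $r_k:|\Omega X(k)|\to N(k)$ be the continuous map $$r_k\Big(\sum_j b_j l^j\Big)=\Big(\sum_j b_j\,(l^j)_k(1),\dots,\sum_j b_j\,(l^j)_k(k-1)\Big).$$ Let $k_1\mid k_2\mid k_3\mid\cdots$ be positive integers, and for each $k=k_n$ let $0=t_0<t_1<\dots<t_k=1$ be a partition of $[0,1]$, such that for successive terms $k$ and $k'=ck$ the partitions satisfy $t'_{ci}=t_i$, and such that the mesh tends to $0$. Let $j_{k',k}:\Omega X(k)\to\Omega X(k')$ be the inclusion and let $\iota_{k',k}:N(k)\to N(k')$, $\iota_{k',k}(b)=b'$, be the map given by $$b'_\ell=\frac{t_i-t'_\ell}{t_i-t_{i-1}}\,b_{i-1}+\frac{t'_\ell-t_{i-1}}{t_i-t_{i-1}}\,b_i\qquad(c(i-1)\le\ell<ci),\qquad b_0=b_k=x_0 .$$ Theorem. (1) There are continuous maps $\bar r_k:|\Omega X(k)|\to N(k)$, for $k$ in the sequence, with $\bar r_k\simeq r_k$ and $\iota_{k',k}\circ\bar r_k=\bar r_{k'}\circ|j_{k',k}|$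 (strictly) for all successive terms $k,k'$. (2) The canonical projection from the mapping telescope of the sequence $(N(k),\iota_{k',k})$ to its direct limit $\operatorname{colim}_kN(k)$ is a homotopy equivalence, so that $\operatorname{hocolim}_kN(k)=\operatorname{colim}_kN(k)$. (3) For every family $(\bar r_k)$ as in (1) there is exactly one continuous map $\bar r:|\Omega X|\to\operatorname{hocolim}_kN(k)=\operatorname{colim}_kN(k)$ which restricts to $\bar r_k$ on $|\Omega X(k)|$ for every $k$ in the sequence, and this map $\bar r$ is a homotopy equivalence. -/

import Mathlib

noncomputable section

universe u

/-! ### Homotopy equivalences, direct limits and telescopes of sequences of spaces -/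

/-- A continuous map is a homotopy equivalence if it has a homotopy inverse. -/
def IsHomotopyEquivalence {A B : Type*} [TopologicalSpace A] [TopologicalSpace B]
    (f : C(A, B)) : Prop :=
  ∃ g : C(B, A), (g.comp f).Homotopic (ContinuousMap.id A) ∧
    (f.comp g).Homotopic (ContinuousMap.id B)

section Sequences

variable {A : ℕ → Type u} [∀ n, TopologicalSpace (A n)] (f : ∀ n, C(A n, A (n + 1)))

/-- The generating relation `x ∼ f n x` of the direct limit of a sequence of spaces. -/
inductive SeqColim.Rel : (Σ n, A n) → (Σ n, A n) → Prop
  | step (n : ℕ) (x : A n) : SeqColim.Rel ⟨n, x⟩ ⟨n + 1, f n x⟩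

/-- The direct limit (colimit) of `A 0 → A 1 → A 2 → ⋯`, with the quotient topology. -/
def SeqColim : Type u := Quot (SeqColim.Rel f)

instance : TopologicalSpace (SeqColim f) :=
  inferInstanceAs (TopologicalSpace (Quot (SeqColim.Rel f)))

/-- The canonical map of a term of the sequence into the direct limit. -/
def SeqColim.of (n : ℕ) : C(A n, SeqColim f) where
  toFun x := Quot.mk _ ⟨n, x⟩
  continuous_toFun := continuous_quot_mk.comp continuous_sigmaMk

/-- The gluing relation of the mapping telescope: the end `A n × {1}` of the `n`-th cylinder is
glued to the beginning `A (n + 1) × {0}` of the next one along `f n`. -/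
inductive Telescope.Rel : (Σ n, A n × unitInterval) → (Σ n, A n × unitInterval) → Prop
  | step (n : ℕ) (x : A n) : Telescope.Rel ⟨n, x, 1⟩ ⟨n + 1, f n x, 0⟩

/-- The mapping telescope, i.e. the homotopy colimit, of `A 0 → A 1 → A 2 → ⋯`. -/
def Telescope : Type u := Quot (Telescope.Rel f)

instance : TopologicalSpace (Telescope f) :=
  inferInstanceAs (TopologicalSpace (Quot (Telescope.Rel f)))

/-- The canonical projection of the homotopy colimit onto the direct limit, which forgets the
interval coordinates. -/
def Telescope.toColim : C(Telescope f, SeqColim f) where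
  toFun := Quot.lift (fun z => SeqColim.of f z.1 z.2.1) (by
    rintro _ _ ⟨n, x⟩
    exact Quot.sound (SeqColim.Rel.step n x))
  continuous_toFun := by
    refine continuous_quot_lift _ (continuous_sigma fun n => ?_)
    exact (SeqColim.of f n).continuous.comp continuous_fst

end Sequences

/-! ### The topology of a cell complex -/

/-- The weak topology on a set `P` of points with real coordinates `κ`, with respect to a family
`C` of cells: a set is open iff its trace on each cell is open, each cell having the topology given
by the coordinates. -/
def cellTopology {P J ι : Type*} (κ : P → J → ℝ) (C : ι → Set P) : TopologicalSpace P :=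
  ⨆ i, TopologicalSpace.coinduced (Subtype.val : C i → P)
    (TopologicalSpace.induced (fun p => κ p.1) inferInstance)

/-- A map that sends cells into cells and is given on each cell by a continuous function of the
coordinates is continuous. -/
theorem continuous_cellTopology {P J ι P' J' ι' : Type*} {κ : P → J → ℝ} {C : ι → Set P}
    {κ' : P' → J' → ℝ} {C' : ι' → Set P'} {f : P → P'}
    (h : ∀ i, ∃ j, Set.MapsTo f (C i) (C' j) ∧
      ∃ g : (J → ℝ) → (J' → ℝ), Continuous g ∧ ∀ p ∈ C i, κ' (f p) = g (κ p)) :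
    @Continuous P P' (cellTopology κ C) (cellTopology κ' C') f := by
  let _ := cellTopology κ' C'
  refine continuous_iSup_dom.2 fun i => continuous_coinduced_dom.2 ?_
  obtain ⟨j, hm, g, hg, hfg⟩ := h i
  let t : TopologicalSpace (C i) := TopologicalSpace.induced (fun p => κ p.1) inferInstance
  let t' : TopologicalSpace (C' j) := TopologicalSpace.induced (fun p => κ' p.1) inferInstance
  have h1 : Continuous (hm.restrict) := by
    refine continuous_induced_rng.2 ?_
    have : ((fun p : C' j => κ' p.1) ∘ hm.restrict) = g ∘ fun p : C i => κ p.1 := by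
      funext p
      exact hfg p.1 p.2
    rw [this]
    exact hg.comp continuous_induced_dom
  have h2 : Continuous (Subtype.val : C' j → P') :=
    continuous_iSup_rng (i := j) continuous_coinduced_rng
  exact h2.comp h1

/-! ### Spatial realization of a simplicial complex -/

namespace PreAbstractSimplicialComplex

variable {V : Type u}

/-- The spatial realization `|K|`: points are given by their barycentric coordinates. -/
@[ext]
structure Realization (K : PreAbstractSimplicialComplex V) where
  /-- the barycentric coordinates -/
  coord : V →₀ ℝ
  nonneg : ∀ v, 0 ≤ coord v
  sum_eq : (coord.sum fun _ a => a) = 1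
  support_mem : coord.support ∈ K.faces

/-- `|K|` has the weak topology with respect to the closed simplices `|s|`, where `s` is a face. -/
instance (K : PreAbstractSimplicialComplex V) : TopologicalSpace K.Realization :=
  cellTopology (fun p v => p.coord v) fun s : K.faces => {p | p.coord.support ⊆ s.1}

/-- The inclusion `|K| → |L|` of the realization of a subcomplex. -/
def Realization.incl {K L : PreAbstractSimplicialComplex V} (h : K ≤ L) :
    C(K.Realization, L.Realization) where
  toFun p := ⟨p.coord, p.nonneg, p.sum_eq, h p.support_mem⟩
  continuous_toFun := continuous_cellTopology fun s =>
    ⟨⟨s.1, h s.2⟩, fun _ hp => hp, id, continuous_id, fun _ _ => rfl⟩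

end PreAbstractSimplicialComplex

/-! ### Based complexes, edge loops and the loop complex -/

/-- A simplicial complex with a chosen base vertex. The vertices of the complex are those `v : V`
for which `{v}` is a face. -/
structure BasedComplex (V : Type u) extends PreAbstractSimplicialComplex V where
  /-- the base vertex -/
  base : V
  base_mem : {base} ∈ faces

namespace BasedComplex

variable {V : Type u}

open Classical in
/-- A based edge loop of length `len`: vertices `v_0, …, v_len` with `v_0 = v_len = x₀`, where
adjacent ones are equal or span an edge. -/
structure EdgeLoop (X : BasedComplex V) where
  len : ℕ
  vert : Fin (len + 1) → V
  vert_zero : vert 0 = X.base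
  vert_last : vert (Fin.last len) = X.base
  edge : ∀ i : Fin len, {vert i.castSucc, vert i.succ} ∈ X.faces

/-- The `i`-th vertex of `l`, or `x₀` if `l` has length less than `i`. For `i ≤ k` this is the
`i`-th vertex of the trivial extension (by repeats of `x₀`) of `l` to any length `k ≥ l.len`. -/
def EdgeLoop.pad {X : BasedComplex V} (l : X.EdgeLoop) (i : ℕ) : V :=
  if h : i < l.len + 1 then l.vert ⟨i, h⟩ else X.base

theorem EdgeLoop.pad_zero {X : BasedComplex V} (l : X.EdgeLoop) : l.pad 0 = X.base := by
  simpa [EdgeLoop.pad] using l.vert_zero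

theorem EdgeLoop.pad_of_le {X : BasedComplex V} (l : X.EdgeLoop) {i : ℕ} (h : l.len ≤ i) :
    l.pad i = X.base := by
  unfold EdgeLoop.pad
  split_ifs with h'
  · have : i = l.len := by omega
    subst this
    exact l.vert_last
  · rfl

open Classical in
/-- The `i`-th column of a finite set of edge loops, trivially extended as far as necessary. -/
def column {X : BasedComplex V} (s : Finset X.EdgeLoop) (i : ℕ) : Finset V :=
  s.image fun l => l.pad i

open Classical in
/-- The simplicial complex `ΩX`. Its vertices are all based edge loops. A finite set `s` of loops
is a simplex if for some `m` all its members have length `m` or `m - 1`, one of them has length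
exactly `m`, and the union of any two adjacent columns `σ_i ∪ σ_{i+1}`, `0 ≤ i ≤ m - 1`, is a
simplex of `X`. -/
def loopComplex (X : BasedComplex V) : PreAbstractSimplicialComplex X.EdgeLoop where
  faces := {s | ∃ m : ℕ, (∃ l ∈ s, l.len = m) ∧ (∀ l ∈ s, l.len = m ∨ l.len + 1 = m) ∧
    ∀ i < m, column s i ∪ column s (i + 1) ∈ X.faces}
  isRelLowerSet_faces := by
    rintro s ⟨m, ⟨l, hl, hlm⟩, hs, hc⟩
    refine ⟨⟨l, hl⟩, fun t hts htne => ?_⟩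
    have key : ∀ i < m, column t i ∪ column t (i + 1) ∈ X.faces := fun i hi =>
      (X.isRelLowerSet_faces (hc i hi)).2
        (Finset.union_subset_union (Finset.image_subset_image hts)
          (Finset.image_subset_image hts))
        ((htne.image _).mono Finset.subset_union_left)
    by_cases h : ∃ l ∈ t, l.len = m
    · exact ⟨m, h, fun l hl => hs l (hts hl), key⟩
    · push Not at h
      have h' : ∀ l ∈ t, l.len + 1 = m := fun l hl => (hs l (hts hl)).resolve_left (h l hl)
      obtain ⟨l', hl'⟩ := htne
      have := h' l' hl'
      exact ⟨m - 1, ⟨l', hl', by omega⟩, fun l hl => Or.inl (by have := h' l hl; omega),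
        fun i hi => key i (by omega)⟩

/-- The full subcomplex `ΩX(k)` of `ΩX` on the loops of length at most `k`. -/
def loopComplexUpTo (X : BasedComplex V) (k : ℕ) : PreAbstractSimplicialComplex X.EdgeLoop where
  faces := {s | s ∈ X.loopComplex.faces ∧ ∀ l ∈ s, l.len ≤ k}
  isRelLowerSet_faces := fun _ hs =>
    ⟨(X.loopComplex.isRelLowerSet_faces hs.1).1, fun _ hts htne =>
      ⟨(X.loopComplex.isRelLowerSet_faces hs.1).2 hts htne, fun l hl => hs.2 l (hts hl)⟩⟩

theorem loopComplexUpTo_le (X : BasedComplex V) (k : ℕ) : X.loopComplexUpTo k ≤ X.loopComplex :=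
  fun _ hs => hs.1

theorem loopComplexUpTo_mono (X : BasedComplex V) {k k' : ℕ} (h : k ≤ k') :
    X.loopComplexUpTo k ≤ X.loopComplexUpTo k' :=
  fun _ hs => ⟨hs.1, fun l hl => (hs.2 l hl).trans h⟩

/-! ### The cell complexes `N(k)` -/

open Classical in
/-- A chain `{x₀} = σ_0, σ_1, …, σ_{k-1}, σ_k = {x₀}` of length `k` of simplices of `X`, any two
consecutive ones spanning a simplex. It is stored as an infinite sequence which is constant equal to
`{x₀}` from index `k` on. -/
structure IsChain (X : BasedComplex V) (k : ℕ) (σ : ℕ → Finset V) : Prop where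
  zero : σ 0 = {X.base}
  last : ∀ i, k ≤ i → σ i = {X.base}
  mem : ∀ i, σ i ∈ X.faces
  union_mem : ∀ i, σ i ∪ σ (i + 1) ∈ X.faces

/-- `N(k)`, the set of the points `(x_1, …, x_{k-1})` of `|X|^{k-1}` for which there is a chain
`{x₀}, σ_1, …, σ_{k-1}, {x₀}` of simplices with `x_i ∈ |σ_i|`. Such a point is stored as a sequence
`(x_i)`, `i : ℕ`, with `x_i = x₀` for `i = 0` and for `i ≥ k`, which the conditions
`x_i ∈ |σ_i|` force. -/
@[ext]
structure N (X : BasedComplex V) (k : ℕ) where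
  /-- the coordinates `x_i`, with `x_i = x₀` for `i = 0` and for `i ≥ k` -/
  pt : ℕ → X.Realization
  exists_chain : ∃ σ, X.IsChain k σ ∧ ∀ i, (pt i).coord.support ⊆ σ i

/-- `N(k)` has the topology of a cell complex, the closed cells being the products
`|σ_1| × ⋯ × |σ_{k-1}|` of simplices, where `σ` is a chain. -/
instance (X : BasedComplex V) (k : ℕ) : TopologicalSpace (X.N k) :=
  cellTopology (fun x (j : ℕ × V) => (x.pt j.1).coord j.2)
    fun σ : {σ // X.IsChain k σ} => {x | ∀ i, (x.pt i).coord.support ⊆ σ.1 i}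

/-! ### The maps `r_k : |ΩX(k)| → N(k)` -/

open Classical in
theorem isChain_column {X : BasedComplex V} {k : ℕ} {s : Finset X.EdgeLoop}
    (hs : s ∈ (X.loopComplexUpTo k).faces) : X.IsChain k (column s) := by
  obtain ⟨⟨m, ⟨l, hl, hlm⟩, hlen, hc⟩, hk⟩ := hs
  have hbase : ∀ i, (∀ l ∈ s, l.pad i = X.base) → column s i = {X.base} := fun i h =>
    Finset.eq_singleton_iff_unique_mem.2
      ⟨Finset.mem_image.2 ⟨l, hl, h l hl⟩, fun v hv => by
        obtain ⟨l', hl', rfl⟩ := Finset.mem_image.1 hv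
        exact h l' hl'⟩
  have hm : ∀ i, m ≤ i → column s i = {X.base} := fun i hi =>
    hbase i fun l hl => l.pad_of_le (by have := hlen l hl; omega)
  have hu : ∀ i, column s i ∪ column s (i + 1) ∈ X.faces := fun i => by
    by_cases hi : i < m
    · exact hc i hi
    · rw [hm i (by omega), hm (i + 1) (by omega), Finset.union_self]
      exact X.base_mem
  refine ⟨hbase 0 fun l _ => l.pad_zero, fun i hi => hbase i fun l hl =>
    l.pad_of_le ((hk l hl).trans hi), fun i => ?_, hu⟩
  exact (X.isRelLowerSet_faces (hu i)).2 Finset.subset_union_left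
    (Finset.Nonempty.image ⟨l, hl⟩ _)

open Classical in
/-- The point `∑_j b_j l^j(i)` of `|X|`, for the point `∑_j b_j l^j` of `|ΩX(k)|`. -/
def columnPoint {X : BasedComplex V} {k : ℕ} (p : (X.loopComplexUpTo k).Realization) (i : ℕ) :
    X.Realization :=
  have hsum : ((p.coord.mapDomain fun l => l.pad i).sum fun _ a => a) = 1 := by
    rw [Finsupp.sum_mapDomain_index (fun _ => rfl) (fun _ _ _ => rfl)]
    exact p.sum_eq
  { coord := p.coord.mapDomain fun l => l.pad i
    nonneg := fun v => by
      rw [Finsupp.mapDomain, Finsupp.sum_apply]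
      refine Finset.sum_nonneg fun l _ => ?_
      change 0 ≤ Finsupp.single (l.pad i) (p.coord l) v
      rw [Finsupp.single_apply]
      split_ifs
      exacts [p.nonneg l, le_rfl]
    sum_eq := hsum
    support_mem := by
      refine (X.isRelLowerSet_faces ((isChain_column p.support_mem).mem i)).2
        Finsupp.mapDomain_support ?_
      rw [Finsupp.support_nonempty_iff]
      intro h
      rw [h, Finsupp.sum_zero_index] at hsum
      exact zero_ne_one hsum }

open Classical in
theorem columnPoint_support {X : BasedComplex V} {k : ℕ} (p : (X.loopComplexUpTo k).Realization)
    (i : ℕ) : (columnPoint p i).coord.support ⊆ column p.coord.support i :=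
  Finsupp.mapDomain_support

open Classical in
/-- The map `r_k : |ΩX(k)| → N(k)`,
`r_k (∑_j b_j l^j) = (∑_j b_j (l^j)_k(1), …, ∑_j b_j (l^j)_k(k-1))`. -/
def r (X : BasedComplex V) (k : ℕ) : C((X.loopComplexUpTo k).Realization, X.N k) where
  toFun p := ⟨columnPoint p, column p.coord.support, isChain_column p.support_mem,
    columnPoint_support p⟩
  continuous_toFun := continuous_cellTopology fun s => by
    refine ⟨⟨column s.1, isChain_column s.2⟩, fun p hp i => (columnPoint_support p i).trans
      (Finset.image_subset_image hp),
      fun y j => ∑ l ∈ s.1, if l.pad j.1 = j.2 then y l else 0, ?_, fun p hp => ?_⟩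
    · refine continuous_pi fun j => continuous_finsetSum _ fun l _ => ?_
      split_ifs
      exacts [continuous_apply l, continuous_const]
    · funext j
      change (p.coord.mapDomain fun l => l.pad j.1) j.2 = _
      rw [Finsupp.mapDomain, Finsupp.sum_apply,
        Finsupp.sum_of_support_subset _ (show p.coord.support ⊆ s.1 from hp) _ (by simp)]
      exact Finset.sum_congr rfl fun l _ => Finsupp.single_apply

end BasedComplex

/-! ### The direct system of the `N(k)` -/

/-- A sequence `k 0, k 1, …` of positive integers, each dividing the next, with a partition
`0 = t n 0 < t n 1 < ⋯ < t n (k n) = 1` of the unit interval for each `n` (the values `t n i` with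
`i > k n` play no role), such that the next partition refines the previous one in the sense that
`t (n + 1) (c * i) = t n i` where `k (n + 1) = c * k n`, and such that the mesh tends to `0`. -/
structure PartitionSequence where
  k : ℕ → ℕ
  k_pos : ∀ n, 0 < k n
  k_dvd : ∀ n, k n ∣ k (n + 1)
  t : ℕ → ℕ → ℝ
  t_zero : ∀ n, t n 0 = 0
  t_last : ∀ n, t n (k n) = 1
  t_lt : ∀ n i, i < k n → t n i < t n (i + 1)
  t_compat : ∀ n i, i ≤ k n → t (n + 1) (k (n + 1) / k n * i) = t n i
  mesh : ∀ ε > 0, ∃ n₀, ∀ n ≥ n₀, ∀ i < k n, t n (i + 1) - t n i < ε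

namespace PartitionSequence

variable (S : PartitionSequence)

/-- The quotient `c` of two successive terms of the sequence. -/
def c (n : ℕ) : ℕ := S.k (n + 1) / S.k n

theorem c_mul (n : ℕ) : S.c n * S.k n = S.k (n + 1) := Nat.div_mul_cancel (S.k_dvd n)

theorem c_pos (n : ℕ) : 0 < S.c n :=
  Nat.div_pos (Nat.le_of_dvd (S.k_pos _) (S.k_dvd n)) (S.k_pos n)

theorem k_le (n : ℕ) : S.k n ≤ S.k (n + 1) := Nat.le_of_dvd (S.k_pos _) (S.k_dvd n)

theorem t_mono (n : ℕ) {i j : ℕ} (hij : i ≤ j) (hj : j ≤ S.k n) : S.t n i ≤ S.t n j := by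
  induction j, hij using Nat.le_induction with
  | base => exact le_rfl
  | succ j _ ih => exact (ih (by omega)).trans (S.t_lt n j (by omega)).le

theorem div_lt {n ℓ : ℕ} (hℓ : ℓ < S.k (n + 1)) : ℓ / S.c n < S.k n := by
  rw [Nat.div_lt_iff_lt_mul (S.c_pos n), mul_comm, S.c_mul]
  exact hℓ

/-- For `c * j ≤ ℓ < c * (j + 1)`, the coefficient `(t_{j+1} - t'_ℓ) / (t_{j+1} - t_j)`. -/
def wl (n ℓ : ℕ) : ℝ :=
  (S.t n (ℓ / S.c n + 1) - S.t (n + 1) ℓ) / (S.t n (ℓ / S.c n + 1) - S.t n (ℓ / S.c n))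

/-- For `c * j ≤ ℓ < c * (j + 1)`, the coefficient `(t'_ℓ - t_j) / (t_{j+1} - t_j)`. -/
def wr (n ℓ : ℕ) : ℝ :=
  (S.t (n + 1) ℓ - S.t n (ℓ / S.c n)) / (S.t n (ℓ / S.c n + 1) - S.t n (ℓ / S.c n))

theorem wl_nonneg {n ℓ : ℕ} (hℓ : ℓ < S.k (n + 1)) : 0 ≤ S.wl n ℓ := by
  have hj := S.div_lt hℓ
  have h1 := S.t_compat n (ℓ / S.c n + 1) hj
  have h2 : ℓ ≤ S.c n * (ℓ / S.c n + 1) := (Nat.lt_mul_div_succ ℓ (S.c_pos n)).le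
  have h3 : S.c n * (ℓ / S.c n + 1) ≤ S.k (n + 1) := by
    rw [← S.c_mul n]; exact Nat.mul_le_mul_left _ hj
  refine div_nonneg ?_ (sub_nonneg.2 (S.t_lt n _ hj).le)
  rw [sub_nonneg, ← h1]
  exact S.t_mono (n + 1) h2 h3

theorem wr_nonneg {n ℓ : ℕ} (hℓ : ℓ < S.k (n + 1)) : 0 ≤ S.wr n ℓ := by
  have hj := S.div_lt hℓ
  have h1 := S.t_compat n (ℓ / S.c n) hj.le
  refine div_nonneg ?_ (sub_nonneg.2 (S.t_lt n _ hj).le)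
  rw [sub_nonneg, ← h1]
  exact S.t_mono (n + 1) (Nat.mul_div_le ℓ (S.c n)) hℓ.le

theorem wl_add_wr {n ℓ : ℕ} (hℓ : ℓ < S.k (n + 1)) : S.wl n ℓ + S.wr n ℓ = 1 := by
  have := S.t_lt n _ (S.div_lt hℓ)
  unfold wl wr
  rw [← add_div, div_eq_one_iff_eq (by linarith)]
  ring

theorem wr_of_dvd {n ℓ : ℕ} (hℓ : ℓ < S.k (n + 1)) (h : S.c n ∣ ℓ) : S.wr n ℓ = 0 := by
  have h1 := S.t_compat n (ℓ / S.c n) (S.div_lt hℓ).le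
  change S.t (n + 1) (S.c n * (ℓ / S.c n)) = _ at h1
  rw [Nat.mul_div_cancel' h] at h1
  simp [wr, h1]

end PartitionSequence

namespace BasedComplex

variable {V : Type u}

open Classical in
/-- The convex combination `a • p + b • q` of two points of `|X|` lying in a common simplex. -/
def comb (X : BasedComplex V) (p q : X.Realization) (a b : ℝ) (ha : 0 ≤ a) (hb : 0 ≤ b)
    (hab : a + b = 1) (h : p.coord.support ∪ q.coord.support ∈ X.faces) : X.Realization :=
  have hsum : ((a • p.coord + b • q.coord).sum fun _ x => x) = 1 := by
    rw [Finsupp.sum_add_index' (fun _ => rfl) (fun _ _ _ => rfl),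
      Finsupp.sum_smul_index (fun _ => rfl), Finsupp.sum_smul_index (fun _ => rfl),
      ← Finsupp.mul_sum, ← Finsupp.mul_sum, p.sum_eq, q.sum_eq, mul_one, mul_one, hab]
  { coord := a • p.coord + b • q.coord
    nonneg := fun v => add_nonneg (mul_nonneg ha (p.nonneg v)) (mul_nonneg hb (q.nonneg v))
    sum_eq := hsum
    support_mem := by
      refine (X.isRelLowerSet_faces h).2 (Finsupp.support_add.trans
        (Finset.union_subset_union Finsupp.support_smul Finsupp.support_smul)) ?_
      rw [Finsupp.support_nonempty_iff]
      intro h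
      rw [h, Finsupp.sum_zero_index] at hsum
      exact zero_ne_one hsum }

open Classical in
/-- The point of `|X|` given by the base vertex. -/
def basePoint (X : BasedComplex V) : X.Realization where
  coord := Finsupp.single X.base 1
  nonneg v := by
    rw [Finsupp.single_apply]
    split_ifs
    exacts [zero_le_one, le_rfl]
  sum_eq := Finsupp.sum_single_index rfl
  support_mem := by
    rw [Finsupp.support_single _ one_ne_zero]
    exact X.base_mem

open Classical in
theorem N.support_union_mem {X : BasedComplex V} {k : ℕ} (x : X.N k) (i : ℕ) :
    (x.pt i).coord.support ∪ (x.pt (i + 1)).coord.support ∈ X.faces := by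
  obtain ⟨σ, hσ, hx⟩ := x.exists_chain
  exact (X.isRelLowerSet_faces (hσ.union_mem i)).2 (Finset.union_subset_union (hx i) (hx (i + 1)))
    ((X.isRelLowerSet_faces (x.pt i).support_mem).1.mono Finset.subset_union_left)

open Classical in
/-- The `ℓ`-th coordinate `b'_ℓ` of `ι(b)`: for `c * j ≤ ℓ < c * (j + 1)` and `ℓ < k'` it is
`(t_{j+1} - t'_ℓ) / (t_{j+1} - t_j) • b_j + (t'_ℓ - t_j) / (t_{j+1} - t_j) • b_{j+1}`. -/
def refinePoint (X : BasedComplex V) (S : PartitionSequence) (n : ℕ) (b : X.N (S.k n)) (ℓ : ℕ) :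
    X.Realization :=
  if h : ℓ < S.k (n + 1) then
    X.comb (b.pt (ℓ / S.c n)) (b.pt (ℓ / S.c n + 1)) (S.wl n ℓ) (S.wr n ℓ) (S.wl_nonneg h)
      (S.wr_nonneg h) (S.wl_add_wr h) (b.support_union_mem _)
  else X.basePoint

open Classical in
/-- The chain of length `k'` that carries the image of the cell of a chain `σ` of length `k`. -/
def refineChain (S : PartitionSequence) (n : ℕ) (σ : ℕ → Finset V) (ℓ : ℕ) : Finset V :=
  if S.c n ∣ ℓ then σ (ℓ / S.c n) else σ (ℓ / S.c n) ∪ σ (ℓ / S.c n + 1)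

open Classical in
theorem isChain_refineChain {X : BasedComplex V} {S : PartitionSequence} {n : ℕ}
    {σ : ℕ → Finset V} (hσ : X.IsChain (S.k n) σ) :
    X.IsChain (S.k (n + 1)) (refineChain S n σ) := by
  have hc := S.c_pos n
  refine ⟨?_, fun ℓ hℓ => ?_, fun ℓ => ?_, fun ℓ => ?_⟩
  · simp [refineChain, hσ.zero]
  · have hj : S.k n ≤ ℓ / S.c n := by
      rw [Nat.le_div_iff_mul_le hc, mul_comm, S.c_mul]; exact hℓ
    unfold refineChain
    rw [hσ.last _ hj, hσ.last _ (hj.trans (Nat.le_succ _)), Finset.union_self, ite_self]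
  · unfold refineChain
    split_ifs
    exacts [hσ.mem _, hσ.union_mem _]
  · by_cases h1 : S.c n ∣ ℓ + 1
    · have hj : (ℓ + 1) / S.c n = ℓ / S.c n + 1 := by rw [Nat.succ_div, if_pos h1]
      unfold refineChain
      rw [if_pos h1, hj]
      split_ifs
      · exact hσ.union_mem _
      · rw [Finset.union_assoc, Finset.union_self]
        exact hσ.union_mem _
    · have hj : (ℓ + 1) / S.c n = ℓ / S.c n := by rw [Nat.succ_div, if_neg h1, add_zero]
      unfold refineChain
      rw [if_neg h1, hj]
      split_ifs
      · rw [← Finset.union_assoc, Finset.union_self]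
        exact hσ.union_mem _
      · rw [Finset.union_self]
        exact hσ.union_mem _

open Classical in
theorem refinePoint_support {X : BasedComplex V} {S : PartitionSequence} {n : ℕ}
    {b : X.N (S.k n)} {σ : ℕ → Finset V} (hσ : X.IsChain (S.k n) σ)
    (hb : ∀ i, (b.pt i).coord.support ⊆ σ i) (ℓ : ℕ) :
    (X.refinePoint S n b ℓ).coord.support ⊆ refineChain S n σ ℓ := by
  unfold refinePoint
  split_ifs with h
  · unfold refineChain comb
    split_ifs with hd
    · simp only [S.wr_of_dvd h hd, zero_smul, add_zero]
      exact Finsupp.support_smul.trans (hb _)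
    · exact Finsupp.support_add.trans (Finset.union_subset_union
        (Finsupp.support_smul.trans (hb _)) (Finsupp.support_smul.trans (hb _)))
  · rw [(isChain_refineChain hσ).last ℓ (by omega)]
    exact Finsupp.support_single_subset

open Classical in
/-- The map `ι_{k',k} : N(k) → N(k')` for two successive terms `k`, `k'` of the sequence. -/
def ι (X : BasedComplex V) (S : PartitionSequence) (n : ℕ) :
    C(X.N (S.k n), X.N (S.k (n + 1))) where
  toFun b := ⟨X.refinePoint S n b, by
    obtain ⟨σ, hσ, hb⟩ := b.exists_chain
    exact ⟨refineChain S n σ, isChain_refineChain hσ, refinePoint_support hσ hb⟩⟩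
  continuous_toFun := continuous_cellTopology fun σ => by
    refine ⟨⟨_, isChain_refineChain σ.2⟩, fun b hb => refinePoint_support σ.2 hb,
      fun y j => if j.1 < S.k (n + 1) then
        S.wl n j.1 * y (j.1 / S.c n, j.2) + S.wr n j.1 * y (j.1 / S.c n + 1, j.2)
        else X.basePoint.coord j.2, ?_, fun b _ => ?_⟩
    · refine continuous_pi fun j => ?_
      split_ifs
      · exact ((continuous_apply _).const_mul _).add ((continuous_apply _).const_mul _)
      · exact continuous_const
    · funext j
      change (X.refinePoint S n b j.1).coord j.2 = _
      by_cases h : j.1 < S.k (n + 1)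
      · simp only [refinePoint, h, dif_pos, if_pos]
        rfl
      · simp only [refinePoint, h, dif_neg, if_neg, not_false_iff]

/-- The inclusion `|j_{k',k}| : |ΩX(k)| → |ΩX(k')|` for two successive terms of the sequence. -/
def j (X : BasedComplex V) (S : PartitionSequence) (n : ℕ) :
    C((X.loopComplexUpTo (S.k n)).Realization, (X.loopComplexUpTo (S.k (n + 1))).Realization) :=
  PreAbstractSimplicialComplex.Realization.incl (X.loopComplexUpTo_mono (S.k_le n))

/-- The inclusion `|ΩX(k)| → |ΩX|`. -/
def inclLoop (X : BasedComplex V) (k : ℕ) :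
    C((X.loopComplexUpTo k).Realization, X.loopComplex.Realization) :=
  PreAbstractSimplicialComplex.Realization.incl (X.loopComplexUpTo_le k)

/-- Rigidifications of the maps `r_k`: maps `rbar n : |ΩX(k n)| → N(k n)` homotopic to `r_{k n}`
that commute strictly with the maps of the two direct systems. -/
def IsStrictLadder (X : BasedComplex V) (S : PartitionSequence)
    (rbar : ∀ n, C((X.loopComplexUpTo (S.k n)).Realization, X.N (S.k n))) : Prop :=
  ∀ n, (rbar n).Homotopic (X.r (S.k n)) ∧
    (X.ι S n).comp (rbar n) = (rbar (n + 1)).comp (X.j S n)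

end BasedComplex

end

noncomputable section

open Topology

universe u

/-! ### Neighbourhood deformations and extension of lifts -/

/-! Each `r_k` is a homotopy equivalence. It has a strict section `productSection`, which spreads a
point of a cell over all loops of length `k` with `i`-th vertex in `σ_i`, with weight the product of
the barycentric coordinates; `r_k` takes marginals of this distribution. Conversely, the section
after `r_k` is homotopic to the identity: lengthen short loops one unit at a time, each step staying
inside a simplex, then move along straight lines. This homotopy lies over `N(k)` and fixes the
section (`homotopicWith_productSection`). Hence any map homotopic to `r_k`, or to its section, has a
`CoherentInverse`.

Strictness comes from one lifting theorem, `exists_strict_lift`. A lift up to homotopy of `z` along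
`Rb` is a point `y` with a path from `Rb y` to `z`. A coherent inverse deforms every such pair, over
a fixed `z`, to the canonical pair at `S z`. So a lift given on a neighbourhood deformation retract
can be faded into the canonical lift away from it, and a ladder commuting up to homotopy lifts
inductively to a strict one.

The theorem is used four times. With `Rb` the identity of `N(k)` it rigidifies the `r_k`, since
these commute with the bonding maps up to homotopy (`ι_comp_r_homotopic`). With the telescope as
target it gives a map from the direct limit back to the telescope. For a strict ladder of maps
homotopic to the `r_k` it gives a strict ladder of right homotopy inverses, and then right homotopy
inverses of those; a formal argument makes the induced map of direct limits an equivalence. Finally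
`|ΩX|` is the direct limit of the `|ΩX(k)|`, as the mesh condition forces `k` to be unbounded.

The geometric input is that both systems consist of neighbourhood deformation retracts. For `|j|`
this is the usual argument for full subcomplexes. For `ι` (`ιDeformation`) one discards coordinates
that are small compared with the deviation from the image, so that the retraction stays in the cell.
-/

/-- A neighbourhood deformation of `W` to the image of `i : A → W`: a homotopy of the identity of
`W` relative to `A`, whose end maps `{u < 1}` into `A`. -/
structure NeighbourhoodDeformation {A W : Type*} [TopologicalSpace A] [TopologicalSpace W]
    (i : C(A, W)) where
  u : C(W, ℝ)
  h : C(W × unitInterval, W)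
  ret : C({w // u w < 1}, A)
  u_apply : ∀ a, u (i a) = 0
  h_zero : ∀ w, h (w, 0) = w
  h_apply : ∀ a t, h (i a, t) = i a
  h_one : ∀ w : {w // u w < 1}, h (w.1, 1) = i (ret w)
  ret_apply : ∀ a ha, ret ⟨i a, ha⟩ = a

/-- A map `Rb : Y → Z` together with a homotopy `M` to a map `R` and a homotopy inverse `S` of `R`
with homotopies `K : S R ≃ id` and `L : R S ≃ id` such that `R K = L R`. All homotopies have
parameters in `ℝ` and are constant outside `[0, 1]`. -/
structure CoherentInverse {Y Z : Type*} [TopologicalSpace Y] [TopologicalSpace Z]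
    (Rb : C(Y, Z)) where
  R : C(Y, Z)
  S : C(Z, Y)
  K : C(Y × ℝ, Y)
  L : C(Z × ℝ, Z)
  M : C(Y × ℝ, Z)
  K_zero : ∀ y t, t ≤ 0 → K (y, t) = S (R y)
  K_one : ∀ y t, 1 ≤ t → K (y, t) = y
  L_zero : ∀ z t, t ≤ 0 → L (z, t) = R (S z)
  L_one : ∀ z t, 1 ≤ t → L (z, t) = z
  R_K : ∀ y t, R (K (y, t)) = L (R y, t)
  M_zero : ∀ y t, t ≤ 0 → M (y, t) = Rb y
  M_one : ∀ y t, 1 ≤ t → M (y, t) = R y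

/-- The identity is its own coherent inverse. -/
def CoherentInverse.id (Z : Type*) [TopologicalSpace Z] :
    CoherentInverse (ContinuousMap.id Z) where
  R := .id Z
  S := .id Z
  K := .fst
  L := .fst
  M := .fst
  K_zero _ _ _ := rfl
  K_one _ _ _ := rfl
  L_zero _ _ _ := rfl
  L_one _ _ _ := rfl
  R_K _ _ := rfl
  M_zero _ _ _ := rfl
  M_one _ _ _ := rfl

/-! ### Deforming homotopy lifts of a fixed point to a canonical one -/

section Vertical

variable {U Y Z : Type*} [TopologicalSpace U] [TopologicalSpace Y] [TopologicalSpace Z]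
  {Rb : C(Y, Z)}

/-- The path from `R y` to `z` obtained from a path `γ` from `Rb y` to `z`. -/
theorem CoherentInverse.exists_shift (D : CoherentInverse Rb) (y : C(U, Y)) (γ : C(U × ℝ, Z))
    (h0 : ∀ w t, t ≤ 0 → γ (w, t) = Rb (y w)) :
    ∃ η : C(U × ℝ, Z), (∀ w t, t ≤ 1 → η (w, t) = D.M (y w, 1 - t)) ∧
      ∀ w t, 1 ≤ t → η (w, t) = γ (w, t - 1) := by
  have hb : ∀ p : U × ℝ, p.2 = 1 → D.M (y p.1, 1 - p.2) = γ (p.1, p.2 - 1) := by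
    rintro ⟨w, t⟩ rfl
    rw [h0 _ _ (by simp), D.M_zero _ _ (by simp)]
  refine ⟨⟨fun p => if p.2 ≤ 1 then D.M (y p.1, 1 - p.2) else γ (p.1, p.2 - 1),
    Continuous.if_le (by fun_prop) (by fun_prop) (by fun_prop) (by fun_prop) hb⟩,
    fun w t ht => if_pos ht, fun w t ht => ?_⟩
  change (if t ≤ 1 then _ else _) = _
  split_ifs with h
  · exact hb (w, t) (le_antisymm h ht)
  · rfl

/-- Any family of points `y` with paths `γ` from `Rb y` to `z` can be deformed into the family of
points `S z` with canonical paths to `z`, keeping `z` fixed. -/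
theorem CoherentInverse.exists_vertical (D : CoherentInverse Rb) (y : C(U, Y)) (γ : C(U × ℝ, Z))
    (z : C(U, Z)) {a : ℝ} (ha : 0 ≤ a) (h0 : ∀ w t, t ≤ 0 → γ (w, t) = Rb (y w))
    (h1 : ∀ w t, a ≤ t → γ (w, t) = z w) :
    ∃ (Θ : C(U × ℝ, Y)) (Γ : C(U × ℝ × ℝ, Z)), (∀ w, Θ (w, 0) = y w) ∧
      (∀ w t, Γ (w, 0, t) = γ (w, t)) ∧
      (∀ w τ t, t ≤ 0 → 0 ≤ τ → Γ (w, τ, t) = Rb (Θ (w, τ))) ∧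
      (∀ w τ t, 0 ≤ τ → a + 3 ≤ t → Γ (w, τ, t) = z w) ∧
      (∀ w τ, a + 3 ≤ τ → Θ (w, τ) = D.S (z w)) ∧
      (∀ w τ t, a + 3 ≤ τ → t ≤ 1 → Γ (w, τ, t) = D.M (D.S (z w), t)) ∧
      (∀ w τ t, a + 3 ≤ τ → 1 ≤ t → Γ (w, τ, t) = D.L (z w, t - 1)) := by
  -- The deformation has three stages in `τ`. Up to `τ = 1` the point is fixed and the path `M` with
  -- its reverse is inserted, giving `M` followed by `η`. Up to `τ = 2` the point runs along `K`
  -- from `y` to `S (R y)`, and a piece of `L` is inserted between `M` and `η`. Afterwards the point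
  -- is `S` of a point that runs along `η` to `z`. The bound `a + 3` leaves one unit each for `M`
  -- and `L`, and `a + 1` for `η`.
  obtain ⟨η, hη1, hη2⟩ := D.exists_shift y γ h0
  have hη0 : ∀ w t, t ≤ 0 → η (w, t) = D.R (y w) := fun w t ht => by
    rw [hη1 w t (by linarith), D.M_one _ _ (by linarith)]
  have hηz : ∀ w t, a + 1 ≤ t → η (w, t) = z w := fun w t ht => by
    rw [hη2 w t (by linarith), h1 _ _ (by linarith)]
  -- the path of points of `Y`
  have hΘb : ∀ p : U × ℝ, p.2 = 2 →
      D.K (y p.1, 1 - max 0 (p.2 - 1)) = D.S (η (p.1, max 0 (p.2 - 2))) := by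
    rintro ⟨w, τ⟩ rfl
    rw [D.K_zero _ _ (by norm_num), hη0 _ _ (by norm_num)]
  let Θ : C(U × ℝ, Y) := ⟨fun p => if p.2 ≤ 2 then D.K (y p.1, 1 - max 0 (p.2 - 1))
    else D.S (η (p.1, max 0 (p.2 - 2))),
    Continuous.if_le (by fun_prop) (by fun_prop) (by fun_prop) (by fun_prop) hΘb⟩
  have hΘ1 : ∀ w τ, τ ≤ 2 → Θ (w, τ) = D.K (y w, 1 - max 0 (τ - 1)) := fun w τ h => if_pos h
  have hΘ2 : ∀ w τ, 2 ≤ τ → Θ (w, τ) = D.S (η (w, max 0 (τ - 2))) := fun w τ h => by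
    change (if τ ≤ 2 then _ else _) = _
    split_ifs with h'
    · exact hΘb (w, τ) (le_antisymm h' h)
    · rfl
  have hΘy : ∀ w τ, τ ≤ 1 → Θ (w, τ) = y w := fun w τ h => by
    rw [hΘ1 w τ (by linarith), max_eq_left (by linarith), D.K_one _ _ (by norm_num)]
  -- Here `R K = L R` is used: the end of the `M`-segment must be the start of the `L`-segment at
  -- every time.
  have hRΘ : ∀ w τ, D.R (Θ (w, τ)) =
      D.L (η (w, max 0 (τ - 2)), 1 - min 1 (max 0 (τ - 1))) := fun w τ => by
    rcases le_total τ 2 with h | h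
    · rw [hΘ1 w τ h, D.R_K, hη0 _ _ (by simp [h]), min_eq_right (by simp; linarith)]
    · rw [hΘ2 w τ h, D.L_zero]
      rw [min_eq_left (le_max_of_le_right (by linarith))]
      simp
  -- the first stage: insert a path and its inverse
  let Γ1 : C(U × ℝ × ℝ, Z) := ⟨fun p => if p.2.2 ≤ 2 * p.2.1 then
      D.M (y p.1, min p.2.2 (2 * p.2.1 - p.2.2)) else γ (p.1, p.2.2 - 2 * p.2.1), by
    refine Continuous.if_le (by fun_prop) (by fun_prop) (by fun_prop) (by fun_prop) ?_
    rintro ⟨w, τ, t⟩ h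
    simp only at h ⊢
    rw [h0 _ _ (by linarith), D.M_zero _ _ (min_le_of_right_le (by linarith))]⟩
  -- the other stages
  let Γ2 : C(U × ℝ × ℝ, Z) := ⟨fun p => if p.2.2 ≤ 1 then D.M (Θ (p.1, p.2.1), p.2.2) else
      if p.2.2 ≤ 1 + min 1 (max 0 (p.2.1 - 1)) then
        D.L (η (p.1, max 0 (p.2.1 - 2)), p.2.2 - min 1 (max 0 (p.2.1 - 1))) else
        η (p.1, max 0 (p.2.1 - 2) + p.2.2 - 1 - min 1 (max 0 (p.2.1 - 1))), by
    refine Continuous.if_le (by fun_prop) (Continuous.if_le (by fun_prop) (by fun_prop)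
      (by fun_prop) (by fun_prop) ?_) (by fun_prop) (by fun_prop) ?_
    · rintro ⟨w, τ, t⟩ h
      simp only at h ⊢
      rw [h, D.L_one _ _ (by linarith)]
      congr 2
      ring
    · rintro ⟨w, τ, t⟩ h
      simp only at h ⊢
      subst h
      rw [if_pos (by simp), D.M_one _ _ le_rfl, hRΘ]⟩
  -- At `τ = 1` both formulas describe `M` followed by `η`; in the first, `η` appears as the
  -- reversed `M` followed by `γ`.
  have hΓ : ∀ p : U × ℝ × ℝ, p.2.1 = 1 → Γ1 p = Γ2 p := by
    rintro ⟨w, τ, t⟩ h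
    simp only at h
    subst h
    simp only [Γ1, Γ2, ContinuousMap.coe_mk]
    norm_num
    rcases lt_or_ge 1 t with h | h
    · rw [if_neg (not_le.2 h), if_neg (not_le.2 h)]
      split_ifs with h'
      · rw [hη1 _ _ (by linarith), min_eq_right (by linarith)]
        congr 2
        ring
      · rw [hη2 _ _ (by linarith)]
        congr 2
        ring
    · rw [if_pos h, if_pos (by linarith), hΘy w 1 le_rfl, min_eq_left (by linarith)]
  let Γ : C(U × ℝ × ℝ, Z) := ⟨fun p => if p.2.1 ≤ 1 then Γ1 p else Γ2 p,
    Continuous.if_le (by fun_prop) (by fun_prop) (by fun_prop) (by fun_prop) hΓ⟩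
  have hΓ1 : ∀ w τ t, τ ≤ 1 → Γ (w, τ, t) = Γ1 (w, τ, t) := fun w τ t h => if_pos h
  have hΓ2 : ∀ w τ t, 1 < τ → Γ (w, τ, t) = Γ2 (w, τ, t) := fun w τ t h => if_neg (not_le.2 h)
  refine ⟨Θ, Γ, fun w => hΘy w 0 zero_le_one, fun w t => ?_, fun w τ t ht hτ => ?_,
    fun w τ t hτ ht => ?_, fun w τ hτ => ?_, fun w τ t hτ ht => ?_, fun w τ t hτ ht => ?_⟩
  · rw [hΓ1 _ _ _ zero_le_one]
    simp only [Γ1, ContinuousMap.coe_mk]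
    split_ifs with h
    · rw [h0 _ _ (by linarith), D.M_zero _ _ (min_le_of_left_le (by linarith))]
    · simp
  · rcases le_or_gt τ 1 with h | h
    · rw [hΓ1 _ _ _ h, hΘy _ _ h]
      simp only [Γ1, ContinuousMap.coe_mk]
      rw [if_pos (by linarith), D.M_zero _ _ (min_le_of_left_le (by linarith))]
    · rw [hΓ2 _ _ _ h]
      simp only [Γ2, ContinuousMap.coe_mk]
      rw [if_pos (by linarith), D.M_zero _ _ ht]
  · rcases le_or_gt τ 1 with h | h
    · rw [hΓ1 _ _ _ h]
      simp only [Γ1, ContinuousMap.coe_mk]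
      rw [if_neg (by linarith), h1 _ _ (by linarith)]
    · rw [hΓ2 _ _ _ h]
      simp only [Γ2, ContinuousMap.coe_mk]
      have h2 : min 1 (max 0 (τ - 1)) ≤ 1 := min_le_left _ _
      have h3 : 0 ≤ max 0 (τ - 2) := le_max_left _ _
      rw [if_neg (by linarith), if_neg (by linarith), hηz _ _ (by linarith)]
  · rw [hΘ2 _ _ (by linarith), hηz _ _ (le_max_of_le_right (by linarith))]
  · rw [hΓ2 _ _ _ (by linarith)]
    simp only [Γ2, ContinuousMap.coe_mk]
    rw [if_pos ht, hΘ2 _ _ (by linarith), hηz _ _ (le_max_of_le_right (by linarith))]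
  · rw [hΓ2 _ _ _ (by linarith)]
    simp only [Γ2, ContinuousMap.coe_mk]
    rw [min_eq_left (le_max_of_le_right (by linarith)), max_eq_right (by linarith : 0 ≤ τ - 2)]
    split_ifs with h h'
    · obtain rfl : t = 1 := le_antisymm h ht
      rw [D.M_one _ _ le_rfl, D.L_zero _ _ (by simp), hΘ2 _ _ (by linarith),
        hηz _ _ (le_max_of_le_right (by linarith))]
    · rw [hηz _ _ (by linarith)]
    · rw [hηz _ _ (by linarith), D.L_one _ _ (by linarith)]

end Vertical

/-! ### Gluing, and extension of homotopy lifts -/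

section Lifting

/-- Gluing of continuous maps on `{u < 1}` and `{u > 1/2}`. -/
theorem exists_glue {W Z : Type*} [TopologicalSpace W] [TopologicalSpace Z] (u : C(W, ℝ))
    (F : C({w // u w < 1}, Z)) (G : C(W, Z)) (h : ∀ w, 1 / 2 ≤ u w.1 → F w = G w) :
    ∃ H : C(W, Z), (∀ w (hw : u w < 1), H w = F ⟨w, hw⟩) ∧ ∀ w, 1 / 2 ≤ u w → H w = G w := by
  classical
  let H : W → Z := fun w => if hw : u w < 1 then F ⟨w, hw⟩ else G w
  have h1 : ∀ w (hw : u w < 1), H w = F ⟨w, hw⟩ := fun w hw => dif_pos hw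
  have h2 : ∀ w, 1 / 2 ≤ u w → H w = G w := fun w hw => by
    by_cases hw' : u w < 1
    · rw [h1 w hw', h _ hw]
    · exact dif_neg hw'
  refine ⟨⟨H, continuous_iff_continuousAt.2 fun w => ?_⟩, h1, h2⟩
  by_cases hw : u w < 1
  · have ho : IsOpen {w | u w < 1} := isOpen_lt u.continuous continuous_const
    have : ContinuousOn H {w | u w < 1} := by
      rw [continuousOn_iff_continuous_domRestrict]
      exact F.continuous.congr fun w => (h1 w.1 w.2).symm
    exact this.continuousAt (ho.mem_nhds hw)
  · have ho : IsOpen {w | 1 / 2 < u w} := isOpen_lt continuous_const u.continuous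
    refine G.continuous.continuousAt.congr ?_
    filter_upwards [ho.mem_nhds (show 1 / 2 < u w by linarith)] with v hv
    exact (h2 v (le_of_lt hv)).symm

variable {A W Y Z : Type*} [TopologicalSpace A] [TopologicalSpace W] [TopologicalSpace Y]
  [TopologicalSpace Z] {Rb : C(Y, Z)} {i : C(A, W)}

/-- A lift up to homotopy `(l, k)` of `φ` along `Rb` that is given on `A` extends to `W`. -/
theorem CoherentInverse.exists_lift (D : CoherentInverse Rb) (E : NeighbourhoodDeformation i)
    (φ : C(W, Z)) (l : C(A, Y)) (k : C(A × ℝ, Z)) {a : ℝ} (ha : 0 ≤ a)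
    (h0 : ∀ x t, t ≤ 0 → k (x, t) = Rb (l x)) (h1 : ∀ x t, a ≤ t → k (x, t) = φ (i x)) :
    ∃ (l' : C(W, Y)) (k' : C(W × ℝ, Z)), (∀ x, l' (i x) = l x) ∧
      (∀ x t, k' (i x, t) = k (x, t)) ∧ (∀ w t, t ≤ 0 → k' (w, t) = Rb (l' w)) ∧
      ∀ w t, a + 4 ≤ t → k' (w, t) = φ w := by
  let p : ℝ → unitInterval := Set.projIcc 0 1 zero_le_one
  have hp : Continuous p := continuous_projIcc
  have hkb : ∀ q : {w // E.u w < 1} × ℝ, q.2 = a →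
      k (E.ret q.1, q.2) = φ (E.h (q.1.1, p (1 + a - q.2))) := by
    rintro ⟨w, t⟩ h
    simp only at h
    subst h
    have : p (1 + t - t) = 1 := Set.projIcc_of_right_le _ (by linarith)
    rw [this, h1 _ _ le_rfl, E.h_one]
  -- Over the neighbourhood, lift by retracting to `A`. The path there ends at `φ (h (w, 1))`, and
  -- running the deformation backwards for one more unit of time brings it to `φ w`.
  let γ : C({w // E.u w < 1} × ℝ, Z) := ⟨fun q => if q.2 ≤ a then k (E.ret q.1, q.2)
    else φ (E.h (q.1.1, p (1 + a - q.2))),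
    Continuous.if_le (by fun_prop) (by fun_prop) (by fun_prop) (by fun_prop) hkb⟩
  obtain ⟨Θ, Γ, hΘ0, hΓ0, hΓR, hΓz, hΘ1, hΓ1, hΓ2⟩ := D.exists_vertical
    (l.comp E.ret) γ (φ.comp ⟨Subtype.val, continuous_subtype_val⟩) (a := a + 1) (by linarith)
    (fun w t ht => by
      change (if t ≤ a then _ else _) = _
      rw [if_pos (by linarith), h0 _ _ ht]; rfl)
    (fun w t ht => by
      change (if t ≤ a then _ else _) = _
      rw [if_neg (by linarith)]
      have : p (1 + a - t) = 0 := Set.projIcc_of_le_left _ (by linarith)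
      rw [this, E.h_zero]; rfl)
  -- The vertical deformation is not started on `A`, where `u = 0`, and is complete once `u ≥ 1/2`.
  -- There the lift is the canonical one `S φ`, which is defined on all of `W`, so the two can be
  -- glued.
  let T : C(W, ℝ) := ⟨fun w => (a + 4) * max 0 (min 1 (2 * E.u w)), by fun_prop⟩
  have hT0 : ∀ w, 0 ≤ T w := fun w => mul_nonneg (by linarith) (le_max_left _ _)
  have hT1 : ∀ w, 1 / 2 ≤ E.u w → T w = a + 4 := fun w hw => by
    change (a + 4) * max 0 (min 1 (2 * E.u w)) = _
    rw [min_eq_left (by linarith), max_eq_right zero_le_one, mul_one]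
  have hTA : ∀ x, T (i x) = 0 := fun x => by
    change (a + 4) * max 0 (min 1 (2 * E.u (i x))) = _
    rw [E.u_apply]
    simp
  obtain ⟨l', hl1, hl2⟩ := exists_glue E.u ⟨fun w => Θ (w, T w.1), by fun_prop⟩ (D.S.comp φ)
    (fun w hw => hΘ1 w _ (by rw [hT1 _ hw]; linarith))
  have hcb : ∀ q : W × ℝ, q.2 = 1 → D.M (D.S (φ q.1), q.2) = D.L (φ q.1, q.2 - 1) := by
    rintro ⟨w, t⟩ rfl
    rw [D.M_one _ _ le_rfl, D.L_zero _ _ (by simp)]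
  obtain ⟨k', hk1, hk2⟩ := exists_glue (Z := Z) (E.u.comp (ContinuousMap.fst (β := ℝ)))
    ⟨fun q => Γ (⟨q.1.1, q.2⟩, T q.1.1, q.1.2), by fun_prop⟩
    ⟨fun q => if q.2 ≤ 1 then D.M (D.S (φ q.1), q.2) else D.L (φ q.1, q.2 - 1),
      Continuous.if_le (by fun_prop) (by fun_prop) (by fun_prop) (by fun_prop) hcb⟩
    (by
      rintro ⟨⟨w, t⟩, hq⟩ hw
      have hq' : E.u w < 1 := hq
      change Γ (⟨w, hq'⟩, T w, t) = if t ≤ 1 then _ else _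
      have hT : a + 1 + 3 ≤ T w := by rw [hT1 w hw]; linarith
      split_ifs with h
      · exact hΓ1 ⟨w, hq'⟩ _ t hT h
      · exact hΓ2 ⟨w, hq'⟩ _ t hT (by linarith))
  have hU : ∀ x, E.u (i x) < 1 := fun x => by rw [E.u_apply]; exact one_pos
  refine ⟨l', k', fun x => ?_, fun x t => ?_, fun w t ht => ?_, fun w t ht => ?_⟩
  · rw [hl1 _ (hU x)]
    change Θ (_, T (i x)) = _
    rw [hTA, hΘ0]
    exact congrArg l (E.ret_apply x _)
  · rw [hk1 _ (hU x)]
    change Γ (⟨i x, hU x⟩, T (i x), t) = _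
    rw [hTA, hΓ0]
    change (if t ≤ a then _ else _) = _
    split_ifs with h
    · simp only [E.ret_apply]
    · rw [h1 x t (by linarith), E.h_apply]
  · by_cases hw : E.u w < 1
    · rw [hk1 (w, t) hw, hl1 w hw]
      exact hΓR ⟨w, hw⟩ _ t ht (hT0 w)
    · rw [hk2 (w, t) (by change 1 / 2 ≤ E.u w; linarith), hl2 w (by linarith)]
      change (if t ≤ 1 then _ else _) = _
      rw [if_pos (by linarith), D.M_zero _ _ ht]; rfl
  · by_cases hw : E.u w < 1
    · rw [hk1 (w, t) hw]
      exact hΓz ⟨w, hw⟩ _ t (hT0 w) (by linarith)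
    · rw [hk2 (w, t) (by change 1 / 2 ≤ E.u w; linarith)]
      change (if t ≤ 1 then _ else _) = _
      rw [if_neg (by linarith), D.L_one _ _ (by linarith)]

end Lifting

/-! ### Strictification of homotopy commutative ladders -/

section LiftSequence

theorem exists_seq_of_step {α : ℕ → Type*} (P : ∀ n, α n → α (n + 1) → Prop) (a₀ : α 0)
    (step : ∀ n a, ∃ b, P n a b) : ∃ s : ∀ n, α n, ∀ n, P n (s n) (s (n + 1)) := by
  choose next hnext using step
  exact ⟨fun n => Nat.rec a₀ (fun n a => next n a) n, fun n => hnext n _⟩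

variable {W Y Z : ℕ → Type*} [∀ n, TopologicalSpace (W n)] [∀ n, TopologicalSpace (Y n)]
  [∀ n, TopologicalSpace (Z n)]

/-- Lifts up to homotopy of a homotopy commutative ladder `φ n : W n → Z n` along a strict ladder
`Rb n : Y n → Z n` of homotopy equivalences can be chosen to form a strict ladder. -/
theorem exists_strict_lift {i : ∀ n, C(W n, W (n + 1))} (f : ∀ n, C(Y n, Y (n + 1)))
    (g : ∀ n, C(Z n, Z (n + 1))) (E : ∀ n, NeighbourhoodDeformation (i n))
    (Rb : ∀ n, C(Y n, Z n)) (hR : ∀ n y, g n (Rb n y) = Rb (n + 1) (f n y))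
    (D : ∀ n, CoherentInverse (Rb n)) (φ : ∀ n, C(W n, Z n))
    (c : ∀ n, C(W n × ℝ, Z (n + 1))) (hc0 : ∀ n x t, t ≤ 0 → c n (x, t) = g n (φ n x))
    (hc1 : ∀ n x t, 1 ≤ t → c n (x, t) = φ (n + 1) (i n x)) :
    ∃ (l : ∀ n, C(W n, Y n)) (k : ∀ n, C(W n × ℝ, Z n)) (a : ℕ → ℝ), (∀ n, 0 ≤ a n) ∧
      (∀ n, a n + 1 ≤ a (n + 1)) ∧ (∀ n x, l (n + 1) (i n x) = f n (l n x)) ∧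
      (∀ n x t, t ≤ 0 → k n (x, t) = Rb n (l n x)) ∧ (∀ n x t, a n ≤ t → k n (x, t) = φ n x) ∧
      (∀ n x t, t ≤ a n → k (n + 1) (i n x, t) = g n (k n (x, t))) ∧
      ∀ n x t, a n ≤ t → k (n + 1) (i n x, t) = c n (x, t - a n) := by
  -- A stage of the recursion records the lift, the homotopy to `φ n` and the time `a` at which that
  -- homotopy has ended.
  let α : ℕ → Type _ := fun n => {s : C(W n, Y n) × C(W n × ℝ, Z n) × ℝ // 0 ≤ s.2.2 ∧
    (∀ x t, t ≤ 0 → s.2.1 (x, t) = Rb n (s.1 x)) ∧ ∀ x t, s.2.2 ≤ t → s.2.1 (x, t) = φ n x}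
  have hb : ∀ q : W 0 × ℝ, q.2 = 1 →
      (D 0).M ((D 0).S (φ 0 q.1), q.2) = (D 0).L (φ 0 q.1, q.2 - 1) := by
    rintro ⟨w, t⟩ rfl
    rw [(D 0).M_one _ _ le_rfl, (D 0).L_zero _ _ (by simp)]
  let s₀ : α 0 := ⟨((D 0).S.comp (φ 0), ⟨fun q => if q.2 ≤ 1 then
      (D 0).M ((D 0).S (φ 0 q.1), q.2) else (D 0).L (φ 0 q.1, q.2 - 1),
      Continuous.if_le (by fun_prop) (by fun_prop) (by fun_prop) (by fun_prop) hb⟩, 2), by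
    refine ⟨zero_le_two, fun x t ht => ?_, fun x t ht => ?_⟩
    · change (if t ≤ 1 then _ else _) = _
      rw [if_pos (by linarith), (D 0).M_zero _ _ ht]; rfl
    · change 2 ≤ t at ht
      change (if t ≤ 1 then _ else _) = _
      rw [if_neg (by linarith), (D 0).L_one _ _ (by linarith)]⟩
  obtain ⟨s, hs⟩ := exists_seq_of_step (α := α) (fun n s s' =>
    s.1.2.2 + 1 ≤ s'.1.2.2 ∧ (∀ x, s'.1.1 (i n x) = f n (s.1.1 x)) ∧
    (∀ x t, t ≤ s.1.2.2 → s'.1.2.1 (i n x, t) = g n (s.1.2.1 (x, t))) ∧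
    ∀ x t, s.1.2.2 ≤ t → s'.1.2.1 (i n x, t) = c n (x, t - s.1.2.2)) s₀ (by
    rintro n ⟨⟨l, k, a⟩, ha, h0, h1⟩
    simp only at ha h0 h1
    have hb : ∀ q : W n × ℝ, q.2 = a → g n (k q) = c n (q.1, q.2 - a) := by
      rintro ⟨x, t⟩ rfl
      rw [hc0 _ _ _ (by simp), h1 _ _ le_rfl]
    -- On the image of `W n` the path is prescribed: the previous homotopy pushed forward by `g`,
    -- followed by one unit of `c`. Hence it ends at time `a + 1`, and its extension at `a + 1 + 4`.
    let k₁ : C(W n × ℝ, Z (n + 1)) := ⟨fun q => if q.2 ≤ a then g n (k q) else c n (q.1, q.2 - a),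
      Continuous.if_le (by fun_prop) (by fun_prop) (by fun_prop) (by fun_prop) hb⟩
    have hk1 : ∀ x t, t ≤ a → k₁ (x, t) = g n (k (x, t)) := fun x t ht => if_pos ht
    have hk2 : ∀ x t, a ≤ t → k₁ (x, t) = c n (x, t - a) := fun x t ht => by
      rcases ht.eq_or_lt with h | h
      · rw [hk1 x t h.symm.le, hb (x, t) h.symm]
      · exact if_neg (not_le.2 h)
    obtain ⟨l', k', hl, hk, hk0, hk3⟩ := (D (n + 1)).exists_lift (E n) (φ (n + 1)) ((f n).comp l)
      k₁ (a := a + 1) (by linarith)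
      (fun x t ht => by rw [hk1 x t (by linarith), h0 _ _ ht, hR]; rfl)
      (fun x t ht => by rw [hk2 x t (by linarith), hc1 _ _ _ (by linarith)])
    refine ⟨⟨(l', k', a + 1 + 4), by simp only; linarith, hk0, hk3⟩, ?_, hl, ?_, ?_⟩
    · simp only; linarith
    · intro x t ht
      simp only [hk]
      exact hk1 x t ht
    · intro x t ht
      simp only [hk]
      exact hk2 x t ht)
  exact ⟨fun n => (s n).1.1, fun n => (s n).1.2.1, fun n => (s n).1.2.2, fun n => (s n).2.1,
    fun n => (hs n).1, fun n => (hs n).2.1, fun n => (s n).2.2.1, fun n => (s n).2.2.2,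
    fun n => (hs n).2.2.1, fun n => (hs n).2.2.2⟩

end LiftSequence

/-! ### Homotopies with unbounded parameter -/

/-- A homotopy with parameter in `[0, ∞)` which is eventually constant on each member of a family
of pieces that determines the topology. -/
theorem homotopic_of_eventually_const {κ : Type*} {P : κ → Type*} [∀ i, TopologicalSpace (P i)]
    {C Z : Type*} [TopologicalSpace C] [TopologicalSpace Z] {q : (Σ i, P i) → C}
    (hq : IsQuotientMap q) (F : C → ℝ → Z)
    (hF : ∀ i, Continuous fun p : P i × ℝ => F (q ⟨i, p.1⟩) p.2) {a : κ → ℝ} {φ ψ : C(C, Z)}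
    (h0 : ∀ x, F x 0 = φ x) (h1 : ∀ i x t, a i ≤ t → F (q ⟨i, x⟩) t = ψ (q ⟨i, x⟩)) :
    φ.Homotopic ψ := by
  -- The substitution `s ↦ s / (1 - s)` compresses `[0, ∞)` to `[0, 1)`. On a piece where nothing
  -- changes after time `a i`, the denominator may be bounded below by `1 / (|a i| + 1)` without
  -- affecting the value, which makes the formula continuous up to `s = 1`.
  let H : C → unitInterval → Z := fun x s => if s.1 < 1 then F x (s.1 / (1 - s.1)) else ψ x
  have key : ∀ i x s, H (q ⟨i, x⟩) s =
      F (q ⟨i, x⟩) (s.1 / max (1 - s.1) (1 / (|a i| + 1))) := fun i x s => by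
    have hε : 0 < |a i| + 1 := by positivity
    have hε1 : 1 / (|a i| + 1) ≤ 1 := by
      rw [div_le_one hε]; linarith [abs_nonneg (a i)]
    rcases le_or_gt (1 / (|a i| + 1)) (1 - s.1) with h | h
    · rw [max_eq_left h]
      exact if_pos (by have : 0 < 1 / (|a i| + 1) := by positivity
                       linarith)
    · rw [max_eq_right h.le, h1 i x (s.1 / (1 / (|a i| + 1)))]
      · change (if s.1 < 1 then _ else _) = _
        split_ifs with hs
        · refine h1 i x _ ?_
          rw [le_div_iff₀ (by linarith)]
          rw [lt_div_iff₀ hε] at h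
          nlinarith [le_abs_self (a i)]
        · rfl
      · rw [div_div_eq_mul_div, div_one]
        have h2 : 1 - 1 / (|a i| + 1) < s.1 := by linarith
        have h3 : (1 - 1 / (|a i| + 1)) * (|a i| + 1) = |a i| := by field_simp; ring
        nlinarith [le_abs_self (a i)]
  have hc : ∀ i, Continuous fun p : P i × unitInterval => H (q ⟨i, p.1⟩) p.2 := fun i => by
    simp only [key]
    refine (hF i).comp (continuous_fst.prodMk (Continuous.div (by fun_prop) (by fun_prop) ?_))
    intro p
    exact (lt_max_of_lt_right (by positivity)).ne'
  -- Continuity is checked after currying, because the product of a quotient map with an interval is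
  -- then not needed.
  let G : C → C(unitInterval, Z) := fun x => ⟨H x, by
    obtain ⟨⟨i, y⟩, rfl⟩ := hq.surjective x
    exact (hc i).comp (by fun_prop : Continuous fun s : unitInterval => (y, s))⟩
  have hG : Continuous G := by
    refine hq.continuous_iff.2 (continuous_sigma fun i => ?_)
    exact ContinuousMap.continuous_of_continuous_uncurry _ (hc i)
  refine ⟨⟨⟨fun p => G p.2 p.1, ?_⟩, fun x => ?_, fun x => ?_⟩⟩
  · exact (ContinuousMap.continuous_uncurry_of_continuous ⟨G, hG⟩).comp continuous_swap
  · change H x 0 = _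
    simp [H, h0]
  · change H x 1 = _
    simp [H]

theorem homotopic_of_realHomotopy {A Z : Type*} [TopologicalSpace A] [TopologicalSpace Z]
    {f g : C(A, Z)} (k : C(A × ℝ, Z)) {a : ℝ} (h0 : ∀ x, k (x, 0) = f x)
    (h1 : ∀ x t, a ≤ t → k (x, t) = g x) : f.Homotopic g :=
  homotopic_of_eventually_const (P := fun _ : Unit => A) (q := fun p => p.2) (a := fun _ => a)
    (IsQuotientMap.of_inverse (f := fun x : A => (⟨(), x⟩ : Σ _ : Unit, A))
      (continuous_sigmaMk (σ := fun _ : Unit => A)) (continuous_sigma fun _ => continuous_id)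
      fun _ => rfl)
    (fun x t => k (x, t)) (fun _ => k.continuous) h0 fun _ => h1

/-! ### Direct limits and mapping telescopes -/

section Sequences

variable {A B : ℕ → Type u} [∀ n, TopologicalSpace (A n)] [∀ n, TopologicalSpace (B n)]
  {f : ∀ n, C(A n, A (n + 1))} {g : ∀ n, C(B n, B (n + 1))}

theorem SeqColim.of_step (n : ℕ) (x : A n) :
    SeqColim.of f (n + 1) (f n x) = SeqColim.of f n x :=
  (Quot.sound (SeqColim.Rel.step n x)).symm

variable (f) in
theorem SeqColim.isQuotientMap :
    IsQuotientMap (fun p : Σ n, A n => SeqColim.of f p.1 p.2) :=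
  isQuotientMap_quot_mk

/-- The map out of the direct limit given by compatible maps of the terms. -/
def SeqColim.desc {Z : Type*} [TopologicalSpace Z] (l : ∀ n, C(A n, Z))
    (h : ∀ n x, l (n + 1) (f n x) = l n x) : C(SeqColim f, Z) where
  toFun := Quot.lift (fun p => l p.1 p.2) (by
    rintro _ _ ⟨n, x⟩
    exact (h n x).symm)
  continuous_toFun := continuous_quot_lift _ (continuous_sigma fun n => (l n).continuous)

theorem SeqColim.ext {Z : Type*} {φ ψ : SeqColim f → Z}
    (h : ∀ n x, φ (SeqColim.of f n x) = ψ (SeqColim.of f n x)) : φ = ψ := by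
  funext z
  obtain ⟨⟨n, x⟩, rfl⟩ := (SeqColim.isQuotientMap f).surjective z
  exact h n x

/-- Compatible eventually constant homotopies on the terms induce a homotopy on the direct
limit. -/
theorem SeqColim.homotopic {Z : Type*} [TopologicalSpace Z] (k : ∀ n, C(A n × ℝ, Z))
    (hk : ∀ n x t, k (n + 1) (f n x, t) = k n (x, t)) {a : ℕ → ℝ} {φ ψ : C(SeqColim f, Z)}
    (h0 : ∀ n x, k n (x, 0) = φ (SeqColim.of f n x))
    (h1 : ∀ n x t, a n ≤ t → k n (x, t) = ψ (SeqColim.of f n x)) : φ.Homotopic ψ := by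
  refine homotopic_of_eventually_const (SeqColim.isQuotientMap f)
    (fun z t => Quot.lift (fun p : Σ n, A n => k p.1 (p.2, t)) ?_ z) (fun n => (k n).continuous)
    (fun z => ?_) h1
  · rintro _ _ ⟨n, x⟩
    exact (hk n x t).symm
  · obtain ⟨⟨n, x⟩, rfl⟩ := (SeqColim.isQuotientMap f).surjective z
    exact h0 n x

/-- The map of direct limits induced by a strict ladder. -/
def SeqColim.map (φ : ∀ n, C(A n, B n)) (h : ∀ n x, g n (φ n x) = φ (n + 1) (f n x)) :
    C(SeqColim f, SeqColim g) :=
  SeqColim.desc (fun n => (SeqColim.of g n).comp (φ n)) fun n x => by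
    change SeqColim.of g (n + 1) (φ (n + 1) (f n x)) = SeqColim.of g n (φ n x)
    rw [← h, SeqColim.of_step]

/-- Since `R ≃ R S R' ≃ R'`, also `S R ≃ S R' ≃ id`. Thus it suffices to produce right inverses
twice. -/
theorem isHomotopyEquivalence_of_right_inverses {X Y : Type*} [TopologicalSpace X]
    [TopologicalSpace Y] {R : C(X, Y)} {S : C(Y, X)} {R' : C(X, Y)}
    (h : (R.comp S).Homotopic (.id Y)) (h' : (S.comp R').Homotopic (.id X)) :
    IsHomotopyEquivalence R := by
  refine ⟨S, ?_, h⟩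
  have h1 : R.Homotopic R' := by
    have e1 : (R.comp (S.comp R')).Homotopic (R.comp (.id X)) := .comp (.refl R) h'
    have e2 : ((R.comp S).comp R').Homotopic ((ContinuousMap.id Y).comp R') := .comp h (.refl R')
    exact e1.symm.trans e2
  exact (ContinuousMap.Homotopic.comp (.refl S) h1).trans h'

/-- A strict ladder of maps with coherent inverses over a sequence of neighbourhood deformation
retracts has a strict ladder of right homotopy inverses. -/
theorem exists_right_inverse_ladder (E : ∀ n, NeighbourhoodDeformation (g n))
    (R : ∀ n, C(A n, B n)) (hR : ∀ n x, g n (R n x) = R (n + 1) (f n x))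
    (D : ∀ n, CoherentInverse (R n)) :
    ∃ (S : ∀ n, C(B n, A n)) (hS : ∀ n x, f n (S n x) = S (n + 1) (g n x)),
      (∀ n, ((R n).comp (S n)).Homotopic (.id (B n))) ∧
      ((SeqColim.map R hR).comp (SeqColim.map S hS)).Homotopic (.id (SeqColim g)) := by
  -- A right homotopy inverse is a homotopy lift of the identity. The identities commute strictly
  -- with `g`, so the homotopies `c` are constant.
  obtain ⟨l, k, a, ha, haa, hl, hk0, hk1, hk2, hk3⟩ := exists_strict_lift f g E R hR D
    (fun n => .id (B n)) (fun n => (g n).comp .fst) (fun _ _ _ _ => rfl) (fun _ _ _ _ => rfl)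
  refine ⟨l, fun n x => (hl n x).symm, fun n => ?_, ?_⟩
  · exact homotopic_of_realHomotopy (k n) (fun x => hk0 n x 0 le_rfl) (hk1 n)
  · refine SeqColim.homotopic (fun n => (SeqColim.of g n).comp (k n)) (fun n x t => ?_) (a := a)
      (fun n x => ?_) (fun n x t ht => ?_)
    · change SeqColim.of g _ (k (n + 1) (g n x, t)) = SeqColim.of g n (k n (x, t))
      -- Before time `a n` the two homotopies agree by construction; after it both have reached the
      -- point they were aiming at, and they agree in the limit.
      rcases le_total t (a n) with h | h
      · rw [hk2 _ _ _ h, SeqColim.of_step]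
      · rw [hk3 _ _ _ h, hk1 _ _ _ h]
        exact SeqColim.of_step n x
    · exact congrArg (SeqColim.of g n) (hk0 n x 0 le_rfl)
    · exact congrArg (SeqColim.of g n) (hk1 n x t ht)

/-- The inclusion of the `n`-th cylinder into the telescope. -/
def Telescope.cyl (f : ∀ n, C(A n, A (n + 1))) (n : ℕ) :
    C(A n × unitInterval, Telescope f) where
  toFun p := Quot.mk _ ⟨n, p⟩
  continuous_toFun := continuous_quot_mk.comp continuous_sigmaMk

theorem Telescope.cyl_one (n : ℕ) (x : A n) :
    Telescope.cyl f n (x, 1) = Telescope.cyl f (n + 1) (f n x, 0) :=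
  Quot.sound (Telescope.Rel.step n x)

variable (f) in
theorem Telescope.isQuotientMap :
    IsQuotientMap (fun p : Σ n, A n × unitInterval => Telescope.cyl f p.1 p.2) :=
  isQuotientMap_quot_mk

/-- For a sequence of neighbourhood deformation retracts, the telescope is homotopy equivalent to
the direct limit. -/
theorem Telescope.isHomotopyEquivalence_toColim (E : ∀ n, NeighbourhoodDeformation (f n)) :
    IsHomotopyEquivalence (Telescope.toColim f) := by
  let p : ℝ → unitInterval := Set.projIcc 0 1 zero_le_one
  have hp : Continuous p := continuous_projIcc
  have hp0 : ∀ t, t ≤ 0 → p t = 0 := fun t ht => Set.projIcc_of_le_left _ ht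
  have hp1 : ∀ t, 1 ≤ t → p t = 1 := fun t ht => Set.projIcc_of_right_le _ ht
  -- The inclusions of the initial ends of the cylinders form a ladder into the constant sequence of
  -- the telescope, and the cylinders themselves are the homotopies by which it commutes.
  -- Strictifying gives compatible maps from the terms to the telescope.
  obtain ⟨l, k, a, ha, haa, hl, hk0, hk1, hk2, hk3⟩ := exists_strict_lift
    (Y := fun _ => Telescope f) (Z := fun _ => Telescope f)
    (fun _ => .id _) (fun _ => .id _) E (fun _ => .id _) (fun _ _ => rfl)
    (fun _ => CoherentInverse.id _)
    (fun n => (Telescope.cyl f n).comp ⟨fun x => (x, 0), by fun_prop⟩)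
    (fun n => (Telescope.cyl f n).comp ⟨fun q => (q.1, p q.2), by fun_prop⟩)
    (fun n x t ht => by
      change Telescope.cyl f n (x, p t) = Telescope.cyl f n (x, 0)
      rw [hp0 t ht])
    (fun n x t ht => by
      change Telescope.cyl f n (x, p t) = Telescope.cyl f (n + 1) (f n x, 0)
      rw [hp1 t ht, Telescope.cyl_one])
  have hk1' : ∀ n x t, a n ≤ t → k n (x, t) = Telescope.cyl f n (x, 0) := hk1
  have hk2' : ∀ n x t, t ≤ a n → k (n + 1) (f n x, t) = k n (x, t) := hk2
  have hk3' : ∀ n x t, a n ≤ t → k (n + 1) (f n x, t) = Telescope.cyl f n (x, p (t - a n)) := hk3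
  have hπ : ∀ n x s, Telescope.toColim f (Telescope.cyl f n (x, s)) = SeqColim.of f n x :=
    fun _ _ _ => rfl
  let G : C(SeqColim f, Telescope f) := SeqColim.desc l hl
  refine ⟨G, ?_, ?_⟩
  · have hcb : ∀ n, ∀ q : (A n × unitInterval) × ℝ, q.2 = a n →
        k n (q.1.1, q.2) = Telescope.cyl f n (q.1.1, min q.1.2 (p (q.2 - a n))) := by
      rintro n ⟨⟨x, s⟩, t⟩ h
      simp only at h ⊢
      rw [hk1' n x t h.symm.le, hp0 _ (by linarith), min_eq_right unitInterval.nonneg']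
    -- First follow `k n`, which ends at height `0` of the cylinder, then climb to height `s` and
    -- stop.
    let F : ∀ n, C((A n × unitInterval) × ℝ, Telescope f) := fun n =>
      ⟨fun q => if q.2 ≤ a n then k n (q.1.1, q.2)
        else Telescope.cyl f n (q.1.1, min q.1.2 (p (q.2 - a n))),
        Continuous.if_le (by fun_prop) (by fun_prop) (by fun_prop) (by fun_prop) (hcb n)⟩
    have hF1 : ∀ n x s t, t ≤ a n → F n ((x, s), t) = k n (x, t) := fun n x s t h => if_pos h
    have hF2 : ∀ n x s t, a n ≤ t →
        F n ((x, s), t) = Telescope.cyl f n (x, min s (p (t - a n))) := fun n x s t h => by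
      rcases h.eq_or_lt with h | h
      · rw [hF1 n x s t h.symm.le, hcb n ((x, s), t) h.symm]
      · exact if_neg (not_le.2 h)
    refine homotopic_of_eventually_const (Telescope.isQuotientMap f) (a := fun n => a n + 1)
      (fun z t => Quot.lift (fun q : Σ n, A n × unitInterval => F q.1 (q.2, t)) ?_ z)
      (fun n => (F n).continuous) (fun z => ?_) (fun n => ?_)
    · rintro _ _ ⟨n, x⟩
      change F n ((x, 1), t) = F (n + 1) ((f n x, 0), t)
      have h1 : ∀ s : unitInterval, min 1 s = s := fun s => min_eq_right unitInterval.le_one'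
      have h2 : ∀ s : unitInterval, min 0 s = 0 := fun s => min_eq_left unitInterval.nonneg'
      rcases le_total t (a (n + 1)) with h | h
      · rw [hF1 (n + 1) _ _ _ h]
        rcases le_total t (a n) with h' | h'
        · rw [hF1 n _ _ _ h', hk2' _ _ _ h']
        · rw [hF2 n _ _ _ h', hk3' _ _ _ h', h1]
      -- The inequality `a n + 1 ≤ a (n + 1)` ensures that the climb to the top of one cylinder is
      -- over before the climb in the next begins.
      · have := haa n
        rw [hF2 (n + 1) _ _ _ h, hF2 n _ _ _ (by linarith), h1, h2, hp1 _ (by linarith),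
          Telescope.cyl_one]
    · obtain ⟨⟨n, x, s⟩, rfl⟩ := (Telescope.isQuotientMap f).surjective z
      change F n ((x, s), 0) = l n x
      rw [hF1 n x s 0 (ha n)]
      exact hk0 n x 0 le_rfl
    · rintro ⟨x, s⟩ t ht
      change F n ((x, s), t) = Telescope.cyl f n (x, s)
      rw [hF2 n x s t (by linarith), hp1 _ (by linarith), min_eq_left unitInterval.le_one']
  · refine SeqColim.homotopic (fun n => (Telescope.toColim f).comp (k n)) (fun n x t => ?_)
      (a := a) (fun n x => ?_) (fun n x t ht => ?_)
    · change Telescope.toColim f (k (n + 1) (f n x, t)) = Telescope.toColim f (k n (x, t))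
      rcases le_total t (a n) with h | h
      · rw [hk2' _ _ _ h]
      · rw [hk3' _ _ _ h, hk1' _ _ _ h, hπ, hπ]
    · exact congrArg (Telescope.toColim f) (hk0 n x 0 le_rfl)
    · change Telescope.toColim f (k n (x, t)) = _
      rw [hk1' n x t ht]
      rfl

end Sequences

/-! ### Continuity for the topology of a cell complex -/

section CellTopology

variable {P : Type u} {J ι : Type*} {κ : P → J → ℝ} {C : ι → Set P} [tP : TopologicalSpace P]

/-- A map into a single cell is continuous if its coordinates are. -/
theorem continuous_of_mapsTo_cell (hP : tP = cellTopology κ C) {S : Type*} [TopologicalSpace S]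
    {q : S → P} (i : ι) (hq : ∀ s, q s ∈ C i) (hc : ∀ j, Continuous fun s => κ (q s) j) :
    Continuous q := by
  subst hP
  let t : TopologicalSpace (C i) := TopologicalSpace.induced (fun p => κ p.1) inferInstance
  have h1 : Continuous (fun s => (⟨q s, hq s⟩ : C i)) :=
    continuous_induced_rng.2 (continuous_pi hc)
  have h2 : @Continuous (C i) P t (cellTopology κ C) Subtype.val :=
    continuous_iSup_rng (i := i) continuous_coinduced_rng
  exact @Continuous.comp _ _ _ _ t (cellTopology κ C) _ _ h2 h1

/-- Cells are probed by arbitrary families `q` with values in one cell and continuous coordinates.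
This way the cells need not be handled as subspaces, and such families can be composed freely. -/
theorem isOpen_of_cells (hP : tP = cellTopology κ C) {O : Set P}
    (h : ∀ (i : ι) (S : Type u) [TopologicalSpace S] (q : S → P), (∀ s, q s ∈ C i) →
      (∀ j, Continuous fun s => κ (q s) j) → IsOpen (q ⁻¹' O)) : IsOpen O := by
  subst hP
  refine isOpen_iSup_iff.2 fun i => ?_
  rw [isOpen_coinduced]
  let t : TopologicalSpace (C i) := TopologicalSpace.induced (fun p => κ p.1) inferInstance
  exact h i (C i) Subtype.val (fun s => s.2) fun j =>
    (continuous_apply j).comp continuous_induced_dom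

theorem continuous_of_cells (hP : tP = cellTopology κ C) {Z : Type*} [TopologicalSpace Z]
    {f : P → Z}
    (h : ∀ (i : ι) (S : Type u) [TopologicalSpace S] (q : S → P), (∀ s, q s ∈ C i) →
      (∀ j, Continuous fun s => κ (q s) j) → Continuous fun s => f (q s)) : Continuous f :=
  continuous_def.2 fun O hO => isOpen_of_cells hP fun i S _ q hq hc =>
    (h i S q hq hc).isOpen_preimage O hO

theorem continuous_cell_coord (hP : tP = cellTopology κ C) (j : J) :
    Continuous fun p => κ p j :=
  continuous_of_cells hP fun _ _ _ _ _ hc => hc j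

/-- Local compactness of `T` allows currying to a map from `P` into `C(T, Z)`, whose continuity can
be tested on cells. -/
theorem continuous_prod_of_cells (hP : tP = cellTopology κ C) {T Z : Type*} [TopologicalSpace T]
    [LocallyCompactSpace T] [TopologicalSpace Z] {f : P × T → Z} (hT : ∀ p, ∃ i, p ∈ C i)
    (h : ∀ (i : ι) (S : Type u) [TopologicalSpace S] (q : S → P), (∀ s, q s ∈ C i) →
      (∀ j, Continuous fun s => κ (q s) j) → Continuous fun p : S × T => f (q p.1, p.2)) :
    Continuous f := by
  let G : P → C(T, Z) := fun p => ⟨fun t => f (p, t), by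
    obtain ⟨i, hi⟩ := hT p
    exact (h i PUnit (fun _ => p) (fun _ => hi) fun _ => continuous_const).comp
      (by fun_prop : Continuous fun t : T => (PUnit.unit, t))⟩
  have hG : Continuous G := continuous_of_cells hP fun i S _ q hq hc =>
    ContinuousMap.continuous_of_continuous_uncurry _ (h i S q hq hc)
  exact ContinuousMap.continuous_uncurry_of_continuous ⟨G, hG⟩

/-- The open set `{u < 1}` again has the weak topology with respect to its traces on the cells; this
serves for retractions defined only near a subspace. -/
theorem continuous_subtype_of_cells (hP : tP = cellTopology κ C) {Z : Type*} [TopologicalSpace Z]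
    {u : P → ℝ} (hu : Continuous u) {f : {p // u p < 1} → Z}
    (h : ∀ (i : ι) (S : Type u) [TopologicalSpace S] (q : S → P), (∀ s, q s ∈ C i) →
      (∀ j, Continuous fun s => κ (q s) j) → ∀ hlt : ∀ s, u (q s) < 1,
      Continuous fun s => f ⟨q s, hlt s⟩) : Continuous f := by
  refine continuous_def.2 fun O hO => ?_
  have hU : IsOpen {p | u p < 1} := isOpen_lt hu continuous_const
  have : IsOpen (Subtype.val '' (f ⁻¹' O)) := isOpen_of_cells hP fun i S _ q hq hc => by
    have hqc : Continuous q := continuous_of_mapsTo_cell hP i hq hc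
    have hV : IsOpen {s | u (q s) < 1} := hU.preimage hqc
    have h1 := (h i {s // u (q s) < 1} (fun s => q s.1) (fun s => hq s.1)
      (fun j => (hc j).comp continuous_subtype_val) fun s => s.2).isOpen_preimage O hO
    have h2 := hV.isOpenMap_subtype_val _ h1
    convert h2 using 1
    ext s
    constructor
    · rintro ⟨⟨p, hp⟩, hpO, hps⟩
      obtain rfl : p = q s := hps
      exact ⟨⟨s, hp⟩, hpO, rfl⟩
    · rintro ⟨⟨s', hs'⟩, hO', rfl⟩
      exact ⟨⟨q s', hs'⟩, hO', rfl⟩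
  rw [← Set.preimage_image_eq (f ⁻¹' O) Subtype.val_injective]
  exact this.preimage continuous_subtype_val

end CellTopology

/-! ### Points and maps of spatial realizations -/

namespace PreAbstractSimplicialComplex.Realization

variable {V : Type u} {K L : PreAbstractSimplicialComplex V}

theorem sum_face (p : K.Realization) {s : Finset V} (h : p.coord.support ⊆ s) :
    ∑ v ∈ s, p.coord v = 1 := by
  rw [← p.sum_eq, Finsupp.sum_of_support_subset _ h _ (by simp)]

theorem support_nonempty (p : K.Realization) : p.coord.support.Nonempty :=
  (K.isRelLowerSet_faces p.support_mem).1

theorem coord_eq_zero (p : K.Realization) {s : Finset V} (h : p.coord.support ⊆ s) {v : V}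
    (hv : v ∉ s) : p.coord v = 0 :=
  Finsupp.notMem_support_iff.1 fun hv' => hv (h hv')

theorem ext_coord {p q : K.Realization} (h : ∀ v, p.coord v = q.coord v) : p = q :=
  Realization.ext (Finsupp.ext h)

theorem mem_support_iff_pos (p : K.Realization) (v : V) : v ∈ p.coord.support ↔ 0 < p.coord v := by
  rw [Finsupp.mem_support_iff]
  exact ⟨fun h => lt_of_le_of_ne (p.nonneg v) h.symm, fun h => h.ne'⟩

open Classical in
/-- The point of `|K|` with given barycentric coordinates in a face `s`. -/
def ofWeights (s : Finset V) (w : V → ℝ) (hs : s ∈ K.faces) (h0 : ∀ v, 0 ≤ w v)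
    (hw : ∀ v ∉ s, w v = 0) (h1 : ∑ v ∈ s, w v = 1) : K.Realization :=
  have hsub : (Finsupp.onFinset s w fun v hv => by
      by_contra h; exact hv (hw v h)).support ⊆ s := Finsupp.support_onFinset_subset
  have hsum : ((Finsupp.onFinset s w fun v hv => by
      by_contra h; exact hv (hw v h)).sum fun _ a => a) = 1 := by
    rw [Finsupp.sum_of_support_subset _ hsub _ (by simp)]
    exact h1
  { coord := Finsupp.onFinset s w fun v hv => by
      by_contra h; exact hv (hw v h)
    nonneg := h0
    sum_eq := hsum
    support_mem := by
      refine (K.isRelLowerSet_faces hs).2 hsub ?_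
      rw [Finsupp.support_nonempty_iff]
      intro h
      rw [h, Finsupp.sum_zero_index] at hsum
      exact zero_ne_one hsum }

theorem ofWeights_coord {s : Finset V} {w : V → ℝ} (hs : s ∈ K.faces) (h0 : ∀ v, 0 ≤ w v)
    (hw : ∀ v ∉ s, w v = 0) (h1 : ∑ v ∈ s, w v = 1) (v : V) :
    (ofWeights s w hs h0 hw h1).coord v = w v := rfl

theorem ofWeights_support {s : Finset V} {w : V → ℝ} (hs : s ∈ K.faces) (h0 : ∀ v, 0 ≤ w v)
    (hw : ∀ v ∉ s, w v = 0) (h1 : ∑ v ∈ s, w v = 1) :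
    (ofWeights s w hs h0 hw h1).coord.support ⊆ s := fun v hv => by
  by_contra h
  exact Finsupp.mem_support_iff.1 hv (hw v h)

theorem continuous_of_mapsTo_face {S : Type*} [TopologicalSpace S] {q : S → K.Realization}
    {s : Finset V} (hs : s ∈ K.faces) (hq : ∀ x, (q x).coord.support ⊆ s)
    (hc : ∀ v, Continuous fun x => (q x).coord v) : Continuous q :=
  continuous_of_mapsTo_cell rfl (⟨s, hs⟩ : K.faces) hq hc

theorem continuous_coord (v : V) : Continuous fun p : K.Realization => p.coord v :=
  continuous_cell_coord (κ := fun (p : K.Realization) v => p.coord v) rfl v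

theorem continuous_of_faces {Z : Type*} [TopologicalSpace Z] {f : K.Realization → Z}
    (h : ∀ s ∈ K.faces, ∀ (S : Type u) [TopologicalSpace S] (q : S → K.Realization),
      (∀ x, (q x).coord.support ⊆ s) → (∀ v, Continuous fun x => (q x).coord v) →
      Continuous fun x => f (q x)) : Continuous f :=
  continuous_of_cells (κ := fun (p : K.Realization) v => p.coord v) rfl
    fun s S _ q hq hc => h s.1 s.2 S q hq hc

theorem continuous_prod_of_faces {T Z : Type*} [TopologicalSpace T] [LocallyCompactSpace T]
    [TopologicalSpace Z] {f : K.Realization × T → Z}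
    (h : ∀ s ∈ K.faces, ∀ (S : Type u) [TopologicalSpace S] (q : S → K.Realization),
      (∀ x, (q x).coord.support ⊆ s) → (∀ v, Continuous fun x => (q x).coord v) →
      Continuous fun p : S × T => f (q p.1, p.2)) : Continuous f :=
  continuous_prod_of_cells (κ := fun (p : K.Realization) v => p.coord v) rfl
    (fun p => ⟨(⟨_, p.support_mem⟩ : K.faces), fun _ hv => hv⟩)
    fun s S _ q hq hc => h s.1 s.2 S q hq hc

/-! ### Full subcomplexes -/

section Full

open Classical in
/-- The total weight of the vertices of `p` with the property `g`. -/
def mass (g : V → Prop) (p : K.Realization) : ℝ :=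
  ∑ v ∈ p.coord.support, if g v then p.coord v else 0

open Classical in
theorem mass_eq (g : V → Prop) (p : K.Realization) {s : Finset V} (h : p.coord.support ⊆ s) :
    mass g p = ∑ v ∈ s, if g v then p.coord v else 0 :=
  Finset.sum_subset h fun v _ hv => by simp [Finsupp.notMem_support_iff.1 hv]

theorem continuous_mass (g : V → Prop) : Continuous (mass g : K.Realization → ℝ) := by
  classical
  refine continuous_of_faces fun s _ S _ q hq hc => ?_
  simp only [mass_eq g _ (hq _)]
  refine continuous_finsetSum _ fun v _ => ?_
  split_ifs
  exacts [hc v, continuous_const]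

theorem mass_nonneg (g : V → Prop) (p : K.Realization) : 0 ≤ mass g p := by
  refine Finset.sum_nonneg fun v _ => ?_
  split_ifs
  exacts [p.nonneg v, le_rfl]

theorem mass_le_one (g : V → Prop) (p : K.Realization) : mass g p ≤ 1 := by
  rw [← p.sum_face subset_rfl]
  refine Finset.sum_le_sum fun v _ => ?_
  split_ifs
  exacts [le_rfl, p.nonneg v]

/-- The factor by which the coordinates of `p` are multiplied at time `t` of the deformation of
`|K|` to the full subcomplex on the vertices with the property `g`. -/
def fullFactor (g : V → Prop) [DecidablePred g] (p : K.Realization) (t : ℝ) (v : V) : ℝ :=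
  if g v then 1 + t * ((1 - mass g p) / max (mass g p) (1 / 2))
  else 1 - t * (mass g p / max (mass g p) (1 / 2))

theorem half_max_pos (m : ℝ) : 0 < max m (1 / 2) := lt_max_of_lt_right (by norm_num)

theorem fullFactor_nonneg (g : V → Prop) [DecidablePred g] (p : K.Realization)
    (t : unitInterval) (v : V) : 0 ≤ fullFactor g p t v := by
  have h1 := mass_nonneg g p
  have h2 := mass_le_one g p
  have h3 := half_max_pos (mass g p)
  unfold fullFactor
  split_ifs
  · have : 0 ≤ (1 - mass g p) / max (mass g p) (1 / 2) := div_nonneg (by linarith) h3.le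
    have := mul_nonneg t.2.1 this
    linarith
  · have h4 : mass g p / max (mass g p) (1 / 2) ≤ 1 := (div_le_one h3).2 (le_max_left _ _)
    have h5 : 0 ≤ mass g p / max (mass g p) (1 / 2) := div_nonneg h1 h3.le
    have := mul_le_one₀ t.2.2 h5 h4
    linarith

/-- With `m` the mass on `g` and `M = max m (1/2)`, the vertices in `g` gain `t m (1 - m) / M` in
total, which is what the others lose. The maximum keeps the quotients defined when `m = 0`, and
equals `m` where the retraction is needed. -/
theorem fullFactor_sum (g : V → Prop) [DecidablePred g] (p : K.Realization) (t : ℝ)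
    {s : Finset V} (h : p.coord.support ⊆ s) :
    ∑ v ∈ s, p.coord v * fullFactor g p t v = 1 := by
  have h1 : ∑ v ∈ s, (if g v then p.coord v else 0) = mass g p := by
    rw [mass_eq g p h]
    exact Finset.sum_congr rfl fun v _ => by congr
  have h2 := p.sum_face h
  have h3 := (half_max_pos (mass g p)).ne'
  have : ∀ v ∈ s, p.coord v * fullFactor g p t v =
      p.coord v * (1 - t * (mass g p / max (mass g p) (1 / 2))) +
      (if g v then p.coord v else 0) * (t * (1 / max (mass g p) (1 / 2))) := fun v _ => by
    unfold fullFactor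
    split_ifs
    · field_simp; ring
    · ring
  rw [Finset.sum_congr rfl this, Finset.sum_add_distrib, ← Finset.sum_mul, ← Finset.sum_mul, h1,
    h2]
  field_simp
  ring

theorem continuous_fullFactor (g : V → Prop) [DecidablePred g] {S : Type*} [TopologicalSpace S]
    {q : S → K.Realization} {t : S → ℝ} (hq : Continuous q) (ht : Continuous t) (v : V) :
    Continuous fun x => fullFactor g (q x) (t x) v := by
  have hm := (continuous_mass g (K := K)).comp hq
  have hM : Continuous fun x => max (mass g (q x)) (1 / 2) := hm.max continuous_const
  have h0 : ∀ x, max (mass g (q x)) (1 / 2) ≠ 0 := fun x => (half_max_pos _).ne'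
  unfold fullFactor
  split_ifs
  · exact continuous_const.add (ht.mul ((continuous_const.sub hm).div hM h0))
  · exact continuous_const.sub (ht.mul (hm.div hM h0))

/-- The realization of a full subcomplex is a neighbourhood deformation retract. -/
theorem nonempty_neighbourhoodDeformation (hLK : L ≤ K) (g : V → Prop)
    (hL : ∀ s, s ∈ L.faces ↔ s ∈ K.faces ∧ ∀ v ∈ s, g v) :
    Nonempty (NeighbourhoodDeformation (Realization.incl hLK)) := by
  classical
  let defo : K.Realization × unitInterval → K.Realization := fun x =>
    ofWeights x.1.coord.support (fun v => x.1.coord v * fullFactor g x.1 x.2 v) x.1.support_mem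
      (fun v => mul_nonneg (x.1.nonneg v) (fullFactor_nonneg g x.1 x.2 v))
      (fun v hv => by rw [Finsupp.notMem_support_iff.1 hv, zero_mul])
      (fullFactor_sum g x.1 x.2 subset_rfl)
  have defo_coord : ∀ p t v, (defo (p, t)).coord v = p.coord v * fullFactor g p t v :=
    fun _ _ _ => rfl
  have defo_support : ∀ p t, (defo (p, t)).coord.support ⊆ p.coord.support :=
    fun _ _ => ofWeights_support _ _ _ _
  have hdefo : Continuous defo := by
    refine continuous_prod_of_faces fun s hs S _ q hq hc => ?_
    refine continuous_of_mapsTo_face hs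
      (fun x => (ofWeights_support _ _ _ _).trans (hq _)) fun v => ?_
    exact ((hc v).comp continuous_fst).mul (continuous_fullFactor g
      ((continuous_of_mapsTo_face hs hq hc).comp continuous_fst)
      (continuous_subtype_val.comp continuous_snd) v)
  have mass_incl : ∀ a : L.Realization, mass g (incl hLK a) = 1 := fun a => by
    rw [← a.sum_face subset_rfl]
    exact Finset.sum_congr rfl fun v hv => if_pos (((hL _).1 a.support_mem).2 v hv)
  -- The condition `uu p < 1` says that the mass exceeds `1/2`, so that at time `1` the factor of
  -- the vertices outside `g` vanishes.
  let uu : K.Realization → ℝ := fun p => 2 * (1 - mass g p)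
  have huu : Continuous uu := continuous_const.mul (continuous_const.sub (continuous_mass g))
  have factor_one : ∀ p, uu p < 1 → ∀ v, ¬ g v → fullFactor g p 1 v = 0 := fun p hp v hv => by
    have hm : 1 / 2 < mass g p := by simp only [uu] at hp; linarith
    unfold fullFactor
    rw [if_neg hv, max_eq_left hm.le, div_self (by linarith)]
    ring
  have hsupp : ∀ p (hp : uu p < 1), (defo (p, 1)).coord.support ∈ L.faces := fun p hp => by
    refine (hL _).2 ⟨(defo (p, 1)).support_mem, fun v hv => ?_⟩
    by_contra hg
    refine Finsupp.mem_support_iff.1 hv ?_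
    rw [defo_coord]
    erw [factor_one p hp v hg, mul_zero]
  let ret : {p // uu p < 1} → L.Realization := fun p =>
    ⟨(defo (p.1, 1)).coord, (defo (p.1, 1)).nonneg, (defo (p.1, 1)).sum_eq, hsupp p.1 p.2⟩
  have hret : Continuous ret := by
    refine continuous_subtype_of_cells (κ := fun (p : K.Realization) v => p.coord v) rfl huu ?_
    rintro ⟨s, hs⟩ S _ q hq hc hlt
    have hqc := continuous_of_mapsTo_face hs hq hc
    have hcoord : ∀ v, Continuous fun x => (ret ⟨q x, hlt x⟩).coord v := fun v => by
      have : Continuous fun x => (defo (q x, 1)).coord v :=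
        (continuous_coord v).comp (hdefo.comp (hqc.prodMk continuous_const))
      exact this
    rcases isEmpty_or_nonempty S with hS | ⟨⟨x₀⟩⟩
    · exact continuous_of_discreteTopology
    -- The retraction carries a face `s` into the face of the vertices of `s` in `g`. That set is a
    -- face only if it is non-empty, which is why a point `x₀` is needed.
    · have hsub : ∀ x, (ret ⟨q x, hlt x⟩).coord.support ⊆ s.filter g := fun x v hv => by
        refine Finset.mem_filter.2 ⟨?_, ((hL _).1 (ret ⟨q x, hlt x⟩).support_mem).2 v hv⟩
        have hqx : (q x).coord.support ⊆ s := hq x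
        exact hqx (defo_support (q x) 1 hv)
      refine continuous_of_mapsTo_face (s := s.filter g) ?_ hsub hcoord
      exact (hL _).2 ⟨(K.isRelLowerSet_faces hs).2 (Finset.filter_subset _ _)
        ((support_nonempty _).mono (hsub x₀)), fun v hv => (Finset.mem_filter.1 hv).2⟩
  have factor_incl : ∀ (a : L.Realization) t v,
      a.coord v * fullFactor g (incl hLK a) t v = a.coord v := fun a t v => by
    by_cases hv : v ∈ a.coord.support
    · unfold fullFactor
      rw [if_pos (((hL _).1 a.support_mem).2 v hv), mass_incl]
      ring
    · rw [Finsupp.notMem_support_iff.1 hv, zero_mul]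
  exact ⟨{
    u := ⟨uu, huu⟩
    h := ⟨defo, hdefo⟩
    ret := ⟨ret, hret⟩
    u_apply := fun a => by simp [uu, mass_incl]
    h_zero := fun p => ext_coord fun v => by
      change p.coord v * fullFactor g p 0 v = _
      unfold fullFactor
      split_ifs <;> ring
    h_apply := fun a t => ext_coord fun v => factor_incl a t v
    h_one := fun p => rfl
    ret_apply := fun a ha => ext_coord fun v => factor_incl a 1 v }⟩

end Full

/-- Two maps such that every face has images in a common face are homotopic, by straight lines. -/
theorem exists_linear_homotopy {f₀ f₁ : C(K.Realization, L.Realization)}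
    (h : ∀ s ∈ K.faces, ∃ t ∈ L.faces, ∀ p : K.Realization, p.coord.support ⊆ s →
      (f₀ p).coord.support ⊆ t ∧ (f₁ p).coord.support ⊆ t) :
    ∃ H : ContinuousMap.Homotopy f₀ f₁, ∀ t p v,
      (H (t, p)).coord v = (1 - t.1) * (f₀ p).coord v + t.1 * (f₁ p).coord v := by
  classical
  choose! T hT hsub using h
  let H : K.Realization × unitInterval → L.Realization := fun x =>
    ofWeights (T x.1.coord.support)
      (fun v => (1 - x.2.1) * (f₀ x.1).coord v + x.2.1 * (f₁ x.1).coord v)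
      (hT _ x.1.support_mem)
      (fun v => add_nonneg (mul_nonneg (by linarith [x.2.2.2]) ((f₀ x.1).nonneg v))
        (mul_nonneg x.2.2.1 ((f₁ x.1).nonneg v)))
      (fun v hv => by
        rw [coord_eq_zero _ (hsub _ x.1.support_mem x.1 subset_rfl).1 hv,
          coord_eq_zero _ (hsub _ x.1.support_mem x.1 subset_rfl).2 hv]
        ring)
      (by
        rw [Finset.sum_add_distrib, ← Finset.mul_sum, ← Finset.mul_sum,
          sum_face _ (hsub _ x.1.support_mem x.1 subset_rfl).1,
          sum_face _ (hsub _ x.1.support_mem x.1 subset_rfl).2]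
        ring)
  have hH : Continuous H := by
    refine continuous_prod_of_faces fun s hs S _ q hq hc => ?_
    have hqc := continuous_of_mapsTo_face hs hq hc
    refine continuous_of_mapsTo_face (hT s hs) (fun x v hv => ?_) fun v => ?_
    · by_contra hv'
      refine Finsupp.mem_support_iff.1 hv ?_
      change (1 - x.2.1) * (f₀ (q x.1)).coord v + x.2.1 * (f₁ (q x.1)).coord v = 0
      rw [coord_eq_zero _ (hsub s hs (q x.1) (hq _)).1 hv',
        coord_eq_zero _ (hsub s hs (q x.1) (hq _)).2 hv']
      ring
    · have h0 : Continuous fun x : S × unitInterval => (f₀ (q x.1)).coord v :=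
        (continuous_coord v).comp (f₀.continuous.comp (hqc.comp continuous_fst))
      have h1 : Continuous fun x : S × unitInterval => (f₁ (q x.1)).coord v :=
        (continuous_coord v).comp (f₁.continuous.comp (hqc.comp continuous_fst))
      change Continuous fun x : S × unitInterval =>
        (1 - x.2.1) * (f₀ (q x.1)).coord v + x.2.1 * (f₁ (q x.1)).coord v
      fun_prop
  refine ⟨⟨⟨fun x => H (x.2, x.1), hH.comp continuous_swap⟩, fun p => ext_coord fun v => ?_,
    fun p => ext_coord fun v => ?_⟩, fun t p v => rfl⟩
  · change (1 - (0 : ℝ)) * (f₀ p).coord v + (0 : ℝ) * (f₁ p).coord v = _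
    ring
  · change (1 - (1 : ℝ)) * (f₀ p).coord v + (1 : ℝ) * (f₁ p).coord v = _
    ring

end PreAbstractSimplicialComplex.Realization

/-! ### The cell complexes `N(k)` -/

namespace BasedComplex

open PreAbstractSimplicialComplex

variable {V : Type u} {X : BasedComplex V} {k : ℕ}

theorem basePoint_of_support {p : X.Realization} (h : p.coord.support ⊆ {X.base}) :
    p = X.basePoint := by
  classical
  refine Realization.ext_coord fun v => ?_
  have h1 := p.sum_face h
  rw [Finset.sum_singleton] at h1
  change _ = Finsupp.single X.base 1 v
  rw [Finsupp.single_apply]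
  split_ifs with hv
  · rw [← hv, h1]
  · exact p.coord_eq_zero h (by simpa using Ne.symm hv)

theorem basePoint_support : X.basePoint.coord.support ⊆ {X.base} :=
  Finsupp.support_single_subset

namespace N

theorem pt_zero (x : X.N k) : x.pt 0 = X.basePoint := by
  obtain ⟨σ, hσ, hx⟩ := x.exists_chain
  exact basePoint_of_support (hσ.zero ▸ hx 0)

theorem pt_of_le (x : X.N k) {i : ℕ} (h : k ≤ i) : x.pt i = X.basePoint := by
  obtain ⟨σ, hσ, hx⟩ := x.exists_chain
  exact basePoint_of_support (hσ.last i h ▸ hx i)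

open Classical in
theorem isChain_of_pts {pt : ℕ → X.Realization} (h0 : (pt 0).coord.support ⊆ {X.base})
    (hk : ∀ i, k ≤ i → (pt i).coord.support ⊆ {X.base})
    (hu : ∀ i, (pt i).coord.support ∪ (pt (i + 1)).coord.support ∈ X.faces) :
    X.IsChain k fun i => (pt i).coord.support where
  zero := (Finset.Nonempty.subset_singleton_iff (pt 0).support_nonempty).1 h0
  last i hi := (Finset.Nonempty.subset_singleton_iff (pt i).support_nonempty).1 (hk i hi)
  mem i := (pt i).support_mem
  union_mem := hu

open Classical in
/-- The point of `N(k)` with given components. -/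
def ofPts (pt : ℕ → X.Realization) (h0 : (pt 0).coord.support ⊆ {X.base})
    (hk : ∀ i, k ≤ i → (pt i).coord.support ⊆ {X.base})
    (hu : ∀ i, (pt i).coord.support ∪ (pt (i + 1)).coord.support ∈ X.faces) : X.N k :=
  ⟨pt, _, isChain_of_pts h0 hk hu, fun _ => subset_rfl⟩

theorem isChain_support (x : X.N k) : X.IsChain k fun i => (x.pt i).coord.support :=
  isChain_of_pts (by rw [x.pt_zero]; exact basePoint_support)
    (fun i hi => by rw [x.pt_of_le hi]; exact basePoint_support) x.support_union_mem

/-- A point whose components have smaller supports than those of a point of `N(k)` is a point of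
`N(k)`. -/
def ofSupport (x : X.N k) (pt : ℕ → X.Realization)
    (h : ∀ i, (pt i).coord.support ⊆ (x.pt i).coord.support) : X.N k :=
  ⟨pt, _, x.isChain_support, h⟩

theorem ext_coord {x y : X.N k} (h : ∀ i v, (x.pt i).coord v = (y.pt i).coord v) : x = y :=
  N.ext (funext fun i => Realization.ext_coord (h i))

theorem continuous_coord (i : ℕ) (v : V) : Continuous fun x : X.N k => (x.pt i).coord v :=
  continuous_cell_coord (κ := fun (x : X.N k) (j : ℕ × V) => (x.pt j.1).coord j.2) rfl (i, v)

theorem continuous_of_mapsTo_chain {S : Type*} [TopologicalSpace S] {q : S → X.N k}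
    {σ : ℕ → Finset V} (hσ : X.IsChain k σ) (hq : ∀ x i, ((q x).pt i).coord.support ⊆ σ i)
    (hc : ∀ i v, Continuous fun x => ((q x).pt i).coord v) : Continuous q :=
  continuous_of_mapsTo_cell rfl (⟨σ, hσ⟩ : {σ // X.IsChain k σ}) hq fun j => hc j.1 j.2

-- The simplices `σ i` need only be adjacent and carry the components up to index `k`. Replacing
-- those at the two ends by the base vertex, where the components lie anyway, turns them into a
-- genuine chain.
open Classical in
theorem continuous_of_support {S : Type*} [TopologicalSpace S] {q : S → X.N k}
    (σ : ℕ → Finset V) (hσ : ∀ i < k, σ i ∪ σ (i + 1) ∈ X.faces)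
    (hq : ∀ x, ∀ i ≤ k, ((q x).pt i).coord.support ⊆ σ i)
    (hc : ∀ i v, Continuous fun x => ((q x).pt i).coord v) : Continuous q := by
  rcases isEmpty_or_nonempty S with hS | ⟨⟨x₀⟩⟩
  · exact continuous_of_discreteTopology
  have hbase : ∀ x i, i = 0 ∨ k ≤ i → ((q x).pt i).coord.support = {X.base} := fun x i hi => by
    refine (Finset.Nonempty.subset_singleton_iff (Realization.support_nonempty _)).1 ?_
    rcases hi with rfl | hi
    · rw [pt_zero]; exact basePoint_support
    · rw [pt_of_le _ hi]; exact basePoint_support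
  let τ : ℕ → Finset V := fun i => if i = 0 ∨ k ≤ i then {X.base} else σ i
  have hτσ : ∀ i, i ≤ k → τ i ⊆ σ i := fun i hi => by
    simp only [τ]
    split_ifs with h
    · rw [← hbase x₀ i h]
      exact hq x₀ i hi
    · exact subset_rfl
  have hqτ : ∀ x i, ((q x).pt i).coord.support ⊆ τ i := fun x i => by
    simp only [τ]
    split_ifs with h
    · exact (hbase x i h).subset
    · exact hq x i (by omega)
  have hτ0 : ∀ i, (τ i).Nonempty := fun i => (Realization.support_nonempty _).mono (hqτ x₀ i)
  have hu : ∀ i, τ i ∪ τ (i + 1) ∈ X.faces := fun i => by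
    by_cases hi : i < k
    · exact (X.isRelLowerSet_faces (hσ i hi)).2 (Finset.union_subset_union (hτσ i hi.le)
        (hτσ _ hi)) ((hτ0 i).mono Finset.subset_union_left)
    · simp only [τ]
      rw [if_pos (by omega), if_pos (by omega), Finset.union_self]
      exact X.base_mem
  refine continuous_of_mapsTo_chain (σ := τ) ⟨if_pos (.inl rfl), fun i hi => if_pos (.inr hi),
    fun i => ?_, hu⟩ hqτ hc
  exact (X.isRelLowerSet_faces (hu i)).2 Finset.subset_union_left (hτ0 i)

theorem continuous_of_chains {Z : Type*} [TopologicalSpace Z] {f : X.N k → Z}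
    (h : ∀ σ, X.IsChain k σ → ∀ (S : Type u) [TopologicalSpace S] (q : S → X.N k),
      (∀ x i, ((q x).pt i).coord.support ⊆ σ i) →
      (∀ i v, Continuous fun x => ((q x).pt i).coord v) → Continuous fun x => f (q x)) :
    Continuous f :=
  continuous_of_cells (κ := fun (x : X.N k) (j : ℕ × V) => (x.pt j.1).coord j.2) rfl
    fun σ S _ q hq hc => h σ.1 σ.2 S q hq fun i v => hc (i, v)

theorem continuous_prod_of_chains {T Z : Type*} [TopologicalSpace T] [LocallyCompactSpace T]
    [TopologicalSpace Z] {f : X.N k × T → Z}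
    (h : ∀ σ, X.IsChain k σ → ∀ (S : Type u) [TopologicalSpace S] (q : S → X.N k),
      (∀ x i, ((q x).pt i).coord.support ⊆ σ i) →
      (∀ i v, Continuous fun x => ((q x).pt i).coord v) →
      Continuous fun p : S × T => f (q p.1, p.2)) :
    Continuous f :=
  continuous_prod_of_cells (κ := fun (x : X.N k) (j : ℕ × V) => (x.pt j.1).coord j.2) rfl
    (fun x => ⟨(⟨_, x.isChain_support⟩ : {σ // X.IsChain k σ}), fun _ _ hv => hv⟩)
    fun σ S _ q hq hc => h σ.1 σ.2 S q hq fun i v => hc (i, v)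

end N

end BasedComplex

/-! ### Coefficients of the refinement maps -/

namespace PartitionSequence

variable (S : PartitionSequence)

theorem t_strictMono (n : ℕ) {i j : ℕ} (hij : i < j) (hj : j ≤ S.k n) : S.t n i < S.t n j :=
  (S.t_lt n i (by omega)).trans_le (S.t_mono n hij hj)

theorem c_mul_div_succ_le {n ℓ : ℕ} (hℓ : ℓ < S.k (n + 1)) :
    S.c n * (ℓ / S.c n + 1) ≤ S.k (n + 1) := by
  rw [← S.c_mul n]
  exact Nat.mul_le_mul_left _ (S.div_lt hℓ)

theorem wl_pos {n ℓ : ℕ} (hℓ : ℓ < S.k (n + 1)) : 0 < S.wl n ℓ := by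
  have hj := S.div_lt hℓ
  have h1 := S.t_compat n (ℓ / S.c n + 1) hj
  refine div_pos ?_ (sub_pos.2 (S.t_lt n _ hj))
  rw [sub_pos, ← h1]
  exact S.t_strictMono (n + 1) (Nat.lt_mul_div_succ ℓ (S.c_pos n)) (S.c_mul_div_succ_le hℓ)

theorem wl_of_dvd {n ℓ : ℕ} (hℓ : ℓ < S.k (n + 1)) (h : S.c n ∣ ℓ) : S.wl n ℓ = 1 := by
  have := S.wl_add_wr hℓ
  rw [S.wr_of_dvd hℓ h, add_zero] at this
  exact this

/-- A bound for the inverses of the nonzero coefficients of `ι`. -/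
def invBound (n : ℕ) : ℝ := ∑ ℓ ∈ Finset.range (S.k (n + 1)), (1 / S.wl n ℓ + 1 / S.wr n ℓ)

theorem invBound_nonneg (n : ℕ) : 0 ≤ S.invBound n :=
  Finset.sum_nonneg fun _ hℓ => by
    have := S.wl_nonneg (Finset.mem_range.1 hℓ)
    have := S.wr_nonneg (Finset.mem_range.1 hℓ)
    positivity

theorem le_invBound {n ℓ : ℕ} (hℓ : ℓ < S.k (n + 1)) :
    1 / S.wl n ℓ ≤ S.invBound n ∧ 1 / S.wr n ℓ ≤ S.invBound n := by
  have h := Finset.single_le_sum (f := fun ℓ => 1 / S.wl n ℓ + 1 / S.wr n ℓ)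
    (fun i hi => by
      have := S.wl_nonneg (Finset.mem_range.1 hi)
      have := S.wr_nonneg (Finset.mem_range.1 hi)
      positivity) (Finset.mem_range.2 hℓ)
  have h1 : 0 ≤ 1 / S.wl n ℓ := one_div_nonneg.2 (S.wl_nonneg hℓ)
  -- At the start of a block `wr` is `0` and its inverse counts as `0`, so the bound says nothing
  -- there.
  have h2 : 0 ≤ 1 / S.wr n ℓ := one_div_nonneg.2 (S.wr_nonneg hℓ)
  unfold invBound
  constructor <;> linarith

end PartitionSequence

/-! ### The image of `ι` is a neighbourhood deformation retract -/

namespace BasedComplex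

open PreAbstractSimplicialComplex

variable {V : Type u} {X : BasedComplex V} (S : PartitionSequence) {n : ℕ}

/-- The deviation of a point of `N(k')` from the image of `ι`, in one coordinate. -/
def deviation (b : X.N (S.k (n + 1))) (ℓ : ℕ) (v : V) : ℝ :=
  (b.pt ℓ).coord v - (S.wl n ℓ * (b.pt (S.c n * (ℓ / S.c n))).coord v +
    S.wr n ℓ * (b.pt (S.c n * (ℓ / S.c n + 1))).coord v)

open Classical in
/-- The union of the simplices of a chain. -/
def chainUnion (k : ℕ) (σ : ℕ → Finset V) : Finset V := (Finset.range (k + 1)).biUnion σ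

open Classical in
theorem subset_chainUnion {k i : ℕ} (σ : ℕ → Finset V) (h : i ≤ k) : σ i ⊆ chainUnion k σ :=
  fun _ hv => Finset.mem_biUnion.2 ⟨i, Finset.mem_range.2 (by omega), hv⟩

/-- The total deviation of a point of `N(k')` from the image of `ι`. -/
def totalDeviation (b : X.N (S.k (n + 1))) : ℝ :=
  ∑ ℓ ∈ Finset.range (S.k (n + 1)),
    ∑ v ∈ chainUnion (S.k (n + 1)) (fun i => (b.pt i).coord.support), |deviation S b ℓ v|

theorem deviation_eq_zero {b : X.N (S.k (n + 1))} {σ : ℕ → Finset V}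
    (h : ∀ i, (b.pt i).coord.support ⊆ σ i) {ℓ : ℕ} (hℓ : ℓ < S.k (n + 1)) {v : V}
    (hv : v ∉ chainUnion (S.k (n + 1)) σ) : deviation S b ℓ v = 0 := by
  have h0 : ∀ i ≤ S.k (n + 1), (b.pt i).coord v = 0 := fun i hi =>
    Realization.coord_eq_zero _ ((h i).trans (subset_chainUnion σ hi)) hv
  have h1 := S.c_mul_div_succ_le hℓ
  have h2 : S.c n * (ℓ / S.c n) ≤ ℓ := Nat.mul_div_le ℓ (S.c n)
  simp [deviation, h0 _ hℓ.le, h0 _ h1, h0 _ (h2.trans hℓ.le)]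

/-- On a cell the sum can be taken over a fixed finite set of vertices, which makes continuity
visible. -/
theorem totalDeviation_eq {b : X.N (S.k (n + 1))} {σ : ℕ → Finset V}
    (h : ∀ i, (b.pt i).coord.support ⊆ σ i) : totalDeviation S b =
      ∑ ℓ ∈ Finset.range (S.k (n + 1)), ∑ v ∈ chainUnion (S.k (n + 1)) σ, |deviation S b ℓ v| := by
  classical
  refine Finset.sum_congr rfl fun ℓ hℓ => Finset.sum_subset
    (Finset.biUnion_mono fun i _ => h i) fun v _ hv => ?_
  rw [deviation_eq_zero S (fun i => subset_rfl) (Finset.mem_range.1 hℓ) hv, abs_zero]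

theorem continuous_deviation (ℓ : ℕ) (v : V) :
    Continuous fun b : X.N (S.k (n + 1)) => deviation S b ℓ v :=
  (N.continuous_coord _ _).sub (((N.continuous_coord _ _).const_mul _).add
    ((N.continuous_coord _ _).const_mul _))

theorem continuous_totalDeviation :
    Continuous (totalDeviation S : X.N (S.k (n + 1)) → ℝ) := by
  refine N.continuous_of_chains fun σ hσ T _ q hq hc => ?_
  have hqc := N.continuous_of_mapsTo_chain hσ hq hc
  simp only [totalDeviation_eq S (hq _)]
  exact continuous_finsetSum _ fun ℓ _ => continuous_finsetSum _ fun v _ =>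
    ((continuous_deviation S ℓ v).comp hqc).abs

theorem totalDeviation_nonneg (b : X.N (S.k (n + 1))) : 0 ≤ totalDeviation S b :=
  Finset.sum_nonneg fun _ _ => Finset.sum_nonneg fun _ _ => abs_nonneg _

theorem abs_deviation_le (b : X.N (S.k (n + 1))) {ℓ : ℕ} (hℓ : ℓ < S.k (n + 1)) (v : V) :
    |deviation S b ℓ v| ≤ totalDeviation S b := by
  by_cases hv : v ∈ chainUnion (S.k (n + 1)) (fun i => (b.pt i).coord.support)
  · refine le_trans ?_ (Finset.single_le_sum (fun _ _ => Finset.sum_nonneg fun _ _ => abs_nonneg _)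
      (Finset.mem_range.2 hℓ))
    exact Finset.single_le_sum (f := fun v => |deviation S b ℓ v|) (fun _ _ => abs_nonneg _) hv
  · rw [deviation_eq_zero S (fun i => subset_rfl) hℓ hv, abs_zero]
    exact totalDeviation_nonneg S b

/-- The bound below which coordinates are cut off. -/
def threshold (b : X.N (S.k (n + 1))) : ℝ := S.invBound n * totalDeviation S b

theorem threshold_nonneg (b : X.N (S.k (n + 1))) : 0 ≤ threshold S b :=
  mul_nonneg (S.invBound_nonneg n) (totalDeviation_nonneg S b)

theorem continuous_threshold : Continuous (threshold S : X.N (S.k (n + 1)) → ℝ) :=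
  continuous_const.mul (continuous_totalDeviation S)

/-- The coordinates of the `c i`-th component, with small coordinates cut off. -/
def cutoff (b : X.N (S.k (n + 1))) (i : ℕ) (v : V) : ℝ :=
  max ((b.pt (S.c n * i)).coord v - threshold S b) 0

theorem continuous_cutoff (i : ℕ) (v : V) :
    Continuous fun b : X.N (S.k (n + 1)) => cutoff S b i v :=
  ((N.continuous_coord _ _).sub (continuous_threshold S)).max continuous_const

theorem cutoff_nonneg (b : X.N (S.k (n + 1))) (i : ℕ) (v : V) : 0 ≤ cutoff S b i v :=
  le_max_right _ _

theorem cutoff_le (b : X.N (S.k (n + 1))) (i : ℕ) (v : V) :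
    cutoff S b i v ≤ (b.pt (S.c n * i)).coord v :=
  max_le (by linarith [threshold_nonneg S b]) (Realization.nonneg _ _)

theorem threshold_lt {b : X.N (S.k (n + 1))} {i : ℕ} {v : V} (h : cutoff S b i v ≠ 0) :
    threshold S b < (b.pt (S.c n * i)).coord v := by
  by_contra h'
  exact h (max_eq_right (by linarith))

/-- Coordinates that survive the cutoff are present in all components of the block. -/
theorem coord_pos_left {b : X.N (S.k (n + 1))} {ℓ : ℕ} (hℓ : ℓ < S.k (n + 1)) {v : V}
    (h : cutoff S b (ℓ / S.c n) v ≠ 0) : 0 < (b.pt ℓ).coord v := by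
  have h1 := threshold_lt S h
  have h2 := abs_le.1 (abs_deviation_le S b hℓ v)
  have h3 := S.wl_pos hℓ
  have h4 := mul_nonneg (S.wr_nonneg hℓ)
    ((b.pt (S.c n * (ℓ / S.c n + 1))).nonneg v)
  -- The coordinate at `ℓ` is at least `wl` times the one at the left end of the block, minus the
  -- total deviation. It is therefore larger than `(wl * invBound - 1) * totalDeviation`, which is
  -- non-negative.
  have h5 := mul_lt_mul_of_pos_left h1 h3
  have h6 : 1 ≤ S.wl n ℓ * S.invBound n := by
    have := mul_le_mul_of_nonneg_left (S.le_invBound hℓ).1 h3.le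
    rwa [mul_one_div_cancel h3.ne'] at this
  have h7 := mul_le_mul_of_nonneg_right h6 (totalDeviation_nonneg S b)
  unfold threshold at h5
  unfold deviation at h2
  linarith

theorem coord_pos_right {b : X.N (S.k (n + 1))} {ℓ : ℕ} (hℓ : ℓ < S.k (n + 1)) {v : V}
    (hw : S.wr n ℓ ≠ 0) (h : cutoff S b (ℓ / S.c n + 1) v ≠ 0) : 0 < (b.pt ℓ).coord v := by
  have h1 := threshold_lt S h
  have h2 := abs_le.1 (abs_deviation_le S b hℓ v)
  have h3 : 0 < S.wr n ℓ := lt_of_le_of_ne (S.wr_nonneg hℓ) hw.symm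
  have h4 := mul_nonneg (S.wl_nonneg hℓ) ((b.pt (S.c n * (ℓ / S.c n))).nonneg v)
  have h5 := mul_lt_mul_of_pos_left h1 h3
  have h6 : 1 ≤ S.wr n ℓ * S.invBound n := by
    have := mul_le_mul_of_nonneg_left (S.le_invBound hℓ).2 h3.le
    rwa [mul_one_div_cancel h3.ne'] at this
  have h7 := mul_le_mul_of_nonneg_right h6 (totalDeviation_nonneg S b)
  unfold threshold at h5
  unfold deviation at h2
  linarith

/-- The mass that survives the cutoff. -/
def cutoffMass (b : X.N (S.k (n + 1))) (i : ℕ) : ℝ :=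
  ∑ v ∈ (b.pt (S.c n * i)).coord.support, cutoff S b i v

theorem cutoff_eq_zero {b : X.N (S.k (n + 1))} {i : ℕ} {s : Finset V}
    (h : (b.pt (S.c n * i)).coord.support ⊆ s) {v : V} (hv : v ∉ s) : cutoff S b i v = 0 := by
  refine le_antisymm ((cutoff_le S b i v).trans ?_) (cutoff_nonneg S b i v)
  rw [Realization.coord_eq_zero _ h hv]

theorem cutoffMass_eq {b : X.N (S.k (n + 1))} {i : ℕ} {s : Finset V}
    (h : (b.pt (S.c n * i)).coord.support ⊆ s) : cutoffMass S b i = ∑ v ∈ s, cutoff S b i v :=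
  Finset.sum_subset h fun _ _ hv => cutoff_eq_zero S subset_rfl hv

theorem cutoffMass_le_one (b : X.N (S.k (n + 1))) (i : ℕ) : cutoffMass S b i ≤ 1 := by
  rw [← (b.pt (S.c n * i)).sum_face subset_rfl]
  exact Finset.sum_le_sum fun v _ => cutoff_le S b i v

theorem continuous_cutoffMass (i : ℕ) :
    Continuous fun b : X.N (S.k (n + 1)) => cutoffMass S b i := by
  refine N.continuous_of_chains fun σ hσ T _ q hq hc => ?_
  have hqc := N.continuous_of_mapsTo_chain hσ hq hc
  simp only [cutoffMass_eq S (hq _ _)]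
  exact continuous_finsetSum _ fun v _ => (continuous_cutoff S i v).comp hqc

/-- The function which measures the distance of a point of `N(k')` from the image of `ι`. -/
def refineDist (b : X.N (S.k (n + 1))) : ℝ :=
  4 * ∑ i ∈ Finset.range (S.k n + 1), (1 - cutoffMass S b i)

theorem continuous_refineDist : Continuous (refineDist S : X.N (S.k (n + 1)) → ℝ) :=
  continuous_const.mul (continuous_finsetSum _ fun i _ =>
    continuous_const.sub (continuous_cutoffMass S i))

/-- The factor `4` is chosen so that a distance below `2` leaves every single component more than
half of its mass. The deformation is at full speed for distance at most `1` and stops at `2`. -/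
theorem half_lt_cutoffMass {b : X.N (S.k (n + 1))} (h : refineDist S b < 2) (i : ℕ) :
    1 / 2 < cutoffMass S b i := by
  have key : ∀ i ≤ S.k n, 1 / 2 < cutoffMass S b i := fun i hi => by
    have := Finset.single_le_sum (f := fun i => 1 - cutoffMass S b i)
      (fun i _ => sub_nonneg.2 (cutoffMass_le_one S b i))
      (Finset.mem_range.2 (Nat.lt_succ_of_le hi))
    unfold refineDist at h
    linarith
  rcases le_total i (S.k n) with hi | hi
  · exact key i hi
  · have h1 : b.pt (S.c n * i) = b.pt (S.c n * S.k n) := by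
      rw [b.pt_of_le (by rw [← S.c_mul n]; exact Nat.mul_le_mul_left _ hi),
        b.pt_of_le (S.c_mul n).ge]
    have : cutoffMass S b i = cutoffMass S b (S.k n) := by
      unfold cutoffMass cutoff
      rw [h1]
    rw [this]
    exact key _ le_rfl

/-- The normalized coordinates after the cutoff. -/
def trunc (b : X.N (S.k (n + 1))) (i : ℕ) (v : V) : ℝ :=
  cutoff S b i v / max (cutoffMass S b i) (1 / 2)

theorem continuous_trunc (i : ℕ) (v : V) :
    Continuous fun b : X.N (S.k (n + 1)) => trunc S b i v :=
  (continuous_cutoff S i v).div ((continuous_cutoffMass S i).max continuous_const)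
    fun _ => (Realization.half_max_pos _).ne'

theorem trunc_nonneg (b : X.N (S.k (n + 1))) (i : ℕ) (v : V) : 0 ≤ trunc S b i v :=
  div_nonneg (cutoff_nonneg S b i v) (Realization.half_max_pos _).le

theorem cutoff_ne_zero {b : X.N (S.k (n + 1))} {i : ℕ} {v : V} (h : trunc S b i v ≠ 0) :
    cutoff S b i v ≠ 0 := fun h' => h (by rw [trunc, h', zero_div])

theorem trunc_eq_zero {b : X.N (S.k (n + 1))} {i : ℕ} {s : Finset V}
    (h : (b.pt (S.c n * i)).coord.support ⊆ s) {v : V} (hv : v ∉ s) : trunc S b i v = 0 := by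
  rw [trunc, cutoff_eq_zero S h hv, zero_div]

theorem sum_trunc {b : X.N (S.k (n + 1))} (hb : refineDist S b < 2) {i : ℕ} {s : Finset V}
    (h : (b.pt (S.c n * i)).coord.support ⊆ s) : ∑ v ∈ s, trunc S b i v = 1 := by
  have h1 := half_lt_cutoffMass S hb i
  unfold trunc
  rw [← Finset.sum_div, ← cutoffMass_eq S h, max_eq_left h1.le, div_self (by linarith)]

/-- The coordinates of the image under `ι` of the truncated point. -/
def truncRefine (b : X.N (S.k (n + 1))) (ℓ : ℕ) (v : V) : ℝ :=
  S.wl n ℓ * trunc S b (ℓ / S.c n) v + S.wr n ℓ * trunc S b (ℓ / S.c n + 1) v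

theorem truncRefine_nonneg (b : X.N (S.k (n + 1))) {ℓ : ℕ} (hℓ : ℓ < S.k (n + 1)) (v : V) :
    0 ≤ truncRefine S b ℓ v :=
  add_nonneg (mul_nonneg (S.wl_nonneg hℓ) (trunc_nonneg S b _ v))
    (mul_nonneg (S.wr_nonneg hℓ) (trunc_nonneg S b _ v))

/-- The refinement of the truncated point is supported in the supports of `b` itself, so the
straight line between them stays in the cell of `b`. -/
theorem truncRefine_eq_zero {b : X.N (S.k (n + 1))} {ℓ : ℕ} (hℓ : ℓ < S.k (n + 1)) {v : V}
    (hv : v ∉ (b.pt ℓ).coord.support) : truncRefine S b ℓ v = 0 := by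
  have h0 : ¬ 0 < (b.pt ℓ).coord v := by rwa [← Realization.mem_support_iff_pos]
  have h1 : trunc S b (ℓ / S.c n) v = 0 := by
    by_contra h
    exact h0 (coord_pos_left S hℓ (cutoff_ne_zero S h))
  have h2 : S.wr n ℓ * trunc S b (ℓ / S.c n + 1) v = 0 := by
    by_contra h
    exact h0 (coord_pos_right S hℓ (left_ne_zero_of_mul h)
      (cutoff_ne_zero S (right_ne_zero_of_mul h)))
  rw [truncRefine, h1, h2, mul_zero, add_zero]

theorem sum_truncRefine {b : X.N (S.k (n + 1))} (hb : refineDist S b < 2) {ℓ : ℕ}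
    (hℓ : ℓ < S.k (n + 1)) : ∑ v ∈ (b.pt ℓ).coord.support, truncRefine S b ℓ v = 1 := by
  classical
  set s := (b.pt ℓ).coord.support ∪ ((b.pt (S.c n * (ℓ / S.c n))).coord.support ∪
    (b.pt (S.c n * (ℓ / S.c n + 1))).coord.support) with hs
  rw [Finset.sum_subset (s₂ := s) Finset.subset_union_left
    fun v _ hv => truncRefine_eq_zero S hℓ hv]
  unfold truncRefine
  rw [Finset.sum_add_distrib, ← Finset.mul_sum, ← Finset.mul_sum, sum_trunc S hb, sum_trunc S hb,
    mul_one, mul_one, S.wl_add_wr hℓ]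
  · exact Finset.subset_union_right.trans Finset.subset_union_right
  · exact Finset.subset_union_left.trans Finset.subset_union_right

/-- The speed of the deformation. -/
def refineSpeed (b : X.N (S.k (n + 1))) : ℝ := max 0 (min 1 (2 - refineDist S b))

theorem refineSpeed_nonneg (b : X.N (S.k (n + 1))) : 0 ≤ refineSpeed S b := le_max_left _ _

theorem refineSpeed_le_one (b : X.N (S.k (n + 1))) : refineSpeed S b ≤ 1 :=
  max_le zero_le_one (min_le_left _ _)

theorem continuous_refineSpeed : Continuous (refineSpeed S : X.N (S.k (n + 1)) → ℝ) :=
  continuous_const.max (continuous_const.min (continuous_const.sub (continuous_refineDist S)))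

open Classical in
/-- The components of the deformation of `N(k')` to the image of `ι`. -/
def refineDefoPt (b : X.N (S.k (n + 1))) (t : unitInterval) (ℓ : ℕ) : X.Realization :=
  if hℓ : ℓ < S.k (n + 1) then
    Realization.ofWeights (b.pt ℓ).coord.support
      (fun v => (1 - t.1 * refineSpeed S b) * (b.pt ℓ).coord v +
        t.1 * refineSpeed S b * truncRefine S b ℓ v) (b.pt ℓ).support_mem
      (fun v => add_nonneg (mul_nonneg
          (by linarith [mul_le_one₀ t.2.2 (refineSpeed_nonneg S b) (refineSpeed_le_one S b)])
          (Realization.nonneg _ v))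
        (mul_nonneg (mul_nonneg t.2.1 (refineSpeed_nonneg S b)) (truncRefine_nonneg S b hℓ v)))
      (fun v hv => by
        rw [truncRefine_eq_zero S hℓ hv, Finsupp.notMem_support_iff.1 hv]; ring)
      (by
        rw [Finset.sum_add_distrib, ← Finset.mul_sum, ← Finset.mul_sum,
          Realization.sum_face _ subset_rfl]
        -- At distance `2` or more the truncated weights need not sum to `1`, but then the speed is
        -- `0`.
        rcases lt_or_ge (refineDist S b) 2 with h | h
        · rw [sum_truncRefine S h hℓ]; ring
        · have : refineSpeed S b = 0 := max_eq_left (min_le_of_right_le (by linarith))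
          rw [this]; ring)
  else b.pt ℓ

theorem refineDefoPt_coord (b : X.N (S.k (n + 1))) (t : unitInterval) {ℓ : ℕ}
    (hℓ : ℓ < S.k (n + 1)) (v : V) : (refineDefoPt S b t ℓ).coord v =
      (1 - t.1 * refineSpeed S b) * (b.pt ℓ).coord v +
        t.1 * refineSpeed S b * truncRefine S b ℓ v := by
  unfold refineDefoPt
  rw [dif_pos hℓ]
  rfl

theorem refineDefoPt_support (b : X.N (S.k (n + 1))) (t : unitInterval) (ℓ : ℕ) :
    (refineDefoPt S b t ℓ).coord.support ⊆ (b.pt ℓ).coord.support := by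
  unfold refineDefoPt
  split_ifs
  exacts [Realization.ofWeights_support _ _ _ _, subset_rfl]

/-- The deformation of `N(k')` to the image of `ι`. -/
def refineDefo (x : X.N (S.k (n + 1)) × unitInterval) : X.N (S.k (n + 1)) :=
  x.1.ofSupport (refineDefoPt S x.1 x.2) (refineDefoPt_support S x.1 x.2)

theorem continuous_truncRefine (ℓ : ℕ) (v : V) :
    Continuous fun b : X.N (S.k (n + 1)) => truncRefine S b ℓ v :=
  ((continuous_trunc S _ v).const_mul _).add ((continuous_trunc S _ v).const_mul _)

theorem continuous_refineDefo :
    Continuous (refineDefo S : X.N (S.k (n + 1)) × unitInterval → _) := by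
  refine N.continuous_prod_of_chains fun σ hσ T _ q hq hc => ?_
  have hqc := (N.continuous_of_mapsTo_chain hσ hq hc).comp (continuous_fst (Y := unitInterval))
  refine N.continuous_of_mapsTo_chain hσ
    (fun x i => (refineDefoPt_support S _ _ i).trans (hq _ i)) fun ℓ v => ?_
  change Continuous fun x : T × unitInterval => (refineDefoPt S (q x.1) x.2 ℓ).coord v
  by_cases hℓ : ℓ < S.k (n + 1)
  · simp only [refineDefoPt_coord S _ _ hℓ]
    have h1 := (continuous_refineSpeed S).comp hqc
    have h2 := (continuous_truncRefine S ℓ v).comp hqc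
    have h3 := (N.continuous_coord ℓ v).comp hqc
    have h4 : Continuous fun x : T × unitInterval => x.2.1 :=
      continuous_subtype_val.comp continuous_snd
    exact ((continuous_const.sub (h4.mul h1)).mul h3).add ((h4.mul h1).mul h2)
  · simp only [refineDefoPt, dif_neg hℓ]
    exact (N.continuous_coord ℓ v).comp hqc

/-- The truncated component of a point near the image of `ι`. -/
def truncPt (b : X.N (S.k (n + 1))) (hb : refineDist S b < 1) (i : ℕ) : X.Realization :=
  Realization.ofWeights (b.pt (S.c n * i)).coord.support (trunc S b i)
    (Realization.support_mem _) (trunc_nonneg S b i) (fun _ hv => trunc_eq_zero S subset_rfl hv)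
    (sum_trunc S (by linarith) subset_rfl)

theorem truncPt_support (b : X.N (S.k (n + 1))) (hb : refineDist S b < 1) (i : ℕ) :
    (truncPt S b hb i).coord.support ⊆ (b.pt (S.c n * i)).coord.support :=
  Realization.ofWeights_support _ _ _ _

/-- Surviving vertices persist up to the last index before `c (i + 1)`. Consecutive truncated
components thus lie in adjacent components of `b`, and form a point of `N(k)`. -/
theorem truncPt_support_last (b : X.N (S.k (n + 1))) (hb : refineDist S b < 1) {i : ℕ}
    (hi : i < S.k n) :
    (truncPt S b hb i).coord.support ⊆ (b.pt (S.c n * (i + 1) - 1)).coord.support := by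
  intro v hv
  have hc := S.c_pos n
  have hℓ : S.c n * (i + 1) - 1 < S.k (n + 1) := by
    have : S.c n * (i + 1) ≤ S.c n * S.k n := Nat.mul_le_mul_left _ hi
    rw [S.c_mul n] at this
    have : 0 < S.c n * (i + 1) := by positivity
    omega
  have hdiv : (S.c n * (i + 1) - 1) / S.c n = i := by
    have : S.c n * (i + 1) - 1 = S.c n - 1 + S.c n * i := by
      rw [Nat.mul_succ]; omega
    rw [this, Nat.add_mul_div_left _ _ hc, Nat.div_eq_of_lt (by omega), zero_add]
  rw [Realization.mem_support_iff_pos]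
  refine coord_pos_left S hℓ ?_
  rw [hdiv]
  exact cutoff_ne_zero S (Finsupp.mem_support_iff.1 hv)

open Classical in
/-- The point of `N(k)` to which a point near the image of `ι` is deformed. -/
def truncN (b : {b : X.N (S.k (n + 1)) // refineDist S b < 1}) : X.N (S.k n) :=
  N.ofPts (truncPt S b.1 b.2)
    (by
      refine (truncPt_support S b.1 b.2 0).trans ?_
      rw [mul_zero, N.pt_zero]
      exact basePoint_support)
    (fun i hi => by
      refine (truncPt_support S b.1 b.2 i).trans ?_
      rw [N.pt_of_le _ (by rw [← S.c_mul n]; exact Nat.mul_le_mul_left _ hi)]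
      exact basePoint_support)
    (fun i => by
      have hne := (Realization.support_nonempty (truncPt S b.1 b.2 i)).mono
        (Finset.subset_union_left (s₂ := (truncPt S b.1 b.2 (i + 1)).coord.support))
      rcases lt_or_ge i (S.k n) with hi | hi
      · refine (X.isRelLowerSet_faces (b.1.support_union_mem (S.c n * (i + 1) - 1))).2
          (Finset.union_subset_union (truncPt_support_last S b.1 b.2 hi) ?_) hne
        rw [Nat.sub_add_cancel (Nat.mul_pos (S.c_pos n) (Nat.succ_pos i))]
        exact truncPt_support S b.1 b.2 (i + 1)
      · refine (X.isRelLowerSet_faces X.base_mem).2 (Finset.union_subset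
          ((truncPt_support S b.1 b.2 _).trans ?_) ((truncPt_support S b.1 b.2 _).trans ?_)) hne
        · rw [N.pt_of_le _ (by rw [← S.c_mul n]; exact Nat.mul_le_mul_left _ hi)]
          exact basePoint_support
        · rw [N.pt_of_le _ (by rw [← S.c_mul n]; exact Nat.mul_le_mul_left _ (by omega))]
          exact basePoint_support)

open Classical in
theorem continuous_truncN :
    Continuous (truncN S : {b : X.N (S.k (n + 1)) // refineDist S b < 1} → _) := by
  refine continuous_subtype_of_cells
    (κ := fun (x : X.N (S.k (n + 1))) (j : ℕ × V) => (x.pt j.1).coord j.2) rfl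
    (continuous_refineDist S) ?_
  rintro ⟨σ, hσ⟩ T _ q hq hc hlt
  have hqc := N.continuous_of_mapsTo_chain hσ hq fun i v => hc (i, v)
  rcases isEmpty_or_nonempty T with hT | ⟨⟨x₀⟩⟩
  · exact continuous_of_discreteTopology
  have hq1 : ∀ x i, ((q x).pt i).coord.support ⊆ σ i := hq
  -- The first set of each intersection bounds the truncated component at its own index, the second
  -- at the end of its block. Adjacency then follows from that of `σ` at the indices `c (i + 1) - 1`
  -- and `c (i + 1)`.
  let τ : ℕ → Finset V := fun i =>
    if i < S.k n then σ (S.c n * i) ∩ σ (S.c n * (i + 1) - 1) else σ (S.c n * i)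
  have hτ : ∀ x i, (truncPt S (q x) (hlt x) i).coord.support ⊆ τ i := fun x i => by
    simp only [τ]
    split_ifs with h
    · exact Finset.subset_inter ((truncPt_support S _ _ _).trans (hq1 _ _))
        ((truncPt_support_last S _ _ h).trans (hq1 _ _))
    · exact (truncPt_support S _ _ _).trans (hq1 _ _)
  refine N.continuous_of_support τ (fun i hi => ?_) (fun x i _ => hτ x i) fun i v => ?_
  · refine (X.isRelLowerSet_faces (hσ.union_mem (S.c n * (i + 1) - 1))).2 ?_
      (((Realization.support_nonempty _).mono (hτ x₀ i)).mono Finset.subset_union_left)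
    refine Finset.union_subset_union ?_ ?_
    · simp only [τ, if_pos hi]
      exact Finset.inter_subset_right
    · rw [Nat.sub_add_cancel (Nat.mul_pos (S.c_pos n) (Nat.succ_pos i))]
      simp only [τ]
      split_ifs
      exacts [Finset.inter_subset_left, subset_rfl]
  · exact (continuous_trunc S i v).comp hqc

theorem ι_coord (a : X.N (S.k n)) {ℓ : ℕ} (hℓ : ℓ < S.k (n + 1)) (v : V) :
    ((X.ι S n a).pt ℓ).coord v =
      S.wl n ℓ * (a.pt (ℓ / S.c n)).coord v + S.wr n ℓ * (a.pt (ℓ / S.c n + 1)).coord v := by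
  change (X.refinePoint S n a ℓ).coord v = _
  unfold refinePoint
  rw [dif_pos hℓ]
  rfl

/-- The components at multiples of `c` recover `a`, so on the image of `ι` the truncation is an
inverse. -/
theorem ι_pt_mul (a : X.N (S.k n)) (i : ℕ) : (X.ι S n a).pt (S.c n * i) = a.pt i := by
  rcases lt_or_ge i (S.k n) with hi | hi
  · have hℓ : S.c n * i < S.k (n + 1) := by
      rw [← S.c_mul n]; exact Nat.mul_lt_mul_of_pos_left hi (S.c_pos n)
    refine Realization.ext_coord fun v => ?_
    rw [ι_coord S a hℓ, S.wl_of_dvd hℓ (dvd_mul_right _ _), S.wr_of_dvd hℓ (dvd_mul_right _ _),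
      Nat.mul_div_cancel_left _ (S.c_pos n)]
    ring
  · rw [a.pt_of_le hi, N.pt_of_le _ (by rw [← S.c_mul n]; exact Nat.mul_le_mul_left _ hi)]

theorem deviation_ι (a : X.N (S.k n)) {ℓ : ℕ} (hℓ : ℓ < S.k (n + 1)) (v : V) :
    deviation S (X.ι S n a) ℓ v = 0 := by
  rw [deviation, ι_coord S a hℓ, ι_pt_mul, ι_pt_mul, sub_self]

theorem cutoff_ι (a : X.N (S.k n)) (i : ℕ) (v : V) :
    cutoff S (X.ι S n a) i v = (a.pt i).coord v := by
  have h1 : threshold S (X.ι S n a) = 0 := by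
    unfold threshold totalDeviation
    rw [Finset.sum_eq_zero, mul_zero]
    intro ℓ hℓ
    exact Finset.sum_eq_zero fun v _ => by
      rw [deviation_ι S a (Finset.mem_range.1 hℓ), abs_zero]
  rw [cutoff, h1, ι_pt_mul, sub_zero, max_eq_left (Realization.nonneg _ _)]

theorem cutoffMass_ι (a : X.N (S.k n)) (i : ℕ) : cutoffMass S (X.ι S n a) i = 1 := by
  simp only [cutoffMass, cutoff_ι, ι_pt_mul]
  exact Realization.sum_face _ subset_rfl

theorem trunc_ι (a : X.N (S.k n)) (i : ℕ) (v : V) :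
    trunc S (X.ι S n a) i v = (a.pt i).coord v := by
  rw [trunc, cutoff_ι, cutoffMass_ι, max_eq_left (by norm_num), div_one]

variable (X n) in
/-- The image of `ι` is a neighbourhood deformation retract. -/
def ιDeformation : NeighbourhoodDeformation (X.ι S n) where
  u := ⟨refineDist S, continuous_refineDist S⟩
  h := ⟨refineDefo S, continuous_refineDefo S⟩
  ret := ⟨truncN S, continuous_truncN S⟩
  u_apply a := by
    change refineDist S (X.ι S n a) = 0
    simp [refineDist, cutoffMass_ι]
  h_zero b := N.ext_coord fun ℓ v => by
    change (refineDefoPt S b 0 ℓ).coord v = _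
    by_cases hℓ : ℓ < S.k (n + 1)
    · rw [refineDefoPt_coord S b 0 hℓ]
      simp
    · rw [refineDefoPt, dif_neg hℓ]
  h_apply a t := N.ext_coord fun ℓ v => by
    change (refineDefoPt S (X.ι S n a) t ℓ).coord v = _
    by_cases hℓ : ℓ < S.k (n + 1)
    · rw [refineDefoPt_coord S _ t hℓ, truncRefine, trunc_ι, trunc_ι, ι_coord S a hℓ]
      ring
    · rw [refineDefoPt, dif_neg hℓ]
  h_one b := N.ext_coord fun ℓ v => by
    change (refineDefoPt S b.1 1 ℓ).coord v = ((X.ι S n (truncN S b)).pt ℓ).coord v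
    by_cases hℓ : ℓ < S.k (n + 1)
    · have h1 : refineSpeed S b.1 = 1 := by
        have : refineDist S b.1 < 1 := b.2
        rw [refineSpeed, min_eq_left (by linarith), max_eq_right zero_le_one]
      rw [refineDefoPt_coord S _ 1 hℓ, ι_coord S _ hℓ, h1]
      change (1 - (1 : ℝ) * 1) * _ + (1 : ℝ) * 1 * truncRefine S b.1 ℓ v =
        S.wl n ℓ * trunc S b.1 _ v + S.wr n ℓ * trunc S b.1 _ v
      rw [truncRefine]
      ring
    · rw [refineDefoPt, dif_neg hℓ, N.pt_of_le _ (not_lt.1 hℓ), N.pt_of_le _ (not_lt.1 hℓ)]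
  ret_apply a _ := N.ext_coord fun i v => trunc_ι S a i v

end BasedComplex

namespace BasedComplex

open PreAbstractSimplicialComplex

variable {V : Type u} {X : BasedComplex V}

/-! ### Straight-line homotopies and reparametrizations of chains -/

open Classical in
/-- Two maps such that every cell has images in a common cell are homotopic. -/
theorem N.homotopic_of_chains {k k' : ℕ} {f₀ f₁ : C(X.N k, X.N k')}
    (h : ∀ σ, X.IsChain k σ → ∃ τ, X.IsChain k' τ ∧ ∀ x : X.N k,
      (∀ i, (x.pt i).coord.support ⊆ σ i) →
      ∀ i, ((f₀ x).pt i).coord.support ⊆ τ i ∧ ((f₁ x).pt i).coord.support ⊆ τ i) :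
    f₀.Homotopic f₁ := by
  have hcomm : ∀ x i, ((f₀ x).pt i).coord.support ∪ ((f₁ x).pt i).coord.support ∈ X.faces :=
    fun x i => by
      obtain ⟨τ, hτ, hx⟩ := h _ x.isChain_support
      have := hx x (fun _ => subset_rfl) i
      exact (X.isRelLowerSet_faces (hτ.mem i)).2 (Finset.union_subset this.1 this.2)
        ((Realization.support_nonempty _).mono Finset.subset_union_left)
  let pt : X.N k × unitInterval → ℕ → X.Realization := fun x i =>
    X.comb ((f₀ x.1).pt i) ((f₁ x.1).pt i) (1 - x.2.1) x.2.1 (by linarith [x.2.2.2]) x.2.2.1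
      (by ring) (hcomm x.1 i)
  have hcoord : ∀ x i v, (pt x i).coord v =
      (1 - x.2.1) * ((f₀ x.1).pt i).coord v + x.2.1 * ((f₁ x.1).pt i).coord v := fun _ _ _ => rfl
  have hsupp : ∀ x i, (pt x i).coord.support ⊆
      ((f₀ x.1).pt i).coord.support ∪ ((f₁ x.1).pt i).coord.support := fun x i =>
    Finsupp.support_add.trans
      (Finset.union_subset_union Finsupp.support_smul Finsupp.support_smul)
  let H : X.N k × unitInterval → X.N k' := fun x => ⟨pt x, by
    obtain ⟨τ, hτ, hx⟩ := h _ x.1.isChain_support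
    exact ⟨τ, hτ, fun i => (hsupp x i).trans (Finset.union_subset
      (hx x.1 (fun _ => subset_rfl) i).1 (hx x.1 (fun _ => subset_rfl) i).2)⟩⟩
  have hH : Continuous H := by
    refine N.continuous_prod_of_chains fun σ hσ T _ q hq hc => ?_
    have hqc := (N.continuous_of_mapsTo_chain hσ hq hc).comp (continuous_fst (Y := unitInterval))
    obtain ⟨τ, hτ, hx⟩ := h σ hσ
    refine N.continuous_of_mapsTo_chain hτ (fun x i => (hsupp _ i).trans
      (Finset.union_subset (hx _ (hq x.1) i).1 (hx _ (hq x.1) i).2)) fun i v => ?_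
    have h0 := (N.continuous_coord i v).comp (f₀.continuous.comp hqc)
    have h1 := (N.continuous_coord i v).comp (f₁.continuous.comp hqc)
    have h2 : Continuous fun x : T × unitInterval => x.2.1 :=
      continuous_subtype_val.comp continuous_snd
    exact ((continuous_const.sub h2).mul h0).add (h2.mul h1)
  refine ⟨⟨⟨fun x => H (x.2, x.1), hH.comp continuous_swap⟩, fun x => N.ext_coord fun i v => ?_,
    fun x => N.ext_coord fun i v => ?_⟩⟩
  · change (1 - (0 : ℝ)) * ((f₀ x).pt i).coord v + (0 : ℝ) * ((f₁ x).pt i).coord v = _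
    ring
  · change (1 - (1 : ℝ)) * ((f₀ x).pt i).coord v + (1 : ℝ) * ((f₁ x).pt i).coord v = _
    ring

/-- A monotone map of indices with steps at most one, which carries chains of length `k` to chains
of length `k'`. -/
structure IsReindexing (k k' : ℕ) (α : ℕ → ℕ) : Prop where
  zero : α 0 = 0
  last : ∀ ℓ, k' ≤ ℓ → k ≤ α ℓ
  step : ∀ ℓ, α (ℓ + 1) = α ℓ ∨ α (ℓ + 1) = α ℓ + 1

theorem IsReindexing.isChain {k k' : ℕ} {α : ℕ → ℕ} (h : IsReindexing k k' α)
    {σ : ℕ → Finset V} (hσ : X.IsChain k σ) : X.IsChain k' fun ℓ => σ (α ℓ) := by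
  classical
  refine ⟨by rw [h.zero, hσ.zero], fun ℓ hℓ => hσ.last _ (h.last ℓ hℓ), fun ℓ => hσ.mem _,
    fun ℓ => ?_⟩
  rcases h.step ℓ with e | e
  · simp only [e, Finset.union_self]
    exact hσ.mem _
  · simp only [e]
    exact hσ.union_mem _

/-- The map `N(k) → N(k')` that repeats and omits components. -/
def reindex (X : BasedComplex V) {k k' : ℕ} {α : ℕ → ℕ} (h : IsReindexing k k' α) :
    C(X.N k, X.N k') where
  toFun x := ⟨fun ℓ => x.pt (α ℓ), _, h.isChain x.isChain_support, fun _ => subset_rfl⟩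
  continuous_toFun := N.continuous_of_chains fun _ hσ _ _ _ hq hc =>
    N.continuous_of_mapsTo_chain (h.isChain hσ) (fun x ℓ => hq x (α ℓ)) fun ℓ v => hc (α ℓ) v

-- The hypothesis puts all four simplices at the positions `ℓ` and `ℓ + 1` into one `σ i ∪ σ (i +
-- 1)`, so the unions of corresponding simplices form a chain carrying both maps.
open Classical in
theorem reindex_homotopic {k k' : ℕ} {α β : ℕ → ℕ} (hα : IsReindexing k k' α)
    (hβ : IsReindexing k k' β) (h : ∀ ℓ, ∃ i, (α ℓ = i ∨ α ℓ = i + 1) ∧ (β ℓ = i ∨ β ℓ = i + 1) ∧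
      (α (ℓ + 1) = i ∨ α (ℓ + 1) = i + 1) ∧ (β (ℓ + 1) = i ∨ β (ℓ + 1) = i + 1)) :
    (reindex X hα).Homotopic (reindex X hβ) := by
  refine N.homotopic_of_chains fun σ hσ => ⟨fun ℓ => σ (α ℓ) ∪ σ (β ℓ), ?_, fun x hx ℓ =>
    ⟨(hx _).trans Finset.subset_union_left, (hx _).trans Finset.subset_union_right⟩⟩
  have hne : ∀ i, (σ i).Nonempty := fun i => (X.isRelLowerSet_faces (hσ.mem i)).1
  have hsub : ∀ i m, m = i ∨ m = i + 1 → σ m ⊆ σ i ∪ σ (i + 1) := by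
    rintro i m (rfl | rfl)
    exacts [Finset.subset_union_left, Finset.subset_union_right]
  refine ⟨by simp [hα.zero, hβ.zero, hσ.zero], fun ℓ hℓ => ?_, fun ℓ => ?_, fun ℓ => ?_⟩
  · rw [hσ.last _ (hα.last ℓ hℓ), hσ.last _ (hβ.last ℓ hℓ), Finset.union_self]
  · obtain ⟨i, h1, h2, -, -⟩ := h ℓ
    exact (X.isRelLowerSet_faces (hσ.union_mem i)).2
      (Finset.union_subset (hsub i _ h1) (hsub i _ h2)) ((hne _).mono Finset.subset_union_left)
  · obtain ⟨i, h1, h2, h3, h4⟩ := h ℓ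
    exact (X.isRelLowerSet_faces (hσ.union_mem i)).2
      (Finset.union_subset (Finset.union_subset (hsub i _ h1) (hsub i _ h2))
        (Finset.union_subset (hsub i _ h3) (hsub i _ h4)))
      (((hne _).mono Finset.subset_union_left).mono Finset.subset_union_left)

/-- Index maps interpolating between `ℓ ↦ ℓ / c` and the identity. -/
def stepMap (c m ℓ : ℕ) : ℕ := if ℓ ≤ m then ℓ else max m (ℓ / c)

theorem div_succ_cases (c ℓ : ℕ) : (ℓ + 1) / c = ℓ / c ∨ (ℓ + 1) / c = ℓ / c + 1 := by
  rw [Nat.succ_div]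
  split_ifs
  exacts [.inr rfl, .inl rfl]

theorem isReindexing_div (S : PartitionSequence) (n : ℕ) :
    IsReindexing (S.k n) (S.k (n + 1)) fun ℓ => ℓ / S.c n where
  zero := Nat.zero_div _
  last ℓ hℓ := by
    rw [Nat.le_div_iff_mul_le (S.c_pos n), mul_comm, S.c_mul]
    exact hℓ
  step ℓ := div_succ_cases _ ℓ

theorem isReindexing_stepMap (S : PartitionSequence) (n m : ℕ) :
    IsReindexing (S.k n) (S.k (n + 1)) (stepMap (S.c n) m) where
  zero := by simp [stepMap]
  last ℓ hℓ := by
    have h1 := (isReindexing_div S n).last ℓ hℓ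
    have h2 := Nat.div_le_self ℓ (S.c n)
    unfold stepMap
    split_ifs
    · omega
    · exact h1.trans (le_max_right _ _)
  step ℓ := by
    have h1 := div_succ_cases (S.c n) ℓ
    have h2 := Nat.div_le_self ℓ (S.c n)
    have h3 := Nat.div_le_self (ℓ + 1) (S.c n)
    unfold stepMap
    split_ifs <;> omega

theorem reindex_stepMap_homotopic (S : PartitionSequence) (n m : ℕ) :
    (reindex X (isReindexing_stepMap S n m)).Homotopic
      (reindex X (isReindexing_stepMap S n (m + 1))) := by
  refine reindex_homotopic _ _ fun ℓ => ?_
  have h1 := div_succ_cases (S.c n) ℓ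
  have h2 := Nat.div_le_self ℓ (S.c n)
  have h3 := Nat.div_le_self (ℓ + 1) (S.c n)
  rcases lt_or_ge ℓ m with h | h
  · refine ⟨ℓ, ?_⟩
    unfold stepMap
    split_ifs <;> omega
  -- For `ℓ ≥ m` the first index map waits at `m` until `ℓ / c` catches up, and the second at `m +
  -- 1`; they differ by at most one.
  · refine ⟨max m (ℓ / S.c n), ?_⟩
    unfold stepMap
    split_ifs <;> omega

open Classical in
theorem ι_homotopic_reindex (S : PartitionSequence) (n : ℕ) :
    (X.ι S n).Homotopic (reindex X (isReindexing_div S n)) := by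
  refine N.homotopic_of_chains fun σ hσ => ⟨refineChain S n σ, isChain_refineChain hσ,
    fun x hx ℓ => ⟨refinePoint_support hσ hx ℓ, (hx _).trans ?_⟩⟩
  unfold refineChain
  split_ifs
  exacts [subset_rfl, Finset.subset_union_left]

theorem ι_homotopic_stepMap (S : PartitionSequence) (n m : ℕ) :
    (X.ι S n).Homotopic (reindex X (isReindexing_stepMap S n m)) := by
  induction m with
  | zero =>
    convert ι_homotopic_reindex (X := X) S n using 1
    refine ContinuousMap.ext fun x => N.ext (funext fun ℓ => ?_)
    change x.pt (stepMap (S.c n) 0 ℓ) = x.pt (ℓ / S.c n)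
    congr 1
    unfold stepMap
    split_ifs with h
    · obtain rfl : ℓ = 0 := by omega
      simp
    · simp
  | succ m ih => exact ih.trans (reindex_stepMap_homotopic S n m)

/-- The maps `r_k` form a ladder which commutes up to homotopy. -/
theorem ι_comp_r_homotopic (X : BasedComplex V) (S : PartitionSequence) (n : ℕ) :
    ((X.ι S n).comp (X.r (S.k n))).Homotopic ((X.r (S.k (n + 1))).comp (X.j S n)) := by
  -- Up to `k'` the index map `stepMap c k'` is the identity, so the reindexing just appends base
  -- points, as does the padding of loops in `r_k'`.
  convert (ι_homotopic_stepMap (X := X) S n (S.k (n + 1))).comp (.refl (X.r (S.k n))) using 1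
  refine ContinuousMap.ext fun p => N.ext (funext fun ℓ => ?_)
  rcases le_or_gt ℓ (S.k (n + 1)) with h | h
  · change columnPoint (X.j S n p) ℓ = columnPoint p (stepMap (S.c n) (S.k (n + 1)) ℓ)
    rw [stepMap, if_pos h]
    rfl
  · rw [N.pt_of_le _ h.le, N.pt_of_le _ h.le]

end BasedComplex

/-! ### Realizations of simplicial maps -/

namespace PreAbstractSimplicialComplex.Realization

variable {V V' : Type u} {K : PreAbstractSimplicialComplex V}
  {L : PreAbstractSimplicialComplex V'}

open Classical in
theorem mapDomain_coord (p : K.Realization) (φ : V → V') {s : Finset V}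
    (h : p.coord.support ⊆ s) (v : V') :
    p.coord.mapDomain φ v = ∑ l ∈ s, if φ l = v then p.coord l else 0 := by
  rw [Finsupp.mapDomain, Finsupp.sum_apply, Finsupp.sum_of_support_subset _ h _ (by simp)]
  exact Finset.sum_congr rfl fun l _ => Finsupp.single_apply

open Classical in
/-- The map of realizations induced by a simplicial map. -/
def map (φ : V → V') (h : ∀ s ∈ K.faces, s.image φ ∈ L.faces) :
    C(K.Realization, L.Realization) where
  toFun p := ofWeights (p.coord.support.image φ) (p.coord.mapDomain φ) (h _ p.support_mem)
    (fun v => by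
      rw [mapDomain_coord p φ subset_rfl]
      refine Finset.sum_nonneg fun l _ => ?_
      split_ifs
      exacts [p.nonneg l, le_rfl])
    (fun v hv => Finsupp.notMem_support_iff.1 fun hv' => hv (Finsupp.mapDomain_support hv'))
    (by
      rw [← p.sum_eq, ← Finsupp.sum_mapDomain_index (f := φ) (h := fun _ a => a)
        (fun _ => rfl) (fun _ _ _ => rfl),
        Finsupp.sum_of_support_subset _ Finsupp.mapDomain_support _ (by simp)])
  continuous_toFun := continuous_of_faces fun s hs S _ q hq hc => by
    refine continuous_of_mapsTo_face (h s hs)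
      (fun x => (ofWeights_support _ _ _ _).trans (Finset.image_subset_image (hq x))) fun v => ?_
    have : ∀ x, (q x).coord.mapDomain φ v = ∑ l ∈ s, if φ l = v then (q x).coord l else 0 :=
      fun x => mapDomain_coord _ φ (hq x) v
    simp only [ofWeights_coord, this]
    refine continuous_finsetSum _ fun l _ => ?_
    split_ifs
    exacts [hc l, continuous_const]

open Classical in
theorem map_coord (φ : V → V') (h : ∀ s ∈ K.faces, s.image φ ∈ L.faces)
    (p : K.Realization) : (map (L := L) φ h p).coord = p.coord.mapDomain φ :=
  Finsupp.ext fun _ => rfl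

end PreAbstractSimplicialComplex.Realization

namespace BasedComplex

open PreAbstractSimplicialComplex

variable {V : Type u} {X : BasedComplex V} {k : ℕ}

/-! ### Edge loops -/

theorem EdgeLoop.ext_pad {l l' : X.EdgeLoop} (h : l.len = l'.len) (hp : ∀ i, l.pad i = l'.pad i) :
    l = l' := by
  obtain ⟨m, w, h0, h1, h2⟩ := l
  obtain ⟨m', w', h0', h1', h2'⟩ := l'
  obtain rfl : m = m' := h
  obtain rfl : w = w' := funext fun i => by
    have e := hp i
    rwa [EdgeLoop.pad, dif_pos i.2, EdgeLoop.pad, dif_pos i.2] at e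
  rfl

open Classical in
theorem EdgeLoop.pad_edge (l : X.EdgeLoop) (i : ℕ) : {l.pad i, l.pad (i + 1)} ∈ X.faces := by
  rcases lt_or_ge i l.len with h | h
  · have := l.edge ⟨i, h⟩
    simpa [EdgeLoop.pad, h, h.le, Nat.lt_succ_of_lt h] using this
  · rw [l.pad_of_le h, l.pad_of_le (h.trans (Nat.le_succ i)), Finset.pair_eq_singleton]
    exact X.base_mem

/-- The trivial extension of a loop to length at least `m`. -/
def EdgeLoop.extend (m : ℕ) (l : X.EdgeLoop) : X.EdgeLoop where
  len := max l.len m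
  vert i := l.pad i
  vert_zero := l.pad_zero
  vert_last := l.pad_of_le (le_max_left _ _)
  edge i := l.pad_edge i

theorem EdgeLoop.extend_len (m : ℕ) (l : X.EdgeLoop) : (l.extend m).len = max l.len m := rfl

theorem EdgeLoop.extend_pad (m : ℕ) (l : X.EdgeLoop) (i : ℕ) : (l.extend m).pad i = l.pad i := by
  by_cases h : i < max l.len m + 1
  · exact dif_pos h
  · rw [l.pad_of_le (by omega), EdgeLoop.pad_of_le _ (by rw [l.extend_len]; omega)]

theorem EdgeLoop.extend_of_le {m : ℕ} {l : X.EdgeLoop} (h : m ≤ l.len) : l.extend m = l :=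
  EdgeLoop.ext_pad (max_eq_left h) (l.extend_pad m)

theorem column_nonempty {s : Finset X.EdgeLoop} (h : s.Nonempty) (i : ℕ) :
    (column s i).Nonempty := by
  classical
  exact h.image _

open Classical in
/-- Extensions of the loops of a simplex to lengths at least `m` and `m + 1` span a simplex. -/
theorem extend_union_mem {s : Finset X.EdgeLoop} (hs : s ∈ (X.loopComplexUpTo k).faces) {m : ℕ}
    (hm : m + 1 ≤ k) : s.image (EdgeLoop.extend m) ∪ s.image (EdgeLoop.extend (m + 1)) ∈
      (X.loopComplexUpTo k).faces := by
  have hchain := isChain_column hs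
  obtain ⟨⟨M, ⟨l₀, hl₀, hM⟩, hlen, -⟩, hk⟩ := hs
  have hmem : ∀ l ∈ s.image (EdgeLoop.extend m) ∪ s.image (EdgeLoop.extend (m + 1)), ∃ l' ∈ s,
      (∀ i, l.pad i = l'.pad i) ∧ (l.len = max l'.len m ∨ l.len = max l'.len (m + 1)) := by
    intro l hl
    rcases Finset.mem_union.1 hl with hl | hl <;>
      obtain ⟨l', hl', rfl⟩ := Finset.mem_image.1 hl
    · exact ⟨l', hl', l'.extend_pad m, .inl rfl⟩
    · exact ⟨l', hl', l'.extend_pad (m + 1), .inr rfl⟩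
  have hcol : ∀ i, column (s.image (EdgeLoop.extend m) ∪ s.image (EdgeLoop.extend (m + 1))) i ⊆
      column s i := fun i v hv => by
    obtain ⟨l, hl, rfl⟩ := Finset.mem_image.1 hv
    obtain ⟨l', hl', hp, -⟩ := hmem l hl
    exact Finset.mem_image.2 ⟨l', hl', (hp i).symm⟩
  have hne : (s.image (EdgeLoop.extend m) ∪ s.image (EdgeLoop.extend (m + 1))).Nonempty :=
    Finset.Nonempty.mono Finset.subset_union_left ⟨_, Finset.mem_image_of_mem _ hl₀⟩
  -- Lengths in a simplex may differ by at most one. As those in `s` are `M` or `M - 1`, the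
  -- extended lengths are `max M (m + 1)` or one less. A direct extension of short loops to length
  -- `k` would violate this.
  refine ⟨⟨max M (m + 1), ⟨l₀.extend (m + 1), Finset.mem_union_right _
    (Finset.mem_image_of_mem _ hl₀), by rw [EdgeLoop.extend_len, hM]⟩, fun l hl => ?_,
    fun i _ => ?_⟩, fun l hl => ?_⟩
  · obtain ⟨l', hl', -, h⟩ := hmem l hl
    have := hlen l' hl'
    omega
  · exact (X.isRelLowerSet_faces (hchain.union_mem i)).2
      (Finset.union_subset_union (hcol i) (hcol (i + 1)))
      ((column_nonempty hne i).mono Finset.subset_union_left)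
  · obtain ⟨l', hl', -, h⟩ := hmem l hl
    have := hk l' hl'
    omega

open Classical in
theorem extend_mem {s : Finset X.EdgeLoop} (hs : s ∈ (X.loopComplexUpTo k).faces) {m : ℕ}
    (hm : m ≤ k) : s.image (EdgeLoop.extend m) ∈ (X.loopComplexUpTo k).faces := by
  have hne : s.Nonempty := ((X.loopComplexUpTo k).isRelLowerSet_faces hs).1
  rcases m with _ | m
  · have : s.image (EdgeLoop.extend 0) = s := by
      rw [Finset.image_congr (f := EdgeLoop.extend 0) (g := id)
        fun l _ => EdgeLoop.extend_of_le (Nat.zero_le _),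
        Finset.image_id]
    rwa [this]
  · exact ((X.loopComplexUpTo k).isRelLowerSet_faces (extend_union_mem hs hm)).2
      Finset.subset_union_right (hne.image _)

/-! ### The product section of `r_k` -/

/-- The loop with given vertices in the simplices of a chain. -/
def loopOf {σ : ℕ → Finset V} (hσ : X.IsChain k σ) (p : Fin (k + 1) → V)
    (hp : ∀ i : Fin (k + 1), p i ∈ σ i) : X.EdgeLoop where
  len := k
  vert := p
  vert_zero := by
    have := hp 0
    rwa [Fin.val_zero, hσ.zero, Finset.mem_singleton] at this
  vert_last := by
    have := hp (Fin.last k)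
    rwa [Fin.val_last, hσ.last k le_rfl, Finset.mem_singleton] at this
  edge i := by
    classical
    refine (X.isRelLowerSet_faces (hσ.union_mem i)).2 ?_ (Finset.insert_nonempty _ _)
    exact Finset.insert_subset (Finset.mem_union_left _ (hp i.castSucc))
      (Finset.singleton_subset_iff.2 (Finset.mem_union_right _ (hp i.succ)))

theorem loopOf_pad {σ : ℕ → Finset V} (hσ : X.IsChain k σ) (p : Fin (k + 1) → V)
    (hp : ∀ i : Fin (k + 1), p i ∈ σ i) (i : Fin (k + 1)) : (loopOf hσ p hp).pad i = p i :=
  dif_pos i.2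

/-- The finite set of all loops of length `k` with vertices in the simplices of a chain. -/
def loopsIn {σ : ℕ → Finset V} (hσ : X.IsChain k σ) : Finset X.EdgeLoop :=
  (Fintype.piFinset fun i : Fin (k + 1) => σ i).attach.map
    ⟨fun p => loopOf hσ p.1 (Fintype.mem_piFinset.1 p.2), fun p q h => Subtype.ext <| funext
      fun i => by
        rw [← loopOf_pad hσ p.1 (Fintype.mem_piFinset.1 p.2) i,
          ← loopOf_pad hσ q.1 (Fintype.mem_piFinset.1 q.2) i]
        exact congrArg (fun l : X.EdgeLoop => l.pad i) h⟩

theorem mem_loopsIn {σ : ℕ → Finset V} (hσ : X.IsChain k σ) {l : X.EdgeLoop} :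
    l ∈ loopsIn hσ ↔ l.len = k ∧ ∀ i ≤ k, l.pad i ∈ σ i := by
  unfold loopsIn
  rw [Finset.mem_map]
  constructor
  · rintro ⟨p, -, rfl⟩
    refine ⟨rfl, fun i hi => ?_⟩
    have := Fintype.mem_piFinset.1 p.2 ⟨i, Nat.lt_succ_of_le hi⟩
    rw [← loopOf_pad hσ p.1 (Fintype.mem_piFinset.1 p.2)] at this
    exact this
  · rintro ⟨rfl, h⟩
    refine ⟨⟨fun i => l.pad i, Fintype.mem_piFinset.2 fun i => h i (Nat.le_of_lt_succ i.2)⟩,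
      Finset.mem_attach _ _, ?_⟩
    refine EdgeLoop.ext_pad rfl fun i => ?_
    rcases Nat.lt_or_ge i (l.len + 1) with hi | hi
    · exact loopOf_pad hσ _ (fun i => h i (Nat.le_of_lt_succ i.2)) ⟨i, hi⟩
    · rw [l.pad_of_le (by omega), EdgeLoop.pad_of_le _ (by change l.len ≤ i; omega)]

theorem sum_loopsIn {σ : ℕ → Finset V} (hσ : X.IsChain k σ) (F : (Fin (k + 1) → V) → ℝ) :
    ∑ l ∈ loopsIn hσ, F (fun i => l.pad i) =
      ∑ p ∈ Fintype.piFinset fun i : Fin (k + 1) => σ i, F p := by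
  unfold loopsIn
  rw [Finset.sum_map, ← Finset.sum_attach _ F]
  refine Finset.sum_congr rfl fun p _ => congrArg F (funext fun i => ?_)
  exact loopOf_pad hσ p.1 (Fintype.mem_piFinset.1 p.2) i

open Classical in
theorem loopsIn_mem {σ : ℕ → Finset V} (hσ : X.IsChain k σ) :
    loopsIn hσ ∈ (X.loopComplexUpTo k).faces := by
  have hne : (loopsIn hσ).Nonempty := by
    unfold loopsIn
    rw [Finset.map_nonempty, Finset.attach_nonempty_iff, Fintype.piFinset_nonempty]
    exact fun i => (X.isRelLowerSet_faces (hσ.mem i)).1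
  have hlen : ∀ l ∈ loopsIn hσ, l.len = k := fun l hl => ((mem_loopsIn hσ).1 hl).1
  have hcol : ∀ i ≤ k, column (loopsIn hσ) i ⊆ σ i := fun i hi v hv => by
    obtain ⟨l, hl, rfl⟩ := Finset.mem_image.1 hv
    exact ((mem_loopsIn hσ).1 hl).2 i hi
  obtain ⟨l, hl⟩ := hne
  refine ⟨⟨k, ⟨l, hl, hlen l hl⟩, fun l hl => .inl (hlen l hl), fun i hi => ?_⟩,
    fun l hl => (hlen l hl).le⟩
  exact (X.isRelLowerSet_faces (hσ.union_mem i)).2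
    (Finset.union_subset_union (hcol i hi.le) (hcol (i + 1) hi))
    ((column_nonempty ⟨l, hl⟩ i).mono Finset.subset_union_left)

open Classical in
/-- The weight of a loop in the product section. -/
def loopWeight (x : X.N k) (l : X.EdgeLoop) : ℝ :=
  if l.len = k then ∏ i : Fin (k + 1), (x.pt i).coord (l.pad i) else 0

theorem loopWeight_nonneg (x : X.N k) (l : X.EdgeLoop) : 0 ≤ loopWeight x l := by
  unfold loopWeight
  split_ifs
  exacts [Finset.prod_nonneg fun i _ => Realization.nonneg _ _, le_rfl]

theorem loopWeight_eq_zero {x : X.N k} {σ : ℕ → Finset V} (hσ : X.IsChain k σ)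
    (hx : ∀ i, (x.pt i).coord.support ⊆ σ i) {l : X.EdgeLoop} (hl : l ∉ loopsIn hσ) :
    loopWeight x l = 0 := by
  unfold loopWeight
  split_ifs with h
  · rw [mem_loopsIn] at hl
    push Not at hl
    obtain ⟨i, hi, hli⟩ := hl h
    exact Finset.prod_eq_zero (Finset.mem_univ ⟨i, Nat.lt_succ_of_le hi⟩)
      (Realization.coord_eq_zero _ (hx i) hli)
  · rfl

theorem loopWeight_of_mem {x : X.N k} {σ : ℕ → Finset V} {hσ : X.IsChain k σ} {l : X.EdgeLoop}
    (hl : l ∈ loopsIn hσ) : loopWeight x l = ∏ i : Fin (k + 1), (x.pt i).coord (l.pad i) :=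
  if_pos ((mem_loopsIn hσ).1 hl).1

theorem sum_loopWeight {x : X.N k} {σ : ℕ → Finset V} (hσ : X.IsChain k σ)
    (hx : ∀ i, (x.pt i).coord.support ⊆ σ i) : ∑ l ∈ loopsIn hσ, loopWeight x l = 1 := by
  rw [Finset.sum_congr rfl fun l hl => loopWeight_of_mem hl,
    sum_loopsIn hσ fun p => ∏ i : Fin (k + 1), (x.pt i).coord (p i), ← Finset.prod_univ_sum]
  exact Finset.prod_eq_one fun i _ => Realization.sum_face _ (hx i)

/-- The section of `r_k` given by the product of the barycentric coordinates. -/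
def productSection (X : BasedComplex V) (k : ℕ) :
    C(X.N k, (X.loopComplexUpTo k).Realization) where
  toFun x := Realization.ofWeights (loopsIn x.isChain_support) (loopWeight x)
    (loopsIn_mem x.isChain_support) (loopWeight_nonneg x)
    (fun _ hl => loopWeight_eq_zero x.isChain_support (fun _ => subset_rfl) hl)
    (sum_loopWeight x.isChain_support fun _ => subset_rfl)
  continuous_toFun := N.continuous_of_chains fun σ hσ S _ q hq hc => by
    refine Realization.continuous_of_mapsTo_face (loopsIn_mem hσ) (fun x l hl => ?_) fun l => ?_
    · by_contra hl'
      exact Finsupp.mem_support_iff.1 hl (loopWeight_eq_zero hσ (hq x) hl')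
    · change Continuous fun x => loopWeight (q x) l
      unfold loopWeight
      split_ifs
      · exact continuous_finsetProd _ fun i _ => hc _ _
      · exact continuous_const

theorem productSection_coord (x : X.N k) (l : X.EdgeLoop) :
    (X.productSection k x).coord l = loopWeight x l := rfl

theorem productSection_support {x : X.N k} {σ : ℕ → Finset V} (hσ : X.IsChain k σ)
    (hx : ∀ i, (x.pt i).coord.support ⊆ σ i) :
    (X.productSection k x).coord.support ⊆ loopsIn hσ := fun l hl => by
  by_contra hl'
  exact Finsupp.mem_support_iff.1 hl (loopWeight_eq_zero hσ hx hl')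

open Classical in
theorem r_productSection (x : X.N k) : X.r k (X.productSection k x) = x := by
  refine N.ext_coord fun i v => ?_
  rcases lt_or_ge k i with hi | hi
  · rw [N.pt_of_le _ hi.le, N.pt_of_le _ hi.le]
  have hσ := x.isChain_support
  let i' : Fin (k + 1) := ⟨i, Nat.lt_succ_of_le hi⟩
  change (X.productSection k x).coord.mapDomain (fun l => l.pad i) v = _
  rw [Realization.mapDomain_coord _ _ (productSection_support hσ fun _ => subset_rfl)]
  -- The indicator of `p i = v` is absorbed into the `i`-th factor. The sum then factors into one
  -- sum per index: those with `m ≠ i` are `1`, and the remaining one is the coordinate at `v`.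
  let F : (Fin (k + 1) → V) → ℝ := fun p => ∏ m : Fin (k + 1), ((x.pt m).coord (p m) *
    if m = i' then (if p m = v then 1 else 0) else 1)
  have h1 : ∀ l ∈ loopsIn hσ, (if l.pad i = v then (X.productSection k x).coord l else 0) =
      F fun m => l.pad m := fun l hl => by
    simp only [F]
    rw [Finset.prod_mul_distrib, Finset.prod_ite_eq' Finset.univ i'
      (fun m : Fin (k + 1) => if l.pad m = v then (1 : ℝ) else 0), if_pos (Finset.mem_univ _),
      productSection_coord, loopWeight_of_mem hl, mul_ite, mul_one, mul_zero]
  rw [Finset.sum_congr rfl h1, sum_loopsIn hσ F]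
  simp only [F]
  rw [← Finset.prod_univ_sum (fun m : Fin (k + 1) => (x.pt m).coord.support)
    (fun m w => (x.pt m).coord w * if m = i' then (if w = v then 1 else 0) else 1),
    Finset.prod_eq_single i']
  · simp only [if_true, mul_ite, mul_one, mul_zero]
    rw [Finset.sum_ite_eq']
    split_ifs with h
    · rfl
    · exact (Finsupp.notMem_support_iff.1 h).symm
  · intro m _ hm
    simp only [if_neg hm, mul_one]
    exact Realization.sum_face _ subset_rfl
  · exact fun h => absurd (Finset.mem_univ _) h

/-! ### `r_k` is a deformation retraction -/

/-- The map that extends all loops of length less than `m` to length `m`. -/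
def extendMap (X : BasedComplex V) {k m : ℕ} (hm : m ≤ k) :
    C((X.loopComplexUpTo k).Realization, (X.loopComplexUpTo k).Realization) :=
  Realization.map (EdgeLoop.extend m) fun _ hs => by
    classical
    convert extend_mem hs hm

theorem r_extendMap {m : ℕ} (hm : m ≤ k) (p : (X.loopComplexUpTo k).Realization) :
    X.r k (X.extendMap hm p) = X.r k p := by
  refine N.ext_coord fun i v => ?_
  change (X.extendMap hm p).coord.mapDomain (fun l => l.pad i) v =
    p.coord.mapDomain (fun l => l.pad i) v
  unfold extendMap
  rw [Realization.map_coord, ← Finsupp.mapDomain_comp]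
  congr 2
  funext l
  exact l.extend_pad m i

theorem extendMap_of_len {m : ℕ} (hm : m ≤ k) {p : (X.loopComplexUpTo k).Realization}
    (hp : ∀ l ∈ p.coord.support, m ≤ l.len) : X.extendMap hm p = p := by
  refine Realization.ext ?_
  unfold extendMap
  rw [Realization.map_coord, Finsupp.mapDomain_congr (f := EdgeLoop.extend m) (g := id)
    fun l hl => EdgeLoop.extend_of_le (hp l hl), Finsupp.mapDomain_id]

theorem extendMap_productSection {m : ℕ} (hm : m ≤ k) (x : X.N k) :
    X.extendMap hm (X.productSection k x) = X.productSection k x :=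
  extendMap_of_len hm fun l hl => by
    have := productSection_support x.isChain_support (fun _ => subset_rfl) hl
    rw [((mem_loopsIn _).1 this).1]
    exact hm

theorem extendMap_support {m : ℕ} (hm : m ≤ k) {p : (X.loopComplexUpTo k).Realization}
    {s : Finset X.EdgeLoop} (hp : p.coord.support ⊆ s) {l : X.EdgeLoop}
    (hl : l ∈ (X.extendMap hm p).coord.support) : ∃ l' ∈ s, l'.extend m = l := by
  classical
  unfold extendMap at hl
  rw [Realization.map_coord] at hl
  obtain ⟨l', hl', rfl⟩ := Finset.mem_image.1 (Finsupp.mapDomain_support hl)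
  exact ⟨l', hp hl', rfl⟩

/-- A self-map of `|ΩX(k)|` over `N(k)` which fixes the product section. -/
def IsFibrewise (f : C((X.loopComplexUpTo k).Realization, (X.loopComplexUpTo k).Realization)) :
    Prop :=
  (∀ p, X.r k (f p) = X.r k p) ∧ ∀ x, f (X.productSection k x) = X.productSection k x

/-- `r_k` is affine on faces, so on a straight line between two points with the same image it is
constant; a line between equal points is constant too. -/
theorem homotopicWith_of_faces
    {f₀ f₁ : C((X.loopComplexUpTo k).Realization, (X.loopComplexUpTo k).Realization)}
    (h₀ : IsFibrewise f₀) (h₁ : IsFibrewise f₁)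
    (h : ∀ s ∈ (X.loopComplexUpTo k).faces, ∃ t ∈ (X.loopComplexUpTo k).faces,
      ∀ p : (X.loopComplexUpTo k).Realization, p.coord.support ⊆ s →
        (f₀ p).coord.support ⊆ t ∧ (f₁ p).coord.support ⊆ t) :
    ContinuousMap.HomotopicWith f₀ f₁ IsFibrewise := by
  obtain ⟨H, hH⟩ := Realization.exists_linear_homotopy h
  refine ⟨⟨H, fun t => ⟨fun p => N.ext_coord fun i v => ?_, fun x =>
    Realization.ext_coord fun l => ?_⟩⟩⟩
  · change (H (t, p)).coord.mapDomain (fun l => l.pad i) v = _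
    have hc : (H (t, p)).coord = (1 - t.1) • (f₀ p).coord + t.1 • (f₁ p).coord :=
      Finsupp.ext fun l => hH t p l
    rw [hc, Finsupp.mapDomain_add, Finsupp.mapDomain_smul, Finsupp.mapDomain_smul]
    change (1 - t.1) * ((X.r k (f₀ p)).pt i).coord v + t.1 * ((X.r k (f₁ p)).pt i).coord v = _
    rw [h₀.1, h₁.1]
    ring
  · change (H (t, X.productSection k x)).coord l = _
    rw [hH, h₀.2, h₁.2]
    ring

open Classical in
theorem homotopicWith_extendMap {m : ℕ} (hm : m ≤ k) :
    ContinuousMap.HomotopicWith (.id (X.loopComplexUpTo k).Realization) (X.extendMap hm)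
      IsFibrewise := by
  induction m with
  | zero =>
    have : X.extendMap hm = .id _ :=
      ContinuousMap.ext fun p => extendMap_of_len hm fun l _ => Nat.zero_le _
    rw [this]
    exact .refl _ ⟨fun _ => rfl, fun _ => rfl⟩
  | succ m ih =>
    refine (ih (Nat.le_of_succ_le hm)).trans (homotopicWith_of_faces
      ⟨r_extendMap _, extendMap_productSection _⟩ ⟨r_extendMap _, extendMap_productSection _⟩
      fun s hs => ⟨_, extend_union_mem hs hm, fun p hp => ⟨fun l hl => ?_, fun l hl => ?_⟩⟩)
    · obtain ⟨l', hl', rfl⟩ := extendMap_support _ hp hl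
      exact Finset.mem_union_left _ (Finset.mem_image_of_mem _ hl')
    · obtain ⟨l', hl', rfl⟩ := extendMap_support _ hp hl
      exact Finset.mem_union_right _ (Finset.mem_image_of_mem _ hl')

open Classical in
/-- The product section is a fibrewise homotopy inverse of `r_k`. -/
theorem homotopicWith_productSection (X : BasedComplex V) (k : ℕ) :
    ContinuousMap.HomotopicWith (.id (X.loopComplexUpTo k).Realization)
      ((X.productSection k).comp (X.r k)) IsFibrewise := by
  refine (homotopicWith_extendMap le_rfl).trans (homotopicWith_of_faces
    ⟨r_extendMap le_rfl, extendMap_productSection le_rfl⟩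
    ⟨fun p => r_productSection _, fun x => congrArg (X.productSection k) (r_productSection x)⟩
    -- Once all loops have length `k`, they are among the loops through the columns of `s`. The
    -- section takes values in that same simplex.
    fun s hs => ⟨loopsIn (isChain_column hs), loopsIn_mem _, fun p hp => ⟨fun l hl => ?_, ?_⟩⟩)
  · obtain ⟨l', hl', rfl⟩ := extendMap_support _ hp hl
    refine (mem_loopsIn _).2 ⟨max_eq_right (hs.2 l' hl'), fun i _ => ?_⟩
    rw [l'.extend_pad]
    exact Finset.mem_image_of_mem _ hl'
  · exact productSection_support (isChain_column hs) fun i =>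
      (columnPoint_support p i).trans (Finset.image_subset_image hp)

/-- A homotopy from `s r` to the identity over `N(k)` and relative to the image of `s`. -/
theorem exists_fibrewise_contraction (X : BasedComplex V) (k : ℕ) :
    ∃ K : C((X.loopComplexUpTo k).Realization × ℝ, (X.loopComplexUpTo k).Realization),
      (∀ p t, t ≤ 0 → K (p, t) = X.productSection k (X.r k p)) ∧
      (∀ p t, 1 ≤ t → K (p, t) = p) ∧ (∀ p t, X.r k (K (p, t)) = X.r k p) ∧
      ∀ x t, K (X.productSection k x, t) = X.productSection k x := by
  obtain ⟨H⟩ := homotopicWith_productSection X k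
  refine ⟨⟨fun q => H.toHomotopy.extend (1 - q.2) q.1, ?_⟩, fun p t ht => ?_, fun p t ht => ?_,
    fun p t => (H.extendProp (1 - t)).1 p, fun x t => (H.extendProp (1 - t)).2 x⟩
  · exact H.toHomotopy.continuous.comp
      ((continuous_projIcc.comp (continuous_const.sub continuous_snd)).prodMk continuous_fst)
  · exact H.toHomotopy.extend_apply_of_one_le (by linarith) p
  · exact H.toHomotopy.extend_apply_of_le_zero (by linarith) p

/-- A homotopy with parameter in `ℝ`. -/
theorem exists_real_homotopy {A B : Type*} [TopologicalSpace A] [TopologicalSpace B] {f g : C(A, B)}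
    (h : f.Homotopic g) : ∃ M : C(A × ℝ, B), (∀ x t, t ≤ 0 → M (x, t) = f x) ∧
      ∀ x t, 1 ≤ t → M (x, t) = g x := by
  obtain ⟨H⟩ := h
  refine ⟨⟨fun q => H.extend q.2 q.1, ?_⟩, fun x t ht => H.extend_apply_of_le_zero ht x,
    fun x t ht => H.extend_apply_of_one_le ht x⟩
  exact H.continuous.comp ((continuous_projIcc.comp continuous_snd).prodMk continuous_fst)

/-- The homotopy `L` is constant, so coherence says that the contraction `K` lies over `N(k)`. -/
theorem nonempty_coherentInverse_r {Rb : C((X.loopComplexUpTo k).Realization, X.N k)}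
    (h : Rb.Homotopic (X.r k)) : Nonempty (CoherentInverse Rb) := by
  obtain ⟨K, hK0, hK1, hKr, -⟩ := exists_fibrewise_contraction X k
  obtain ⟨M, hM0, hM1⟩ := exists_real_homotopy h
  exact ⟨{
    R := X.r k
    S := X.productSection k
    K := K
    L := .fst
    M := M
    K_zero := hK0
    K_one := hK1
    L_zero := fun z _ _ => (r_productSection z).symm
    L_one := fun _ _ _ => rfl
    R_K := hKr
    M_zero := hM0
    M_one := hM1 }⟩

/-- The roles are exchanged: now `K` is constant, and coherence says that the contraction fixes the
section. -/
theorem nonempty_coherentInverse_productSection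
    {Sb : C(X.N k, (X.loopComplexUpTo k).Realization)}
    (h : Sb.Homotopic (X.productSection k)) : Nonempty (CoherentInverse Sb) := by
  obtain ⟨K, hK0, hK1, -, hKs⟩ := exists_fibrewise_contraction X k
  obtain ⟨M, hM0, hM1⟩ := exists_real_homotopy h
  exact ⟨{
    R := X.productSection k
    S := X.r k
    K := .fst
    L := K
    M := M
    K_zero := fun x _ _ => (r_productSection x).symm
    K_one := fun _ _ _ => rfl
    L_zero := hK0
    L_one := hK1
    R_K := fun x t => (hKs x t).symm
    M_zero := hM0
    M_one := hM1 }⟩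

/-- A right homotopy inverse of a map homotopic to `r_k` is homotopic to the product section. -/
theorem homotopic_productSection {Rb : C((X.loopComplexUpTo k).Realization, X.N k)}
    (h : Rb.Homotopic (X.r k)) {Sb : C(X.N k, (X.loopComplexUpTo k).Realization)}
    (hS : (Rb.comp Sb).Homotopic (.id _)) : Sb.Homotopic (X.productSection k) := by
  have h1 : ((X.r k).comp Sb).Homotopic (.id _) :=
    (ContinuousMap.Homotopic.comp h (.refl Sb)).symm.trans hS
  have h2 : (ContinuousMap.id _).Homotopic ((X.productSection k).comp (X.r k)) := by
    obtain ⟨H⟩ := homotopicWith_productSection X k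
    exact ⟨H.toHomotopy⟩
  have h3 := ContinuousMap.Homotopic.comp h2 (.refl Sb)
  have h4 := ContinuousMap.Homotopic.comp (.refl (X.productSection k)) h1
  rw [ContinuousMap.comp_id] at h4
  rw [ContinuousMap.id_comp, ContinuousMap.comp_assoc] at h3
  exact h3.trans h4

end BasedComplex

/-! ### Passage to the limit -/

theorem PartitionSequence.exists_le_k (S : PartitionSequence) (m : ℕ) : ∃ n, m ≤ S.k n := by
  obtain ⟨n, hn⟩ := S.mesh (1 / (m + 1)) (by positivity)
  refine ⟨n, ?_⟩
  -- The `k n` intervals have total length `1`, and each is shorter than `1 / (m + 1)`.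
  have h1 : ∑ i ∈ Finset.range (S.k n), (S.t n (i + 1) - S.t n i) = 1 := by
    rw [Finset.sum_range_sub (S.t n), S.t_last, S.t_zero, sub_zero]
  have h2 : ∑ i ∈ Finset.range (S.k n), (S.t n (i + 1) - S.t n i) ≤
      ∑ _i ∈ Finset.range (S.k n), (1 / (m + 1) : ℝ) :=
    Finset.sum_le_sum fun i hi => (hn n le_rfl i (Finset.mem_range.1 hi)).le
  rw [h1, Finset.sum_const, Finset.card_range, nsmul_eq_mul, mul_one_div,
    le_div_iff₀ (by positivity), one_mul] at h2
  have : (m : ℝ) ≤ S.k n := by linarith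
  exact_mod_cast this

namespace BasedComplex

open PreAbstractSimplicialComplex

variable {V : Type u} {X : BasedComplex V} (S : PartitionSequence)

theorem nonempty_jDeformation (X : BasedComplex V) (n : ℕ) :
    Nonempty (NeighbourhoodDeformation (X.j S n)) :=
  Realization.nonempty_neighbourhoodDeformation _ (fun l : X.EdgeLoop => l.len ≤ S.k n)
    fun _ => ⟨fun hs => ⟨X.loopComplexUpTo_mono (S.k_le n) hs, hs.2⟩, fun hs => ⟨hs.1.1, hs.2⟩⟩

/-- Every finite set of loops consists of loops of length at most some `k n`. -/
theorem exists_mem_loopComplexUpTo {s : Finset X.EdgeLoop} (hs : s ∈ X.loopComplex.faces) :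
    ∃ n, s ∈ (X.loopComplexUpTo (S.k n)).faces := by
  obtain ⟨n, hn⟩ := S.exists_le_k (s.sup EdgeLoop.len)
  exact ⟨n, hs, fun l hl => (Finset.le_sup (f := EdgeLoop.len) hl).trans hn⟩

theorem exists_inclLoop_eq (p : X.loopComplex.Realization) :
    ∃ n q, X.inclLoop (S.k n) q = p := by
  obtain ⟨n, hn⟩ := exists_mem_loopComplexUpTo S p.support_mem
  exact ⟨n, ⟨p.coord, p.nonneg, p.sum_eq, hn⟩, rfl⟩

/-- The canonical map from the direct limit of the `|ΩX(k)|` to `|ΩX|`. -/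
def colimToLoop (X : BasedComplex V) : C(SeqColim (X.j S), X.loopComplex.Realization) :=
  SeqColim.desc (fun n => X.inclLoop (S.k n)) fun _ _ => rfl

theorem of_eq_of_add {n : ℕ} (m : ℕ) {q : (X.loopComplexUpTo (S.k n)).Realization}
    {q' : (X.loopComplexUpTo (S.k (n + m))).Realization} (h : q.coord = q'.coord) :
    SeqColim.of (X.j S) n q = SeqColim.of (X.j S) (n + m) q' := by
  induction m with
  | zero => exact congrArg (SeqColim.of (X.j S) n) (Realization.ext h)
  | succ m ih =>
    have hmem : q.coord.support ∈ (X.loopComplexUpTo (S.k (n + m))).faces :=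
      ⟨q.support_mem.1, fun l hl => (q.support_mem.2 l hl).trans
        (monotone_nat_of_le_succ S.k_le (Nat.le_add_right n m))⟩
    rw [ih (q' := ⟨q.coord, q.nonneg, q.sum_eq, hmem⟩) rfl, ← SeqColim.of_step]
    exact congrArg (SeqColim.of (X.j S) (n + m + 1)) (Realization.ext h)

theorem of_eq_of_coord_eq {n n' : ℕ} {q : (X.loopComplexUpTo (S.k n)).Realization}
    {q' : (X.loopComplexUpTo (S.k n')).Realization} (h : q.coord = q'.coord) :
    SeqColim.of (X.j S) n q = SeqColim.of (X.j S) n' q' := by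
  rcases le_total n n' with hn | hn
  · obtain ⟨m, rfl⟩ := Nat.exists_eq_add_of_le hn
    exact of_eq_of_add S m h
  · obtain ⟨m, rfl⟩ := Nat.exists_eq_add_of_le hn
    exact (of_eq_of_add S m h.symm).symm

/-- The realization `|ΩX|` is the direct limit of the `|ΩX(k)|`. -/
theorem exists_colimToLoop_inverse (X : BasedComplex V) :
    ∃ ψ : C(X.loopComplex.Realization, SeqColim (X.j S)),
      (∀ n q, ψ (X.inclLoop (S.k n) q) = SeqColim.of (X.j S) n q) := by
  choose n hn using fun p : X.loopComplex.Realization =>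
    exists_mem_loopComplexUpTo S p.support_mem
  let ψ : X.loopComplex.Realization → SeqColim (X.j S) := fun p =>
    SeqColim.of (X.j S) (n p) ⟨p.coord, p.nonneg, p.sum_eq, hn p⟩
  refine ⟨⟨ψ, Realization.continuous_of_faces fun s hs T _ q hq hc => ?_⟩, fun m q =>
    of_eq_of_coord_eq S rfl⟩
  -- The stages chosen for individual points are arbitrary, but the points of one face all come from
  -- a common stage, and the class in the direct limit does not depend on the stage.
  obtain ⟨m, hm⟩ := exists_mem_loopComplexUpTo S hs
  let q' : T → (X.loopComplexUpTo (S.k m)).Realization := fun x =>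
    ⟨(q x).coord, (q x).nonneg, (q x).sum_eq,
      ((X.loopComplexUpTo (S.k m)).isRelLowerSet_faces hm).2 (hq x) (q x).support_nonempty⟩
  have hq' : Continuous q' := Realization.continuous_of_mapsTo_face hm hq hc
  refine ((SeqColim.of (X.j S) m).continuous.comp hq').congr fun x => ?_
  exact of_eq_of_coord_eq S rfl

/-- The maps `r_k` can be rigidified. -/
theorem exists_isStrictLadder (X : BasedComplex V) : ∃ rbar, X.IsStrictLadder S rbar := by
  choose c hc0 hc1 using fun n => exists_real_homotopy (ι_comp_r_homotopic X S n)
  -- Lifting `r_k` along identity maps yields homotopic maps; only strict commutativity is gained.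
  obtain ⟨l, k, a, ha, -, hl, hk0, hk1, -, -⟩ := exists_strict_lift (X.ι S) (X.ι S)
    (fun n => (nonempty_jDeformation S X n).some) (fun n => .id (X.N (S.k n))) (fun _ _ => rfl)
    (fun n => CoherentInverse.id _) (fun n => X.r (S.k n)) c hc0 hc1
  refine ⟨l, fun n => ⟨homotopic_of_realHomotopy (k n) (fun x => hk0 n x 0 le_rfl) (hk1 n), ?_⟩⟩
  exact ContinuousMap.ext fun x => (hl n x).symm

/-- A strict ladder of maps homotopic to the `r_k` induces a homotopy equivalence of the direct
limits. -/
theorem isHomotopyEquivalence_map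
    {rbar : ∀ n, C((X.loopComplexUpTo (S.k n)).Realization, X.N (S.k n))}
    (h : X.IsStrictLadder S rbar)
    (hc : ∀ n x, X.ι S n (rbar n x) = rbar (n + 1) (X.j S n x)) :
    IsHomotopyEquivalence (SeqColim.map (f := X.j S) (g := X.ι S) rbar hc) := by
  obtain ⟨s, hs, hrs, hRS⟩ := exists_right_inverse_ladder (ιDeformation X S ·) rbar hc
    fun n => (nonempty_coherentInverse_r (h n).1).some
  -- The right inverses `s n` are homotopic to the product sections, hence have coherent inverses
  -- themselves. Here the sequence of the `|ΩX(k)|` is the one that must consist of neighbourhood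
  -- deformation retracts.
  obtain ⟨r', hr', -, hSR⟩ := exists_right_inverse_ladder
    (fun n => (nonempty_jDeformation S X n).some) s hs
    fun n => (nonempty_coherentInverse_productSection
      (homotopic_productSection (h n).1 (hrs n))).some
  exact isHomotopyEquivalence_of_right_inverses hRS hSR

end BasedComplex

end

theorem mainTheorem2 {V : Type*} (X : BasedComplex V) (S : PartitionSequence) :
    (∃ rbar, X.IsStrictLadder S rbar) ∧
    IsHomotopyEquivalence (Telescope.toColim (X.ι S)) ∧
    ∀ rbar, X.IsStrictLadder S rbar →
      ∃ R : C(X.loopComplex.Realization, SeqColim (X.ι S)),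
        (∀ n, R.comp (X.inclLoop (S.k n)) = (SeqColim.of (X.ι S) n).comp (rbar n)) ∧
        (∀ R' : C(X.loopComplex.Realization, SeqColim (X.ι S)),
          (∀ n, R'.comp (X.inclLoop (S.k n)) = (SeqColim.of (X.ι S) n).comp (rbar n)) → R' = R) ∧
        IsHomotopyEquivalence R := by
  refine ⟨BasedComplex.exists_isStrictLadder S X,
    Telescope.isHomotopyEquivalence_toColim fun n => BasedComplex.ιDeformation X S (n := n),
    fun rbar h => ?_⟩
  have hc : ∀ n x, X.ι S n (rbar n x) = rbar (n + 1) (X.j S n x) := fun n x =>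
    DFunLike.congr_fun (h n).2 x
  obtain ⟨ψ, hψ⟩ := BasedComplex.exists_colimToLoop_inverse S X
  obtain ⟨G, hG1, hG2⟩ := BasedComplex.isHomotopyEquivalence_map S h hc
  -- The maps between `|ΩX|` and the direct limit of the `|ΩX(k)|` are strictly inverse, so the
  -- equivalence of direct limits transfers to `|ΩX|`.
  have hψ1 : ψ.comp (BasedComplex.colimToLoop S X) = .id _ :=
    ContinuousMap.ext fun z => congrFun (SeqColim.ext (φ := ψ.comp (BasedComplex.colimToLoop S X))
      (ψ := id) hψ) z
  have hψ2 : (BasedComplex.colimToLoop S X).comp ψ = .id _ := ContinuousMap.ext fun p => by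
    obtain ⟨n, q, rfl⟩ := BasedComplex.exists_inclLoop_eq S p
    exact congrArg (BasedComplex.colimToLoop S X) (hψ n q)
  have hR : ∀ n q, ((SeqColim.map rbar hc).comp ψ) (X.inclLoop (S.k n) q) =
      SeqColim.of (X.ι S) n (rbar n q) := fun n q =>
    congrArg (SeqColim.map rbar hc) (hψ n q)
  refine ⟨(SeqColim.map rbar hc).comp ψ, fun n => ContinuousMap.ext (hR n), fun R' hR' =>
    ContinuousMap.ext fun p => ?_, (BasedComplex.colimToLoop S X).comp G, ?_, ?_⟩
  · obtain ⟨n, q, rfl⟩ := BasedComplex.exists_inclLoop_eq S p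
    rw [hR]
    exact DFunLike.congr_fun (hR' n) q
  · have h1 : ((BasedComplex.colimToLoop S X).comp ((G.comp (SeqColim.map rbar hc)).comp
        ψ)).Homotopic ((BasedComplex.colimToLoop S X).comp ((ContinuousMap.id _).comp ψ)) :=
      .comp (.refl _) (.comp hG1 (.refl _))
    rwa [ContinuousMap.id_comp, hψ2] at h1
  · have h1 : ((SeqColim.map rbar hc).comp ψ).comp ((BasedComplex.colimToLoop S X).comp G) =
        ((SeqColim.map rbar hc).comp (ψ.comp (BasedComplex.colimToLoop S X))).comp G := rfl
    rw [h1, hψ1, ContinuousMap.comp_id]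
    exact hG2
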